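/- **Setting.** Let $q(x,t)$ be a $C^2$ solution on $\mathbb{R}^2$ of the derivative NLS equation $iq_t+q_{xx}-i(|q|^2q)_x=0$ with zero boundary conditions: $q$ and $q_x$ are integrable in $x$ and tend to $0$ as $x\to\pm\infty$, locally uniformly in $t$ (for every $R$ there is an integrable $g$ with $g(x)\to0$ as $x\to\pm\infty$ and $|q(x,t)|,|q_x(x,t)|\le g(x)$ for $|t|\le R$). Put $\sigma_3=\mathrm{diag}(1,-1)$, $Q=\begin{bmatrix}0&q\\-q^*&0\end{bmatrix}$, $X=ik^2\sigma_3+kQ$, $\theta(x,t;k)=k^2(x-2k^2t)$, $\Sigma=\mathbb{R}\cup i\mathbb{R}$, $D^{\pm}=\{k\in\mathbb{C}:\pm\,\mathrm{Re}\,k\,\mathrm{Im}\,k>0\}$, and orient $\Sigma$ so that $D^+$ lies on its left. Let $\Phi_\pm(x,t;k)$ be the Jost solutions: $\Phi_{\pm,x}=X\Phi_\pm$ and $\mu_\pm:=\Phi_\pm e^{-i\theta\sigma_3}\to I$ as $x\to\pm\infty$; their $j$-th columns are $\Phi_{\pm j},\mu_{\pm j}$. They exist for $k\in\Sigma$, the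 columns $\Phi_{+1},\Phi_{-2}$ extend (with the same normalization) to $D^+\cup\Sigma$ and $\Phi_{-1},\Phi_{+2}$ to $D^-\cup\Sigma$. Let $S(k)=(s_{ij}(k))$ be the scattering matrix, $\Phi_+=\Phi_-S$ on $\Sigma$ ($S$ does not depend on $x,t$), with $s_{11}=\det(\Phi_{+1},\Phi_{-2})$ on $D^+\cup\Sigma$ and $s_{22}=\det(\Phi_{-1},\Phi_{+2})$ on $D^-\cup\Sigma$, and let $\rho=s_{21}/s_{11}$, $\tilde\rho=s_{12}/s_{22}$. Assume that $s_{11}$ and $s_{22}$ have no zeros on $\Sigma$ and that the zeros of $s_{11}$ in the open first quadrant are exactly $N\ge 0$ distinct points $k_1,\dots,k_N$, with $s_{11}'(k_n)=0\neq s_{11}''(k_n)$. Let $K=\{k_n,k_n^*,-k_n^*,-k_n\}_{n=1}^N$, and $\eta_n=k_n$, $\eta_{N+n}=-k_n$ for $1\le n\le N$. For $k_0\in K\cap D^+$ define scalars $b[k_0],d[k_0]$ by $\Phi_{+1}(k_0)=b[k_0]\Phi_{-2}(k_0)$ and $\Phi_{+1}'(k_0)-b[k_0]\Phi_{-2}'(k_0)=d[k_0]\Phi_{-2}(k_0)$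 (they do not depend on $x,t$; $'$ is $\partial_k$), and $$A[k_0]=\frac{2b[k_0]}{s_{11}''(k_0)},\qquad B[k_0]=\frac{d[k_0]}{b[k_0]}-\frac{s_{11}'''(k_0)}{3s_{11}''(k_0)};$$ for $k_0\in K\cap D^-$ use the same definitions with $\Phi_{+2},\Phi_{-1},s_{22}$ in place of $\Phi_{+1},\Phi_{-2},s_{11}$. Put $v_-(x,t)=\frac12\int_{-\infty}^x|q(y,t)|^2\,dy$, $$M=\Big(\frac{\mu_{+1}}{s_{11}},\mu_{-2}\Big)\ \text{on } D^+,\qquad M=\Big(\mu_{-1},\frac{\mu_{+2}}{s_{22}}\Big)\ \text{on } D^-,\qquad J=e^{i\theta\sigma_3}\begin{bmatrix}0&-\tilde\rho\\ \rho&\rho\tilde\rho\end{bmatrix}e^{-i\theta\sigma_3}.$$ **Proposition (solution of the Riemann–Hilbert problem, ZBC).** Fix $(x,t)\in\mathbb{R}^2$. The matrix $M(x,t;k)$ solves the Riemann–Hilbert problem: it is analytic in $(D^+\cup D^-)\setminus K$ with double poles at the points of $K$, it has boundary values $M^\pm(k)=\lim_{k'\to k,\,k'\in D^\pm}M(k')$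 on $\Sigma$, given by the two formulas above, with $M^-=M^+(I-J)$, and $M=e^{iv_-\sigma_3}+O(1/k)$ as $k\to\infty$. This solution is given, for $k\in\mathbb{C}\setminus(\Sigma\cup K)$, by $$M(x,t;k)=e^{iv_-\sigma_3}+\frac1{2\pi i}\int_\Sigma\frac{(M^+J)(x,t;\zeta)}{\zeta-k}\,d\zeta+\sum_{n=1}^{2N}\Big(C_n(k)\Big[\mu_{-2}'(\eta_n)+\Big(D_n+\tfrac1{k-\eta_n}\Big)\mu_{-2}(\eta_n)\Big],\ \widehat C_n(k)\Big[\mu_{-1}'(\eta_n^*)+\Big(\widehat D_n+\tfrac1{k-\eta_n^*}\Big)\mu_{-1}(\eta_n^*)\Big]\Big),$$ where $$C_n(k)=\frac{A[\eta_n]}{k-\eta_n}e^{-2i\theta(\eta_n)},\quad D_n=B[\eta_n]-2i\theta'(\eta_n),\quad \widehat C_n(k)=\frac{A[\eta_n^*]}{k-\eta_n^*}e^{2i\theta(\eta_n^*)},\quad \widehat D_n=B[\eta_n^*]+2i\theta'(\eta_n^*),$$ and for all $n=1,\dots,2N$ (subscripts $1,2$ on $M^+J$ denote columns) $$\mu_{-1}(\eta_n^*)=e^{iv_-\sigma_3}\begin{bmatrix}1\\0\end{bmatrix}+\sum_{l=1}^{2N}C_l(\eta_n^*)\Big[\mu_{-2}'(\eta_l)+\Big(D_l+\tfrac1{\eta_n^*-\eta_l}\Big)\mu_{-2}(\eta_l)\Big]+\frac1{2\pi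 i}\int_\Sigma\frac{(M^+J)_1(\zeta)}{\zeta-\eta_n^*}\,d\zeta,$$ $$\mu_{-1}'(\eta_n^*)=-\sum_{l=1}^{2N}\frac{C_l(\eta_n^*)}{\eta_n^*-\eta_l}\Big[\mu_{-2}'(\eta_l)+\Big(D_l+\tfrac2{\eta_n^*-\eta_l}\Big)\mu_{-2}(\eta_l)\Big]+\frac1{2\pi i}\int_\Sigma\frac{(M^+J)_1(\zeta)}{(\zeta-\eta_n^*)^2}\,d\zeta,$$ $$\mu_{-2}(\eta_n)=e^{iv_-\sigma_3}\begin{bmatrix}0\\1\end{bmatrix}+\sum_{j=1}^{2N}\widehat C_j(\eta_n)\Big[\mu_{-1}'(\eta_j^*)+\Big(\widehat D_j+\tfrac1{\eta_n-\eta_j^*}\Big)\mu_{-1}(\eta_j^*)\Big]+\frac1{2\pi i}\int_\Sigma\frac{(M^+J)_2(\zeta)}{\zeta-\eta_n}\,d\zeta,$$ $$\mu_{-2}'(\eta_n)=-\sum_{j=1}^{2N}\frac{\widehat C_j(\eta_n)}{\eta_n-\eta_j^*}\Big[\mu_{-1}'(\eta_j^*)+\Big(\widehat D_j+\tfrac2{\eta_n-\eta_j^*}\Big)\mu_{-1}(\eta_j^*)\Big]+\frac1{2\pi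 i}\int_\Sigma\frac{(M^+J)_2(\zeta)}{(\zeta-\eta_n)^2}\,d\zeta.$$ All the integrals over $\Sigma$ converge absolutely, and $\mu_{-1}$ is complex differentiable in $k$ at $\eta_n^*$ and $\mu_{-2}$ at $\eta_n$. -/

import Mathlib

open Filter Topology MeasureTheory Matrix
open scoped ComplexConjugate

noncomputable section

namespace DNLS

/-! ### The equation and its Lax pair (`σ = -1`) -/

/-- `q = q(x,t)` is a classical solution of `i q_t + q_xx - i (|q|² q)_x = 0` with zero boundary
conditions: `q` and `q_x` are integrable in `x` and vanish as `x → ±∞`, locally uniformly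
in `t`. -/
structure IsSolutionZBC (q : ℝ → ℝ → ℂ) : Prop where
  smooth : ContDiff ℝ 2 (fun p : ℝ × ℝ => q p.1 p.2)
  dnls : ∀ x t : ℝ,
    Complex.I * deriv (fun τ => q x τ) t + deriv (fun y => deriv (fun z => q z t) y) x
      + Complex.I * (-1) * deriv (fun y => ((‖q y t‖ ^ 2 : ℝ) : ℂ) * q y t) x = 0
  decay : ∀ R : ℝ, ∃ g : ℝ → ℝ, Integrable g ∧ Tendsto g (cocompact ℝ) (𝓝 0) ∧
    ∀ x t : ℝ, |t| ≤ R → ‖q x t‖ ≤ g x ∧ ‖deriv (fun y => q y t) x‖ ≤ g x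

/-- `X(x,t;k) = i k² σ₃ + k Q(x,t)`. -/
def laxX (q : ℝ → ℝ → ℂ) (x t : ℝ) (k : ℂ) : Matrix (Fin 2) (Fin 2) ℂ :=
  (Complex.I * k ^ 2) • !![1, 0; 0, -1] + k • !![0, q x t; -conj (q x t), 0]

/-- `θ(x,t;k) = k² (x - 2 k² t)`. -/
def theta (x t : ℝ) (k : ℂ) : ℂ := k ^ 2 * (x - 2 * k ^ 2 * t)

/-- `e^{i z σ₃}`. -/
def expSigma (z : ℂ) : Matrix (Fin 2) (Fin 2) ℂ :=
  Matrix.diagonal ![Complex.exp (Complex.I * z), Complex.exp (-(Complex.I * z))]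

/-- The contour `Σ = ℝ ∪ iℝ`. -/
def Sig : Set ℂ := {k | k.re * k.im = 0}

def Dplus : Set ℂ := {k | 0 < k.re * k.im}

def Dminus : Set ℂ := {k | k.re * k.im < 0}

/-- The matrix with columns `u` and `v`. -/
def cols (u v : Fin 2 → ℂ) : Matrix (Fin 2) (Fin 2) ℂ := !![u 0, v 0; u 1, v 1]

/-- Wronskian of two columns. -/
def wr (u v : Fin 2 → ℂ) : ℂ := (cols u v).det

/-! ### Jost solutions

Columns are indexed by `Fin 2`, so column `j` of the usual notation is column `j - 1` here. -/

/-- The diagonal entries `1, -1` of `σ₃`. -/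
def sgn (j : Fin 2) : ℂ := ![1, -1] j

/-- `φ` is, at time `t`, the `j`-th column of the Jost solution normalised at the end `l` of the
line (`l = atBot` or `l = atTop`): `φ_x = X φ` and `e^{∓iθ} φ → e_j` along `l`. It exists and is
unique for all `k ∈ Σ`, for the columns `Φ₊₁, Φ₋₂` also for `k ∈ D⁺`, and for the columns
`Φ₋₁, Φ₊₂` also for `k ∈ D⁻`. -/
def IsJostColumn (q : ℝ → ℝ → ℂ) (l : Filter ℝ) (j : Fin 2) (t : ℝ) (k : ℂ)
    (φ : ℝ → Fin 2 → ℂ) : Prop :=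
  (∀ x : ℝ, HasDerivAt φ (laxX q x t k *ᵥ φ x) x) ∧
  Tendsto (fun x : ℝ => Complex.exp (-(sgn j * Complex.I * theta x t k)) • φ x) l
    (𝓝 (Pi.single j 1))

/-- `Φ_{+j}(x,t;k)`. -/
def phiPlus (q : ℝ → ℝ → ℂ) (j : Fin 2) (x t : ℝ) (k : ℂ) : Fin 2 → ℂ :=
  Classical.epsilon (IsJostColumn q atTop j t k) x

/-- `Φ_{-j}(x,t;k)`. -/
def phiMinus (q : ℝ → ℝ → ℂ) (j : Fin 2) (x t : ℝ) (k : ℂ) : Fin 2 → ℂ :=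
  Classical.epsilon (IsJostColumn q atBot j t k) x

/-- `μ_{+j}`, the `j`-th column of `Φ₊ e^{-iθσ₃}`. -/
def muPlus (q : ℝ → ℝ → ℂ) (j : Fin 2) (x t : ℝ) (k : ℂ) : Fin 2 → ℂ :=
  Complex.exp (-(sgn j * Complex.I * theta x t k)) • phiPlus q j x t k

/-- `μ_{-j}`, the `j`-th column of `Φ₋ e^{-iθσ₃}`. -/
def muMinus (q : ℝ → ℝ → ℂ) (j : Fin 2) (x t : ℝ) (k : ℂ) : Fin 2 → ℂ :=
  Complex.exp (-(sgn j * Complex.I * theta x t k)) • phiMinus q j x t k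

/-- `v₋(x,t) = ½ ∫_{-∞}^x |q(y,t)|² dy`. -/
def vMinus (q : ℝ → ℝ → ℂ) (x t : ℝ) : ℝ := (1 / 2) * ∫ y in Set.Iic x, ‖q y t‖ ^ 2

/-! ### Scattering data

The scattering matrix does not depend on `(x,t)`; its entries are evaluated at `(0,0)`. The
Wronskians also give the extensions of `s₁₁` to `D⁺` and of `s₂₂` to `D⁻`. -/

def s11 (q : ℝ → ℝ → ℂ) (k : ℂ) : ℂ := wr (phiPlus q 0 0 0 k) (phiMinus q 1 0 0 k)

def s22 (q : ℝ → ℝ → ℂ) (k : ℂ) : ℂ := wr (phiMinus q 0 0 0 k) (phiPlus q 1 0 0 k)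

def s12 (q : ℝ → ℝ → ℂ) (k : ℂ) : ℂ := wr (phiPlus q 1 0 0 k) (phiMinus q 1 0 0 k)

def s21 (q : ℝ → ℝ → ℂ) (k : ℂ) : ℂ := wr (phiMinus q 0 0 0 k) (phiPlus q 0 0 0 k)

/-- The Wronskians are the coefficients of the relation `Φ₊ = Φ₋ S`, since `det Φ₋ = 1`. -/
theorem scattering_relation (q : ℝ → ℝ → ℂ) (k : ℂ)
    (h : (cols (phiMinus q 0 0 0 k) (phiMinus q 1 0 0 k)).det = 1) :
    cols (phiPlus q 0 0 0 k) (phiPlus q 1 0 0 k) =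
      cols (phiMinus q 0 0 0 k) (phiMinus q 1 0 0 k) *
        !![s11 q k, s12 q k; s21 q k, s22 q k] := by
  simp only [cols, s11, s12, s21, s22, wr, Matrix.det_fin_two_of] at h ⊢
  ext i j
  fin_cases i <;> fin_cases j <;> simp [Matrix.mul_apply, Fin.sum_univ_two]
  · linear_combination (-(phiPlus q 0 0 0 k 0)) * h
  · linear_combination (-(phiPlus q 1 0 0 k 0)) * h
  · linear_combination (-(phiPlus q 0 0 0 k 1)) * h
  · linear_combination (-(phiPlus q 1 0 0 k 1)) * h

/-- Reflection coefficient `ρ = s₂₁ / s₁₁`. -/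
def rho (q : ℝ → ℝ → ℂ) (k : ℂ) : ℂ := s21 q k / s11 q k

/-- Reflection coefficient `ρ̃ = s₁₂ / s₂₂`. -/
def rhoTilde (q : ℝ → ℝ → ℂ) (k : ℂ) : ℂ := s12 q k / s22 q k

/-- The zeros of `s₁₁` in the open first quadrant are exactly the pairwise different points
`k_1, …, k_N`, and each of them is a double zero. -/
structure HasDoubleZeros (q : ℝ → ℝ → ℂ) {N : ℕ} (kn : Fin N → ℂ) : Prop where
  injective : Function.Injective kn
  mem : ∀ n, 0 < (kn n).re ∧ 0 < (kn n).im
  zero_iff : ∀ k : ℂ, 0 < k.re → 0 < k.im → (s11 q k = 0 ↔ ∃ n, k = kn n)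
  deriv_eq : ∀ n, deriv (s11 q) (kn n) = 0
  deriv2_ne : ∀ n, iteratedDeriv 2 (s11 q) (kn n) ≠ 0

/-- Absence of spectral singularities. -/
def NoSpectralSingularity (q : ℝ → ℝ → ℂ) : Prop :=
  ∀ k ∈ Sig, s11 q k ≠ 0 ∧ s22 q k ≠ 0

/-- `η_n = k_n` for `n ≤ N`, and `η_n = -k_{n-N}` for `N < n ≤ 2N`. -/
def eta {N : ℕ} (kn : Fin N → ℂ) : Fin (N + N) → ℂ := Fin.append kn (fun n => -kn n)

/-- The discrete spectrum `K = {k_n, k_n^*, -k_n^*, -k_n}`. -/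
def discreteSpectrum {N : ℕ} (kn : Fin N → ℂ) : Set ℂ :=
  {k | ∃ n, k = kn n ∨ k = conj (kn n) ∨ k = -conj (kn n) ∨ k = -kn n}

/-- The quotient `u / v` of parallel columns, that is the scalar `c` with `u = c v`. -/
def ratio (u v : Fin 2 → ℂ) : ℂ := Classical.epsilon fun c : ℂ => u = c • v

/-- `b[k₀]`; like `d[k₀]` it does not depend on `(x,t)` and is evaluated at `(0,0)`. -/
def bCoeff (q : ℝ → ℝ → ℂ) (k₀ : ℂ) : ℂ :=
  if 0 < k₀.re * k₀.im then ratio (phiPlus q 0 0 0 k₀) (phiMinus q 1 0 0 k₀)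
  else ratio (phiPlus q 1 0 0 k₀) (phiMinus q 0 0 0 k₀)

/-- `d[k₀]`. -/
def dCoeff (q : ℝ → ℝ → ℂ) (k₀ : ℂ) : ℂ :=
  if 0 < k₀.re * k₀.im then
    ratio (deriv (fun k => phiPlus q 0 0 0 k) k₀ -
      bCoeff q k₀ • deriv (fun k => phiMinus q 1 0 0 k) k₀) (phiMinus q 1 0 0 k₀)
  else
    ratio (deriv (fun k => phiPlus q 1 0 0 k) k₀ -
      bCoeff q k₀ • deriv (fun k => phiMinus q 0 0 0 k) k₀) (phiMinus q 0 0 0 k₀)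

/-- `A[k₀]`. -/
def aNorm (q : ℝ → ℝ → ℂ) (k₀ : ℂ) : ℂ :=
  if 0 < k₀.re * k₀.im then 2 * bCoeff q k₀ / iteratedDeriv 2 (s11 q) k₀
  else 2 * bCoeff q k₀ / iteratedDeriv 2 (s22 q) k₀

/-- `B[k₀]`. -/
def bNorm (q : ℝ → ℝ → ℂ) (k₀ : ℂ) : ℂ :=
  if 0 < k₀.re * k₀.im then
    dCoeff q k₀ / bCoeff q k₀ -
      iteratedDeriv 3 (s11 q) k₀ / (3 * iteratedDeriv 2 (s11 q) k₀)
  else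
    dCoeff q k₀ / bCoeff q k₀ -
      iteratedDeriv 3 (s22 q) k₀ / (3 * iteratedDeriv 2 (s22 q) k₀)

/-! ### The Riemann–Hilbert problem -/

/-- `M` on `D⁺`; on `Σ` this is the boundary value `M⁺`. -/
def mPlus (q : ℝ → ℝ → ℂ) (x t : ℝ) (k : ℂ) : Matrix (Fin 2) (Fin 2) ℂ :=
  cols ((s11 q k)⁻¹ • muPlus q 0 x t k) (muMinus q 1 x t k)

/-- `M` on `D⁻`; on `Σ` this is the boundary value `M⁻`. -/
def mMinus (q : ℝ → ℝ → ℂ) (x t : ℝ) (k : ℂ) : Matrix (Fin 2) (Fin 2) ℂ :=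
  cols (muMinus q 0 x t k) ((s22 q k)⁻¹ • muPlus q 1 x t k)

/-- The sectionally meromorphic matrix `M(x,t;k)`, for `k ∉ Σ`. -/
def rhpM (q : ℝ → ℝ → ℂ) (x t : ℝ) (k : ℂ) : Matrix (Fin 2) (Fin 2) ℂ :=
  if 0 < k.re * k.im then mPlus q x t k else mMinus q x t k

/-- `J(x,t;k)`. -/
def rhpJ (q : ℝ → ℝ → ℂ) (x t : ℝ) (k : ℂ) : Matrix (Fin 2) (Fin 2) ℂ :=
  expSigma (theta x t k) * !![0, -rhoTilde q k; rho q k, rho q k * rhoTilde q k] *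
    expSigma (-theta x t k)

/-- `M`, with boundary values `Mp = M⁺` and `Mm = M⁻` on `Σ`, solves the Riemann–Hilbert problem
with pole set `K`, jump `M⁻ = M⁺ (I - J)` and limit `E` at infinity. -/
structure IsRHPSolution (K : Set ℂ) (J : ℂ → Matrix (Fin 2) (Fin 2) ℂ)
    (E : Matrix (Fin 2) (Fin 2) ℂ) (M Mp Mm : ℂ → Matrix (Fin 2) (Fin 2) ℂ) : Prop where
  analytic : ∀ k ∈ (Dplus ∪ Dminus) \ K, ∀ i j, AnalyticAt ℂ (fun z => M z i j) k
  double_pole : ∀ k ∈ K,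
    (∀ i j, MeromorphicAt (fun z => M z i j) k ∧
      -2 ≤ meromorphicOrderAt (fun z => M z i j) k) ∧
    ∃ i j, meromorphicOrderAt (fun z => M z i j) k = -2
  boundary_plus : ∀ k ∈ Sig, Tendsto M (𝓝[Dplus] k) (𝓝 (Mp k))
  boundary_minus : ∀ k ∈ Sig, Tendsto M (𝓝[Dminus] k) (𝓝 (Mm k))
  jump : ∀ k ∈ Sig, Mm k = Mp k * (1 - J k)
  asymptotic : ∀ i j, (fun k => M k i j - E i j)
    =O[Bornology.cobounded ℂ ⊓ 𝓟 (Dplus ∪ Dminus)] fun k => k⁻¹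

/-! ### Integration over the oriented contour

`Σ` is oriented so that `D⁺` lies on its left: outwards (from `0` to `±∞`) on the two real
half-lines, inwards (from `±i∞` to `0`) on the two imaginary half-lines. -/

def SigIntegrable (f : ℂ → ℂ) : Prop :=
  IntegrableOn (fun s : ℝ => f s) (Set.Ioi 0) ∧
  IntegrableOn (fun s : ℝ => f (-s)) (Set.Ioi 0) ∧
  IntegrableOn (fun s : ℝ => f (Complex.I * s)) (Set.Ioi 0) ∧
  IntegrableOn (fun s : ℝ => f (-(Complex.I * s))) (Set.Ioi 0)

def sigIntegral (f : ℂ → ℂ) : ℂ :=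
  (∫ s in Set.Ioi (0 : ℝ), f (s : ℂ)) - (∫ s in Set.Ioi (0 : ℝ), f (-(s : ℂ)))
  - Complex.I * (∫ s in Set.Ioi (0 : ℝ), f (Complex.I * (s : ℂ)))
  + Complex.I * (∫ s in Set.Ioi (0 : ℝ), f (-(Complex.I * (s : ℂ))))

/-- `(M⁺ J)(x,t;ζ)`. -/
def mPlusJ (q : ℝ → ℝ → ℂ) (x t : ℝ) (ζ : ℂ) : Matrix (Fin 2) (Fin 2) ℂ :=
  mPlus q x t ζ * rhpJ q x t ζ

/-- The `j`-th column of `(2πi)⁻¹ ∫_Σ (M⁺J)(x,t;ζ) / (ζ - k)^m dζ`. -/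
def cauchyCol (q : ℝ → ℝ → ℂ) (x t : ℝ) (m : ℕ) (k : ℂ) (j : Fin 2) : Fin 2 → ℂ :=
  fun i => (2 * Real.pi * Complex.I)⁻¹ *
    sigIntegral fun ζ => mPlusJ q x t ζ i j / (ζ - k) ^ m

/-! ### Coefficients of the pole terms -/

/-- `C_n(k)`, as a function of `η = η_n` and `k`. -/
def coefC (q : ℝ → ℝ → ℂ) (x t : ℝ) (η k : ℂ) : ℂ :=
  aNorm q η / (k - η) * Complex.exp (-2 * Complex.I * theta x t η)

/-- `D_n`, as a function of `η = η_n`. -/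
def coefD (q : ℝ → ℝ → ℂ) (x t : ℝ) (η : ℂ) : ℂ :=
  bNorm q η - 2 * Complex.I * deriv (theta x t) η

/-- `Ĉ_n(k)`, as a function of `η' = η_n^*` and `k`. -/
def coefChat (q : ℝ → ℝ → ℂ) (x t : ℝ) (η' k : ℂ) : ℂ :=
  aNorm q η' / (k - η') * Complex.exp (2 * Complex.I * theta x t η')

/-- `D̂_n`, as a function of `η' = η_n^*`. -/
def coefDhat (q : ℝ → ℝ → ℂ) (x t : ℝ) (η' : ℂ) : ℂ :=
  bNorm q η' + 2 * Complex.I * deriv (theta x t) η'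

/-- `μ'_{-j}(x,t;k)`, the derivative with respect to `k`. -/
def muMinus' (q : ℝ → ℝ → ℂ) (j : Fin 2) (x t : ℝ) (k : ℂ) : Fin 2 → ℂ :=
  deriv (fun z => muMinus q j x t z) k

end DNLS

end

noncomputable section

namespace DNLS

/-! ### Integrals depending holomorphically on a parameter -/

/-! In each column of `M`, one side of `Σ` carries a holomorphic Jost column and the other a Jost
column divided by `s₁₁` or `s₂₂`, hence with double poles. Subtract from both sides the same limit
at infinity and the same polar parts. What remains is holomorphic in `D⁺` and `D⁻`, continuous up to
`Σ` and `O(1/k)`, while its jump is still `M⁺ - M⁻ = M⁺J`. Cauchy's formula in the four quadrants,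
added up, recovers such a pair from its jump (`sigIntegral_jump`, `cauchy_of_jump`). This is the
formula for `M`. On the pole-free side it expresses `μ₋₁` and `μ₋₂` near `η_n^*` and `η_n`;
evaluating there, and differentiating once, gives the closed linear system. The representation is
derived from `M` itself, so no uniqueness for the Riemann–Hilbert problem is involved
(`first_column`, `second_column`).

Four ingredients feed this argument.

Jost theory: `μ₊₁` is the Neumann series of a Volterra equation, continuous on the closure of `D⁺`
and holomorphic inside (`VolterraBound`, `jostKernel_bound`). The other three columns follow by
reflecting the potential and by the symmetry `k ↦ k^*`. The Jost solutions are defined by a choice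
operator, and `jostColumn_unique` shows that the choice is forced.

Behaviour at infinity: the kernel is of size `|k|`, so the Neumann bound is useless for large `k`.
The substitution `z = k μ₂ - (i/2) q^* μ₁` gives a system with coefficients bounded independently of
`k` apart from one term of favourable sign. An energy estimate and one integration by parts then
give the limit with error `O(1/k)` (`jost_energy_le`, `jost_asymptotics`).

Time evolution: the zero curvature condition makes the time part of the Lax pair carry Jost columns
to Jost columns. All of them go from `(0,0)` to `(x,t)` by one matrix of determinant one
(`hasDerivAt_of_zero_curvature`, `exists_phi_propagator`). Hence Wronskians, and the proportionality
constants `b` and `d`, may be computed at `(0,0)`.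

Double zeros: if `s = (z - η)² u`, the polar part of `a / s` is read off from the first two Taylor
coefficients of `a / u` (`exists_polar_part`). The relations `Φ₊ = b Φ₋` and `Φ₊' = b Φ₋' + d Φ₋` at
the zero turn these into the constants `A` and `B` (`norming_relation`, `normalised_relation`). The
zeros in the other quadrants come from `s₁₁(-k) = s₁₁(k)` and `s₂₂(k^*) = s₁₁(k)^*`. -/

theorem hasDerivAt_integral_of_holomorphic {α F : Type*} [MeasurableSpace α]
    [NormedAddCommGroup F] [NormedSpace ℂ F] [CompleteSpace F] {μ : Measure α}
    {f : ℂ → α → F} {bound : α → ℝ} {U : Set ℂ} (hU : IsOpen U)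
    (hmeas : ∀ k ∈ U, AEStronglyMeasurable (f k) μ)
    (hbound : ∀ᵐ y ∂μ, ∀ k ∈ U, ‖f k y‖ ≤ bound y) (hint : Integrable bound μ)
    (hdiff : ∀ᵐ y ∂μ, DifferentiableOn ℂ (fun k => f k y) U) {k₀ : ℂ} (hk₀ : k₀ ∈ U) :
    HasDerivAt (fun k => ∫ y, f k y ∂μ) (∫ y, deriv (fun k => f k y) k₀ ∂μ) k₀ := by
  obtain ⟨r, hr, hball⟩ := Metric.isOpen_iff.1 hU k₀ hk₀
  have hr2 : 0 < r / 2 := half_pos hr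
  have hsub : ∀ k ∈ Metric.ball k₀ (r / 2), ∀ z ∈ Metric.closedBall k (r / 4), z ∈ U := by
    intro k hk z hz
    apply hball
    rw [Metric.mem_ball] at hk ⊢
    rw [Metric.mem_closedBall] at hz
    linarith [dist_triangle z k k₀]
  -- The derivative in the parameter is measurable as the pointwise limit of difference quotients
  -- along the explicit sequence `h n → 0`.
  have hm : AEStronglyMeasurable (fun y => deriv (fun k => f k y) k₀) μ := by
    let h : ℕ → ℂ := fun n => ((r / 2 / (n + 1) : ℝ) : ℂ)
    have hpos : ∀ n : ℕ, 0 < r / 2 / ((n : ℝ) + 1) := fun n => by positivity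
    have hmem : ∀ n, k₀ + h n ∈ U := by
      intro n
      apply hball
      rw [Metric.mem_ball, dist_self_add_left, Complex.norm_real, Real.norm_eq_abs,
        abs_of_pos (hpos n)]
      have : r / 2 / ((n : ℝ) + 1) ≤ r / 2 :=
        div_le_self hr2.le (by linarith [Nat.cast_nonneg (α := ℝ) n])
      linarith
    have hh0 : Tendsto h atTop (𝓝[≠] 0) := by
      refine tendsto_nhdsWithin_iff.2 ⟨?_, Eventually.of_forall fun n => ?_⟩
      · have : Tendsto (fun n : ℕ => r / 2 / ((n : ℝ) + 1)) atTop (𝓝 0) :=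
          tendsto_const_nhds.div_atTop
            (tendsto_atTop_add_const_right _ _ tendsto_natCast_atTop_atTop)
        have := (Complex.continuous_ofReal.tendsto 0).comp this
        rwa [Complex.ofReal_zero] at this
      · exact Complex.ofReal_ne_zero.2 (hpos n).ne'
    refine aestronglyMeasurable_of_tendsto_ae atTop
      (f := fun n y => (h n)⁻¹ • (f (k₀ + h n) y - f k₀ y))
      (fun n => ((hmeas _ (hmem n)).sub (hmeas _ hk₀)).const_smul _) ?_
    filter_upwards [hdiff] with y hy
    exact (hasDerivAt_iff_tendsto_slope_zero.1
      ((hy.differentiableAt (hU.mem_nhds hk₀)).hasDerivAt)).comp hh0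
  refine (hasDerivAt_integral_of_dominated_loc_of_deriv_le (s := Metric.ball k₀ (r / 2))
    (bound := fun y => bound y / (r / 4)) (F' := fun k y => deriv (fun k => f k y) k)
    (Metric.ball_mem_nhds _ hr2) ?_ ?_ hm ?_ (hint.div_const _) ?_).2
  · filter_upwards [hU.mem_nhds hk₀] with k hk using hmeas k hk
  · exact hint.mono' (hmeas _ hk₀) (by filter_upwards [hbound] with y hy using hy _ hk₀)
  · filter_upwards [hbound, hdiff] with y hy hdy k hk
    -- Cauchy's estimate on circles of radius `r/4` dominates the derivative by the bound for the
    -- function itself, so no separate hypothesis on the derivative is needed.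
    refine Complex.norm_deriv_le_of_forall_mem_sphere_norm_le (by positivity) ?_ ?_
    · exact (hdy.mono (hsub k hk)).diffContOnCl_ball le_rfl
    · exact fun z hz => hy z (hsub k hk z (Metric.sphere_subset_closedBall hz))
  · filter_upwards [hdiff] with y hdy k hk
    have hkU : k ∈ U := hsub k hk k (Metric.mem_closedBall_self (by positivity))
    exact (hdy.differentiableAt (hU.mem_nhds hkU)).hasDerivAt

/-! ### Tails of integrals -/

def tail {F : Type*} [NormedAddCommGroup F] [NormedSpace ℝ F] (f : ℝ → F) (x : ℝ) : F :=
  ∫ y in Set.Ioi x, f y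

section tail

variable {F : Type*} [NormedAddCommGroup F] [NormedSpace ℝ F]

theorem tail_eq {f : ℝ → F} (hf : ∀ x, IntegrableOn f (Set.Ioi x)) (a x : ℝ) :
    tail f x = tail f a - ∫ y in a..x, f y := by
  have := intervalIntegral.integral_Ioi_sub_Ioi' (hf a) (hf x)
  rw [← this]; simp [tail]

theorem hasDerivAt_tail [CompleteSpace F] {f : ℝ → F} (hc : Continuous f)
    (hf : ∀ x, IntegrableOn f (Set.Ioi x)) (x : ℝ) : HasDerivAt (tail f) (-f x) x := by
  have h : tail f = fun x => tail f 0 - ∫ y in (0 : ℝ)..x, f y := funext fun x => tail_eq hf 0 x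
  rw [h]
  simpa using (hc.integral_hasStrictDerivAt 0 x).hasDerivAt.const_sub (tail f 0)

theorem tendsto_tail [CompleteSpace F] {f : ℝ → F} (hf : ∀ x, IntegrableOn f (Set.Ioi x)) :
    Tendsto (tail f) atTop (𝓝 0) := by
  have h : tail f = fun x => tail f 0 - ∫ y in (0 : ℝ)..x, f y := funext fun x => tail_eq hf 0 x
  rw [h]
  have := (intervalIntegral_tendsto_integral_Ioi 0 (hf 0) tendsto_id).const_sub (tail f 0)
  simpa [tail] using this

theorem tail_nonneg {a : ℝ → ℝ} (h0 : ∀ y, 0 ≤ a y) (x : ℝ) : 0 ≤ tail a x :=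
  integral_nonneg fun y => h0 y

theorem tail_le {a : ℝ → ℝ} (h0 : ∀ y, 0 ≤ a y) (hi : Integrable a) (x : ℝ) :
    tail a x ≤ ∫ y, a y :=
  setIntegral_le_integral hi (Eventually.of_forall h0)

/-- Since `tail a` has derivative `-a`, the integrand is the derivative of `-(tail a)^(n+1)/(n+1)`,
which vanishes at `+∞`. Iterating this identity produces the factorials in the Neumann series. -/
theorem integral_mul_tail_pow {a : ℝ → ℝ} (hc : Continuous a) (h0 : ∀ y, 0 ≤ a y)
    (hi : Integrable a) (n : ℕ) (x : ℝ) :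
    IntegrableOn (fun y => a y * tail a y ^ n) (Set.Ioi x) ∧
      ∫ y in Set.Ioi x, a y * tail a y ^ n = tail a x ^ (n + 1) / (n + 1) := by
  have hd := fun y => hasDerivAt_tail hc (fun x => hi.integrableOn (s := Set.Ioi x)) y
  have hct : Continuous (tail a) := continuous_iff_continuousAt.2 fun y => (hd y).continuousAt
  have hint : IntegrableOn (fun y => a y * tail a y ^ n) (Set.Ioi x) := by
    refine (hi.mul_const ((∫ y, a y) ^ n)).integrableOn.mono'
      (hc.mul (hct.pow n)).aestronglyMeasurable (Eventually.of_forall fun y => ?_)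
    rw [Real.norm_of_nonneg (mul_nonneg (h0 y) (pow_nonneg (tail_nonneg h0 y) n))]
    exact mul_le_mul_of_nonneg_left
      (pow_le_pow_left₀ (tail_nonneg h0 y) (tail_le h0 hi y) n) (h0 y)
  refine ⟨hint, ?_⟩
  have hn : (n : ℝ) + 1 ≠ 0 := by positivity
  have key := integral_Ioi_of_hasDerivAt_of_tendsto' (a := x) (m := 0)
    (f := fun y => -(tail a y ^ (n + 1) / (n + 1))) (f' := fun y => a y * tail a y ^ n)
    (fun y _ => by
      have := (((hd y).fun_pow (n + 1)).div_const ((n : ℝ) + 1)).fun_neg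
      convert this using 1
      rw [Nat.add_sub_cancel]
      push_cast
      field_simp) hint (by
      have := (((tendsto_tail (fun x => hi.integrableOn (s := Set.Ioi x))).pow (n + 1)).div_const
        ((n : ℝ) + 1)).neg
      simpa using this)
  rw [key]; ring

end tail

theorem _root_.ContinuousOn.matrix_mulVec {X : Type*} [TopologicalSpace X] {s : Set X}
    {A : X → Matrix (Fin 2) (Fin 2) ℂ} {v : X → Fin 2 → ℂ} (hA : ContinuousOn A s)
    (hv : ContinuousOn v s) : ContinuousOn (fun x => A x *ᵥ v x) s := by
  rw [continuousOn_iff_continuous_domRestrict] at hA hv ⊢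
  exact Continuous.matrix_mulVec hA hv

/-! ### Volterra equations on a half-line -/

/-- The `n`-th term of the Neumann series of `u(x) = c + ∫_x^∞ K(k,x,y) u(y) dy`. -/
def volterraTerm (K : ℂ → ℝ → ℝ → Matrix (Fin 2) (Fin 2) ℂ) (c : Fin 2 → ℂ) :
    ℕ → ℂ → ℝ → Fin 2 → ℂ
  | 0, _, _ => c
  | n + 1, k, x => ∫ y in Set.Ioi x, K k x y *ᵥ volterraTerm K c n k y

def volterra (K : ℂ → ℝ → ℝ → Matrix (Fin 2) (Fin 2) ℂ) (c : Fin 2 → ℂ) (k : ℂ) (x : ℝ) :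
    Fin 2 → ℂ :=
  ∑' n, volterraTerm K c n k x

/-- The kernel `K` is continuous, and dominated by an integrable function for `k ∈ S`. -/
structure VolterraBound (K : ℂ → ℝ → ℝ → Matrix (Fin 2) (Fin 2) ℂ) (S : Set ℂ) (a : ℝ → ℝ) :
    Prop where
  cont_kernel : Continuous fun p : ℂ × ℝ × ℝ => K p.1 p.2.1 p.2.2
  cont : Continuous a
  nonneg : ∀ y, 0 ≤ a y
  integrable : Integrable a
  bound : ∀ k ∈ S, ∀ x y, x ≤ y → ∀ v, ‖K k x y *ᵥ v‖ ≤ a y * ‖v‖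

/-! ### Convergence, continuity and holomorphy of the Neumann series. -/

namespace VolterraBound

variable {K : ℂ → ℝ → ℝ → Matrix (Fin 2) (Fin 2) ℂ} {S : Set ℂ} {a : ℝ → ℝ}

/-- Each iteration integrates `a · tail a ^ n`, so the bound gains a factor `tail a / (n+1)`: the
series converges for every integrable `a`, with no smallness assumption. -/
theorem norm_term_le (h : VolterraBound K S a) (c : Fin 2 → ℂ) (n : ℕ) {k : ℂ} (hk : k ∈ S)
    (x : ℝ) : ‖volterraTerm K c n k x‖ ≤ ‖c‖ * (tail a x ^ n / n.factorial) := by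
  induction n generalizing x with
  | zero => simp [volterraTerm]
  | succ n ih =>
    obtain ⟨hi, he⟩ := integral_mul_tail_pow h.cont h.nonneg h.integrable n x
    calc ‖volterraTerm K c (n + 1) k x‖
        ≤ ∫ y in Set.Ioi x, ‖c‖ / n.factorial * (a y * tail a y ^ n) := by
          refine norm_integral_le_of_norm_le (hi.const_mul _) ?_
          refine (ae_restrict_iff' measurableSet_Ioi).2 (Eventually.of_forall fun y hy => ?_)
          refine (h.bound k hk x y (le_of_lt hy) _).trans ?_
          calc _ ≤ a y * (‖c‖ * (tail a y ^ n / n.factorial)) :=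
                mul_le_mul_of_nonneg_left (ih y) (h.nonneg y)
            _ = _ := by ring
      _ = ‖c‖ * (tail a x ^ (n + 1) / (n + 1).factorial) := by
          rw [integral_const_mul, he, Nat.factorial_succ]
          push_cast
          field_simp

theorem norm_term_le' (h : VolterraBound K S a) (c : Fin 2 → ℂ) (n : ℕ) {k : ℂ} (hk : k ∈ S)
    (x : ℝ) : ‖volterraTerm K c n k x‖ ≤ ‖c‖ * ((∫ y, a y) ^ n / n.factorial) := by
  refine (h.norm_term_le c n hk x).trans ?_
  gcongr
  · exact tail_nonneg h.nonneg x
  · exact tail_le h.nonneg h.integrable x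

/-- Writing the half-line integral with an indicator puts all dependence on `(k,x)` into the
integrand, and dominated convergence applies along `S`, which need not be open. This is what gives
boundary values on `Σ`. -/
theorem continuousOn_term (h : VolterraBound K S a) (c : Fin 2 → ℂ) (n : ℕ) :
    ContinuousOn (fun p : ℂ × ℝ => volterraTerm K c n p.1 p.2) (S ×ˢ Set.univ) := by
  induction n with
  | zero => exact continuousOn_const
  | succ n ih =>
    have hF : ∀ k ∈ S, Continuous fun y => volterraTerm K c n k y := fun k hk =>
      continuousOn_univ.1 (ih.comp (f := fun y : ℝ => (k, y)) (by fun_prop)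
        (fun y _ => ⟨hk, trivial⟩))
    have hKF : ∀ k ∈ S, ∀ x, Continuous fun y => K k x y *ᵥ volterraTerm K c n k y :=
      fun k hk x => Continuous.matrix_mulVec
        (h.cont_kernel.comp (by fun_prop : Continuous fun y : ℝ => (k, x, y))) (hF k hk)
    have e : (fun p : ℂ × ℝ => volterraTerm K c (n + 1) p.1 p.2) = fun p =>
        ∫ y, (Set.Ioi p.2).indicator (fun y => K p.1 p.2 y *ᵥ volterraTerm K c n p.1 y) y := by
      funext p
      rw [integral_indicator measurableSet_Ioi]
      rfl
    rw [e]
    rintro ⟨k₀, x₀⟩ ⟨hk₀, -⟩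
    refine continuousWithinAt_of_dominated
      (bound := fun y => a y * (‖c‖ * ((∫ y, a y) ^ n / n.factorial))) ?_ ?_
      (h.integrable.mul_const _) ?_
    · filter_upwards [self_mem_nhdsWithin] with p hp
      exact (hKF p.1 hp.1 p.2).aestronglyMeasurable.indicator measurableSet_Ioi
    · filter_upwards [self_mem_nhdsWithin] with p hp
      refine Eventually.of_forall fun y => ?_
      by_cases hy : y ∈ Set.Ioi p.2
      · rw [Set.indicator_of_mem hy]
        exact (h.bound _ hp.1 _ _ (le_of_lt hy) _).trans
          (mul_le_mul_of_nonneg_left (h.norm_term_le' c n hp.1 y) (h.nonneg y))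
      · rw [Set.indicator_of_notMem hy, norm_zero]
        exact mul_nonneg (h.nonneg y) ((norm_nonneg _).trans (h.norm_term_le' c n hp.1 y))
    -- The indicator is discontinuous in `x` only when `y = x₀`, a null set; elsewhere it is locally
    -- constant in `x`.
    · have : ∀ᵐ y : ℝ, y ≠ x₀ := by simp [ae_iff, measure_singleton]
      filter_upwards [this] with y hy
      rcases lt_or_gt_of_ne hy with hlt | hgt
      · have : ∀ᶠ p : ℂ × ℝ in 𝓝 (k₀, x₀), y < p.2 :=
          continuous_snd.continuousAt.eventually (lt_mem_nhds hlt)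
        refine (continuousWithinAt_const (b := (0 : Fin 2 → ℂ))).congr_of_eventuallyEq ?_ ?_
        · filter_upwards [nhdsWithin_le_nhds this] with p hp
          exact Set.indicator_of_notMem (by simpa using hp.le) _
        · exact Set.indicator_of_notMem (by simpa using hlt.le) _
      · have : ∀ᶠ p : ℂ × ℝ in 𝓝 (k₀, x₀), p.2 < y :=
          continuous_snd.continuousAt.eventually (gt_mem_nhds hgt)
        have hc : ContinuousWithinAt (fun p : ℂ × ℝ => K p.1 p.2 y *ᵥ volterraTerm K c n p.1 y)
            (S ×ˢ Set.univ) (k₀, x₀) := by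
          have h1 : Continuous fun p : ℂ × ℝ => K p.1 p.2 y :=
            h.cont_kernel.comp (by fun_prop : Continuous fun p : ℂ × ℝ => (p.1, p.2, y))
          have h2 : ContinuousOn (fun p : ℂ × ℝ => volterraTerm K c n p.1 y) (S ×ˢ Set.univ) :=
            ih.comp (f := fun p : ℂ × ℝ => (p.1, y)) (by fun_prop) (fun p hp => ⟨hp.1, trivial⟩)
          exact (h1.continuousOn.matrix_mulVec h2) _ ⟨hk₀, trivial⟩
        refine hc.congr_of_eventuallyEq ?_ ?_
        · filter_upwards [nhdsWithin_le_nhds this] with p hp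
          exact Set.indicator_of_mem (by simpa using hp) _
        · exact Set.indicator_of_mem (by simpa using hgt) _

theorem continuous_kernel_mulVec (h : VolterraBound K S a) {k : ℂ} (x : ℝ) {f : ℝ → Fin 2 → ℂ}
    (hf : Continuous f) : Continuous fun y => K k x y *ᵥ f y :=
  Continuous.matrix_mulVec (h.cont_kernel.comp (by fun_prop : Continuous fun y : ℝ => (k, x, y))) hf

theorem continuous_term (h : VolterraBound K S a) (c : Fin 2 → ℂ) (n : ℕ) {k : ℂ} (hk : k ∈ S) :
    Continuous fun y => volterraTerm K c n k y :=
  continuousOn_univ.1 ((h.continuousOn_term c n).comp (f := fun y : ℝ => (k, y)) (by fun_prop)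
    (fun y _ => ⟨hk, trivial⟩))

theorem differentiableOn_term (h : VolterraBound K S a) (c : Fin 2 → ℂ) {U : Set ℂ}
    (hU : IsOpen U) (hUS : U ⊆ S)
    (hK : ∀ x y i j, Differentiable ℂ fun k => K k x y i j) (n : ℕ) (x : ℝ) :
    DifferentiableOn ℂ (fun k => volterraTerm K c n k x) U := by
  induction n generalizing x with
  | zero => exact differentiableOn_const _
  | succ n ih =>
    intro k₀ hk₀
    refine (hasDerivAt_integral_of_holomorphic
      (bound := fun y => a y * (‖c‖ * ((∫ y, a y) ^ n / n.factorial))) hU ?_ ?_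
      (h.integrable.mul_const _).integrableOn ?_ hk₀).differentiableAt.differentiableWithinAt
    · exact fun k hk => (h.continuous_kernel_mulVec x
        (h.continuous_term c n (hUS hk))).aestronglyMeasurable
    · refine (ae_restrict_iff' measurableSet_Ioi).2 (Eventually.of_forall fun y hy k hk => ?_)
      exact (h.bound _ (hUS hk) _ _ (le_of_lt hy) _).trans
          (mul_le_mul_of_nonneg_left (h.norm_term_le' c n (hUS hk) y) (h.nonneg y))
    · refine Eventually.of_forall fun y => differentiableOn_pi.2 fun i => ?_
      simp only [Matrix.mulVec, dotProduct]
      exact DifferentiableOn.fun_sum fun j _ =>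
        (hK x y i j).differentiableOn.mul (differentiableOn_pi.1 (ih y) j)

theorem summable_majorant (c : Fin 2 → ℂ) (t : ℝ) :
    Summable fun n : ℕ => ‖c‖ * (t ^ n / n.factorial) :=
  (Real.summable_pow_div_factorial t).mul_left _

theorem summable_term (h : VolterraBound K S a) (c : Fin 2 → ℂ) {k : ℂ} (hk : k ∈ S) (x : ℝ) :
    Summable fun n => volterraTerm K c n k x :=
  (summable_majorant c (tail a x)).of_norm_bounded fun n => h.norm_term_le c n hk x

theorem norm_le (h : VolterraBound K S a) (c : Fin 2 → ℂ) {k : ℂ} (hk : k ∈ S) (x : ℝ) :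
    ‖volterra K c k x‖ ≤ ‖c‖ * Real.exp (tail a x) := by
  refine tsum_of_norm_bounded ?_ fun n => h.norm_term_le c n hk x
  rw [Real.exp_eq_exp_ℝ]
  exact (NormedSpace.expSeries_div_hasSum_exp (tail a x)).mul_left _

/-- The zeroth Neumann term is `c` itself, so the remainder is majorised by the exponential series
without its first term. It vanishes as `tail a x → 0`, which yields the normalisation at `+∞`. -/
theorem norm_sub_le (h : VolterraBound K S a) (c : Fin 2 → ℂ) {k : ℂ} (hk : k ∈ S) (x : ℝ) :
    ‖volterra K c k x - c‖ ≤ ‖c‖ * Real.exp (tail a x) - ‖c‖ := by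
  have h1 : volterra K c k x - c = ∑' n, volterraTerm K c (n + 1) k x := by
    rw [volterra, (h.summable_term c hk x).tsum_eq_zero_add]
    simp [volterraTerm]
  rw [h1]
  refine tsum_of_norm_bounded ?_ fun n => h.norm_term_le c (n + 1) hk x
  have := (NormedSpace.expSeries_div_hasSum_exp (tail a x)).mul_left ‖c‖
  rw [← Real.exp_eq_exp_ℝ] at this
  simpa using (hasSum_nat_add_iff' 1).2 this

theorem tendsto_volterra (h : VolterraBound K S a) (c : Fin 2 → ℂ) {k : ℂ} (hk : k ∈ S) :
    Tendsto (volterra K c k) atTop (𝓝 c) := by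
  rw [tendsto_iff_norm_sub_tendsto_zero]
  refine squeeze_zero (fun _ => norm_nonneg _) (fun x => h.norm_sub_le c hk x) ?_
  have := tendsto_tail (fun x => h.integrable.integrableOn (s := Set.Ioi x))
  have := (((Real.continuous_exp.tendsto 0).comp this).const_mul ‖c‖).sub_const ‖c‖
  simpa using this

theorem continuousOn_volterra (h : VolterraBound K S a) (c : Fin 2 → ℂ) :
    ContinuousOn (fun p : ℂ × ℝ => volterra K c p.1 p.2) (S ×ˢ Set.univ) :=
  continuousOn_tsum (h.continuousOn_term c) (summable_majorant c (∫ y, a y))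
    fun n p hp => h.norm_term_le' c n hp.1 p.2

theorem continuous_volterra (h : VolterraBound K S a) (c : Fin 2 → ℂ) {k : ℂ} (hk : k ∈ S) :
    Continuous fun y => volterra K c k y :=
  continuousOn_univ.1 ((h.continuousOn_volterra c).comp (f := fun y : ℝ => (k, y)) (by fun_prop)
    (fun y _ => ⟨hk, trivial⟩))

theorem differentiableOn_volterra (h : VolterraBound K S a) (c : Fin 2 → ℂ) {U : Set ℂ}
    (hU : IsOpen U) (hUS : U ⊆ S)
    (hK : ∀ x y i j, Differentiable ℂ fun k => K k x y i j) (x : ℝ) :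
    DifferentiableOn ℂ (fun k => volterra K c k x) U :=
  Complex.differentiableOn_tsum_of_summable_norm (summable_majorant c (∫ y, a y))
    (fun n => h.differentiableOn_term c hU hUS hK n x) hU
    fun n k hk => h.norm_term_le' c n (hUS hk) x

theorem integrableOn_kernel_mulVec (h : VolterraBound K S a) {k : ℂ} (hk : k ∈ S) (x : ℝ)
    {f : ℝ → Fin 2 → ℂ} (hf : Continuous f) {C : ℝ} (hC : ∀ y, ‖f y‖ ≤ C) :
    IntegrableOn (fun y => K k x y *ᵥ f y) (Set.Ioi x) := by
  refine (h.integrable.mul_const C).integrableOn.mono'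
    (h.continuous_kernel_mulVec x hf).aestronglyMeasurable ?_
  refine (ae_restrict_iff' measurableSet_Ioi).2 (Eventually.of_forall fun y hy => ?_)
  exact (h.bound _ hk _ _ (le_of_lt hy) _).trans
    (mul_le_mul_of_nonneg_left (hC y) (h.nonneg y))

/-- Shifting the index of the Neumann series and exchanging sum and integral; the factorial majorant
makes the integrals of the norms summable. -/
theorem volterra_eq (h : VolterraBound K S a) (c : Fin 2 → ℂ) {k : ℂ} (hk : k ∈ S) (x : ℝ) :
    volterra K c k x = c + ∫ y in Set.Ioi x, K k x y *ᵥ volterra K c k y := by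
  have h1 : volterra K c k x = c + ∑' n, volterraTerm K c (n + 1) k x := by
    rw [volterra, (h.summable_term c hk x).tsum_eq_zero_add]
    simp [volterraTerm]
  have h2 : ∀ y, K k x y *ᵥ volterra K c k y = ∑' n, K k x y *ᵥ volterraTerm K c n k y := by
    intro y
    exact (LinearMap.toContinuousLinearMap (Matrix.mulVecLin (K k x y))).map_tsum
      (h.summable_term c hk y)
  simp_rw [h1, h2]
  congr 1
  refine integral_tsum_of_summable_integral_norm
    (F := fun n y => K k x y *ᵥ volterraTerm K c n k y)
    (fun n => h.integrableOn_kernel_mulVec hk x (h.continuous_term c n hk)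
      (fun y => h.norm_term_le' c n hk y)) ?_
  have hs := (summable_majorant c (∫ y, a y)).mul_left (∫ y, a y)
  refine hs.of_nonneg_of_le (fun n => integral_nonneg fun y => norm_nonneg _) fun n => ?_
  rw [← integral_mul_const]
  refine (integral_mono_of_nonneg (Eventually.of_forall fun y => norm_nonneg _)
    (h.integrable.mul_const _).integrableOn ?_).trans
    (setIntegral_le_integral (h.integrable.mul_const _) (Eventually.of_forall fun y =>
      mul_nonneg (h.nonneg y) ((norm_nonneg _).trans (h.norm_term_le' c n hk y))))
  refine (ae_restrict_iff' measurableSet_Ioi).2 (Eventually.of_forall fun y hy => ?_)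
  exact (h.bound _ hk _ _ (le_of_lt hy) _).trans
    (mul_le_mul_of_nonneg_left (h.norm_term_le' c n hk y) (h.nonneg y))

end VolterraBound

end DNLS

namespace DNLS

/-! ### The basic Jost column of a potential -/

/-- Admissible potentials at a fixed time. -/
structure Potential (p : ℝ → ℂ) : Prop where
  contDiff : ContDiff ℝ 1 p
  integrable : Integrable p
  integrable_deriv : Integrable (deriv p)
  tendsto_zero : Tendsto p (cocompact ℝ) (𝓝 0)

namespace Potential

variable {p : ℝ → ℂ}

theorem continuous (hp : Potential p) : Continuous p := hp.contDiff.continuous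

theorem continuous_deriv (hp : Potential p) : Continuous (deriv p) :=
  hp.contDiff.continuous_deriv le_rfl

theorem hasDerivAt (hp : Potential p) (x : ℝ) : HasDerivAt p (deriv p x) x :=
  (hp.contDiff.differentiable one_ne_zero x).hasDerivAt

theorem bounded (hp : Potential p) : ∃ P, 0 ≤ P ∧ ∀ x, ‖p x‖ ≤ P := by
  have h1 : ∀ᶠ x in cocompact ℝ, ‖p x‖ < 1 := by
    have := hp.tendsto_zero.norm
    rw [norm_zero] at this
    exact this.eventually (gt_mem_nhds one_pos)
  obtain ⟨s, hs, hsub⟩ := mem_cocompact.1 h1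
  obtain ⟨C, hC⟩ := hs.exists_bound_of_continuousOn hp.continuous.continuousOn
  refine ⟨max C 1, le_max_of_le_right zero_le_one, fun x => ?_⟩
  by_cases hx : x ∈ s
  · exact (hC x hx).trans (le_max_left _ _)
  · exact (le_of_lt (hsub hx)).trans (le_max_right _ _)

theorem integrable_norm_pow (hp : Potential p) (n : ℕ) :
    Integrable fun x => ‖p x‖ ^ (n + 1) := by
  obtain ⟨P, hP0, hP⟩ := hp.bounded
  refine (hp.integrable.norm.const_mul (P ^ n)).mono'
    (hp.continuous.norm.pow _).aestronglyMeasurable (Eventually.of_forall fun x => ?_)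
  rw [Real.norm_of_nonneg (by positivity), pow_succ]
  gcongr
  exact hP x

end Potential

theorem im_sq (k : ℂ) : (k ^ 2).im = 2 * (k.re * k.im) := by
  simp [pow_two]; ring

/-- The Volterra kernel of the first column of the Jost solution at `+∞`. -/
def jostKernel (p : ℝ → ℂ) (k : ℂ) (x y : ℝ) : Matrix (Fin 2) (Fin 2) ℂ :=
  !![0, -(k * p y);
    Complex.exp (-(2 * Complex.I * k ^ 2 * x)) *
      (Complex.exp (2 * Complex.I * k ^ 2 * y) * (k * conj (p y))), 0]

/-- `μ₊₁` at a fixed time. -/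
def jost (p : ℝ → ℂ) (k : ℂ) (x : ℝ) : Fin 2 → ℂ := volterra (jostKernel p) ![1, 0] k x

theorem norm_exp_phase_le {k : ℂ} (hk : 0 ≤ k.re * k.im) {x y : ℝ} (hxy : x ≤ y) :
    ‖Complex.exp (-(2 * Complex.I * k ^ 2 * x)) * Complex.exp (2 * Complex.I * k ^ 2 * y)‖ ≤ 1 := by
  rw [← Complex.exp_add, Complex.norm_exp]
  have : (-(2 * Complex.I * k ^ 2 * x) + 2 * Complex.I * k ^ 2 * y).re
      = -(4 * (k.re * k.im) * (y - x)) := by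
    have e : -(2 * Complex.I * k ^ 2 * x) + 2 * Complex.I * k ^ 2 * y
        = Complex.I * k ^ 2 * ((2 * (y - x) : ℝ) : ℂ) := by push_cast; ring
    rw [e, Complex.re_mul_ofReal, Complex.I_mul_re, im_sq]; ring
  rw [this, Real.exp_le_one_iff]
  have := mul_nonneg hk (sub_nonneg.2 hxy)
  linarith

/-- The kernel is off-diagonal and the exponential factor has modulus at most one when `Im k² ≥ 0`
and `x ≤ y`, so in the sup norm only `‖k‖ ‖p y‖` is left. The cap `ρ` on `‖k‖` makes the majorant
independent of `k`; local statements in `k` use `ρ = ‖k‖ + 1`. -/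
theorem jostKernel_bound {p : ℝ → ℂ} (hp : Potential p) {ρ : ℝ} (hρ : 0 ≤ ρ) :
    VolterraBound (jostKernel p) {k | 0 ≤ k.re * k.im ∧ ‖k‖ ≤ ρ} (fun y => ρ * ‖p y‖) where
  cont_kernel := by
    have := hp.continuous
    refine continuous_matrix fun i j => ?_
    fin_cases i <;> fin_cases j <;> simp [jostKernel] <;> fun_prop
  cont := by have := hp.continuous; fun_prop
  nonneg y := by positivity
  integrable := hp.integrable.norm.const_mul _
  bound := by
    rintro k ⟨hk, hkρ⟩ x y hxy v
    have hkp : ‖k‖ * ‖p y‖ ≤ ρ * ‖p y‖ := by gcongr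
    have h0 : 0 ≤ ρ * ‖p y‖ * ‖v‖ := by positivity
    refine (pi_norm_le_iff_of_nonneg h0).2 fun i => ?_
    fin_cases i
    · simp [jostKernel, Matrix.mulVec, dotProduct]
      gcongr
      exact norm_le_pi_norm v 1
    · simp only [jostKernel, Matrix.mulVec, dotProduct, Fin.sum_univ_two, Fin.mk_one, Fin.isValue,
        Matrix.of_apply, Matrix.cons_val_one, Matrix.cons_val_zero, Matrix.cons_val_fin_one,
        zero_mul, add_zero]
      rw [← mul_assoc, norm_mul _ (v 0), norm_mul _ (k * _), norm_mul k, RCLike.norm_conj]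
      calc _ ≤ 1 * (ρ * ‖p y‖) * ‖v‖ := by
            gcongr
            · exact norm_exp_phase_le hk hxy
            · exact norm_le_pi_norm v 0
        _ = _ := by ring

theorem continuousOn_jost {p : ℝ → ℂ} (hp : Potential p) (x : ℝ) :
    ContinuousOn (fun k => jost p k x) {k | 0 ≤ k.re * k.im} := by
  intro k hk
  have h := ((jostKernel_bound hp (ρ := ‖k‖ + 1) (by positivity)).continuousOn_volterra
    ![1, 0]).comp (f := fun k : ℂ => (k, x)) (s := {k' | 0 ≤ k'.re * k'.im ∧ ‖k'‖ ≤ ‖k‖ + 1})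
    (by fun_prop) (fun k hk => ⟨hk, trivial⟩)
  refine (h k ⟨hk, by linarith⟩).mono_of_mem_nhdsWithin ?_
  have : ∀ᶠ k' in 𝓝 k, ‖k'‖ < ‖k‖ + 1 := continuous_norm.continuousAt.eventually
    (gt_mem_nhds (by linarith))
  filter_upwards [self_mem_nhdsWithin, nhdsWithin_le_nhds this] with k' h1 h2 using ⟨h1, h2.le⟩

theorem isOpen_Dplus : IsOpen Dplus :=
  isOpen_lt continuous_const (Complex.continuous_re.mul Complex.continuous_im)

theorem isOpen_Dminus : IsOpen Dminus :=
  isOpen_lt (Complex.continuous_re.mul Complex.continuous_im) continuous_const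

theorem differentiableOn_jost {p : ℝ → ℂ} (hp : Potential p) (x : ℝ) :
    DifferentiableOn ℂ (fun k => jost p k x) Dplus := by
  intro k hk
  have hU : IsOpen {k' : ℂ | k' ∈ Dplus ∧ ‖k'‖ < ‖k‖ + 1} :=
    isOpen_Dplus.inter (isOpen_lt continuous_norm continuous_const)
  have h := (jostKernel_bound hp (ρ := ‖k‖ + 1) (by positivity)).differentiableOn_volterra
    ![1, 0] hU (fun k' hk' => ⟨le_of_lt hk'.1, le_of_lt hk'.2⟩) (fun x y i j => by
      fin_cases i <;> fin_cases j <;> simp [jostKernel] <;> fun_prop) x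
  exact (h.differentiableAt (hU.mem_nhds ⟨hk, by linarith⟩)).differentiableWithinAt

theorem tendsto_jost {p : ℝ → ℂ} (hp : Potential p) {k : ℂ} (hk : 0 ≤ k.re * k.im) :
    Tendsto (jost p k) atTop (𝓝 ![1, 0]) :=
  (jostKernel_bound hp (norm_nonneg k)).tendsto_volterra _ ⟨hk, le_rfl⟩

/-- In the kernel the phase is split into a factor in `x` and a factor in `y`. Pulling the former
out of the integral leaves pure tails, which are differentiated by the fundamental theorem of
calculus; the term `-2ik²` comes from the extracted exponential. -/
theorem hasDerivAt_jost {p : ℝ → ℂ} (hp : Potential p) {k : ℂ} (hk : 0 ≤ k.re * k.im) (x : ℝ) :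
    HasDerivAt (jost p k)
      (!![0, k * p x; -(k * conj (p x)), -(2 * Complex.I * k ^ 2)] *ᵥ jost p k x) x := by
  have hb := jostKernel_bound hp (norm_nonneg k)
  have hkS : k ∈ {k' : ℂ | 0 ≤ k'.re * k'.im ∧ ‖k'‖ ≤ ‖k‖} := ⟨hk, le_rfl⟩
  have hc : Continuous (jost p k) := hb.continuous_volterra _ hkS
  have hc0 : Continuous fun y => jost p k y 0 := (continuous_apply 0).comp hc
  have hc1 : Continuous fun y => jost p k y 1 := (continuous_apply 1).comp hc
  have hpc := hp.continuous
  obtain ⟨C, hC⟩ : ∃ C, ∀ y, ‖jost p k y‖ ≤ C := by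
    refine ⟨‖(![1, 0] : Fin 2 → ℂ)‖ * Real.exp (∫ y, ‖k‖ * ‖p y‖),
      fun y => (hb.norm_le _ hkS y).trans ?_⟩
    refine mul_le_mul_of_nonneg_left (Real.exp_le_exp.2 (tail_le hb.nonneg hb.integrable y))
      (norm_nonneg _)
  have hint := fun x => hb.integrableOn_kernel_mulVec hkS x hc hC
  have heq := fun x => hb.volterra_eq ![1, 0] hkS x
  have hcomp : ∀ x i, jost p k x i = (![1, 0] : Fin 2 → ℂ) i +
      ∫ y in Set.Ioi x, (jostKernel p k x y *ᵥ jost p k y) i := by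
    intro x i
    rw [← eval_integral (fun i => (hint x).eval i)]
    exact congrFun (heq x) i
  have e0 : ∀ x, jost p k x 0 = 1 + tail (fun y => -(k * p y) * jost p k y 1) x := by
    intro x
    rw [hcomp x 0]
    simp [jostKernel, tail, Matrix.mulVec, dotProduct]
  have e1 : ∀ x, jost p k x 1 = Complex.exp (-(2 * Complex.I * k ^ 2 * x)) *
      tail (fun y => Complex.exp (2 * Complex.I * k ^ 2 * y) * (k * conj (p y))
        * jost p k y 0) x := by
    intro x
    rw [hcomp x 1, tail, ← integral_const_mul]
    simp [jostKernel, Matrix.mulVec, dotProduct, mul_assoc]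
  have i0 : ∀ x, IntegrableOn (fun y => -(k * p y) * jost p k y 1) (Set.Ioi x) := by
    intro x
    have := (hint x).eval 0
    simpa [jostKernel, Matrix.mulVec, dotProduct, IntegrableOn] using this
  have i1 : ∀ x : ℝ, IntegrableOn (fun y : ℝ => Complex.exp (2 * Complex.I * k ^ 2 * y)
      * (k * conj (p y)) * jost p k y 0) (Set.Ioi x) := by
    intro x
    have := ((hint x).eval 1).const_mul (Complex.exp (2 * Complex.I * k ^ 2 * x))
    refine this.congr (Eventually.of_forall fun y => ?_)
    simp only [jostKernel, Matrix.mulVec, dotProduct, Fin.sum_univ_two, Fin.isValue,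
        Matrix.of_apply, Matrix.cons_val_one, Matrix.cons_val_zero, Matrix.cons_val_fin_one,
        zero_mul, add_zero]
    rw [← mul_assoc, ← mul_assoc, ← Complex.exp_add, add_neg_cancel, Complex.exp_zero, one_mul]
  refine hasDerivAt_pi.2 fun i => ?_
  fin_cases i
  · have := (hasDerivAt_tail (by fun_prop) i0 x).const_add 1
    change HasDerivAt (fun x => jost p k x 0) _ x
    rw [funext e0]
    refine this.congr_deriv ?_
    symm
    simp [Matrix.mulVec, dotProduct]
  · have h1 := hasDerivAt_tail (by fun_prop) i1 x
    have h2 : HasDerivAt (fun x : ℝ => Complex.exp (-(2 * Complex.I * k ^ 2 * x)))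
        (Complex.exp (-(2 * Complex.I * k ^ 2 * x)) * (-(2 * Complex.I * k ^ 2))) x := by
      have := ((Complex.ofRealCLM.hasDerivAt (x := x)).const_mul (2 * Complex.I * k ^ 2)).neg.cexp
      simpa using this
    have := h2.fun_mul h1
    change HasDerivAt (fun x => jost p k x 1) _ x
    rw [show (fun x => jost p k x 1) = _ from funext e1]
    refine this.congr_deriv ?_
    symm
    simp only [Matrix.mulVec, dotProduct, Fin.sum_univ_two, Fin.isValue, Fin.mk_one,
        Matrix.of_apply, Matrix.cons_val_one, Matrix.cons_val_zero, Matrix.cons_val_fin_one]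
    rw [e1 x]
    have he : Complex.exp (-(2 * Complex.I * k ^ 2 * x)) * Complex.exp (2 * Complex.I * k ^ 2 * x)
        = 1 := by rw [← Complex.exp_add, neg_add_cancel, Complex.exp_zero]
    linear_combination (k * conj (p x) * jost p k x 0) * he

end DNLS

namespace DNLS

/-! ### Large-`k` asymptotics of the basic Jost column -/

theorem hasDerivAt_normSq {f : ℝ → ℂ} {f' : ℂ} {x : ℝ} (hf : HasDerivAt f f' x) :
    HasDerivAt (fun y => ‖f y‖ ^ 2) (2 * (conj (f x) * f').re) x := by
  have hre : HasDerivAt (fun y => (f y).re) f'.re x := by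
    exact (Complex.reCLM.hasFDerivAt (x := f x)).comp_hasDerivAt x hf
  have him : HasDerivAt (fun y => (f y).im) f'.im x := by
    exact (Complex.imCLM.hasFDerivAt (x := f x)).comp_hasDerivAt x hf
  have e : (fun y => ‖f y‖ ^ 2) = fun y => (f y).re ^ 2 + (f y).im ^ 2 := by
    funext y
    rw [← Complex.normSq_eq_norm_sq, Complex.normSq_apply]; ring
  rw [e]
  refine ((hre.fun_pow 2).fun_add (him.fun_pow 2)).congr_deriv ?_
  simp
  ring

theorem abs_two_re_conj_mul_le (a b c : ℂ) :
    |2 * (conj a * (c * b)).re| ≤ ‖c‖ * (‖a‖ ^ 2 + ‖b‖ ^ 2) := by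
  rw [abs_mul, abs_two]
  have h := Complex.abs_re_le_norm (conj a * (c * b))
  rw [norm_mul, norm_mul, RCLike.norm_conj] at h
  have h2 : 2 * (‖a‖ * ‖b‖) ≤ ‖a‖ ^ 2 + ‖b‖ ^ 2 := by nlinarith [sq_nonneg (‖a‖ - ‖b‖)]
  nlinarith [norm_nonneg c, mul_le_mul_of_nonneg_left h2 (norm_nonneg c)]

/-- Backward Grönwall inequality from `+∞`. -/
theorem le_of_deriv_ge_neg_mul {E E' c : ℝ → ℝ} (hE : ∀ x, HasDerivAt E (E' x) x)
    (hc : Continuous c) (hci : Integrable c) (h : ∀ x, -(c x * E x) ≤ E' x) {L : ℝ}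
    (hL : Tendsto E atTop (𝓝 L)) (x : ℝ) : E x ≤ L * Real.exp (tail c x) := by
  have hd := fun y => hasDerivAt_tail hc (fun x => hci.integrableOn (s := Set.Ioi x)) y
  have hF : ∀ y, HasDerivAt (fun y => E y * Real.exp (-tail c y))
      ((E' y + c y * E y) * Real.exp (-tail c y)) y := fun y => by
    refine ((hE y).fun_mul (hd y).fun_neg.exp).congr_deriv ?_
    ring
  have hmono : Monotone fun y => E y * Real.exp (-tail c y) := by
    refine monotone_of_deriv_nonneg (fun y => (hF y).differentiableAt) fun y => ?_
    rw [(hF y).deriv]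
    exact mul_nonneg (by linarith [h y]) (Real.exp_pos _).le
  have hlim : Tendsto (fun y => E y * Real.exp (-tail c y)) atTop (𝓝 L) := by
    have := (tendsto_tail (fun x => hci.integrableOn (s := Set.Ioi x))).neg
    have := hL.mul ((Real.continuous_exp.tendsto _).comp this)
    simpa using this
  have := hmono.ge_of_tendsto hlim x
  rw [Real.exp_neg] at this
  have hp := Real.exp_pos (tail c x)
  field_simp at this
  linarith

/-- The size of the coefficients of the transformed spectral problem. -/
def transformedBound (p : ℝ → ℂ) (x : ℝ) : ℝ :=
  ‖p x‖ + (‖deriv p x‖ + ‖p x‖ ^ 3)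

theorem Potential.transformedBound_continuous {p : ℝ → ℂ} (hp : Potential p) :
    Continuous (transformedBound p) := by
  have := hp.continuous
  have := hp.continuous_deriv
  unfold transformedBound
  fun_prop

theorem Potential.transformedBound_integrable {p : ℝ → ℂ} (hp : Potential p) :
    Integrable (transformedBound p) :=
  hp.integrable.norm.add (hp.integrable_deriv.norm.add (hp.integrable_norm_pow 2))

/-! ### The substitution that removes the growth in `k`. -/

section transformed

variable {p : ℝ → ℂ} {k : ℂ}

/-- The second component of the transformed Jost column. -/
def jostZ (p : ℝ → ℂ) (k : ℂ) (x : ℝ) : ℂ :=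
  k * jost p k x 1 - Complex.I / 2 * conj (p x) * jost p k x 0

/-- The lower left coefficient of the transformed spectral problem. -/
def jostR (p : ℝ → ℂ) (x : ℝ) : ℂ :=
  -(Complex.I / 2) * (conj (deriv p x) + Complex.I / 2 * (‖p x‖ : ℂ) ^ 2 * conj (p x))

theorem norm_jostR_le (p : ℝ → ℂ) (x : ℝ) :
    ‖jostR p x‖ ≤ ‖deriv p x‖ + ‖p x‖ ^ 3 := by
  have h2 : ‖conj (deriv p x) + Complex.I / 2 * (‖p x‖ : ℂ) ^ 2 * conj (p x)‖
      ≤ ‖deriv p x‖ + 1 / 2 * ‖p x‖ ^ 3 := by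
    refine (norm_add_le _ _).trans (le_of_eq ?_)
    rw [norm_mul, norm_mul, norm_pow, Complex.norm_real, norm_norm, RCLike.norm_conj,
      RCLike.norm_conj]
    simp
    ring
  rw [jostR, norm_mul]
  have h3 : ‖-(Complex.I / 2)‖ = 1 / 2 := by simp
  rw [h3]
  nlinarith [norm_nonneg (deriv p x), pow_nonneg (norm_nonneg (p x)) 3]

/-- In terms of `jostZ` the factor `k` in front of the second component disappears: the coefficients
are `p` and the purely imaginary `i|p|²/2`, free of `k`. -/
theorem hasDerivAt_jost_zero (hp : Potential p) (hk : 0 ≤ k.re * k.im) (x : ℝ) :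
    HasDerivAt (fun y => jost p k y 0)
      (Complex.I / 2 * (‖p x‖ : ℂ) ^ 2 * jost p k x 0 + p x * jostZ p k x) x := by
  refine (hasDerivAt_pi.1 (hasDerivAt_jost hp hk x) 0).congr_deriv ?_
  have : (‖p x‖ : ℂ) ^ 2 = conj (p x) * p x := (Complex.conj_mul' _).symm
  rw [this]
  simp [Matrix.mulVec, dotProduct, jostZ]
  ring

/-- The `k²` terms multiplying the first component cancel, by the choice of the constant `i/2` in
`jostZ`. Only `-2ik² z` still depends on `k`, and its contribution to the energy has a fixed sign.
-/
theorem hasDerivAt_jostZ (hp : Potential p) (hk : 0 ≤ k.re * k.im) (x : ℝ) :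
    HasDerivAt (jostZ p k)
      (-(2 * Complex.I * k ^ 2) * jostZ p k x + jostR p x * jost p k x 0
        - Complex.I / 2 * (‖p x‖ : ℂ) ^ 2 * jostZ p k x) x := by
  have h1 := hasDerivAt_pi.1 (hasDerivAt_jost hp hk x) 1
  have h0 := hasDerivAt_pi.1 (hasDerivAt_jost hp hk x) 0
  have hpc : HasDerivAt (fun y => conj (p y)) (conj (deriv p x)) x := by
    simpa using (hp.hasDerivAt x).star
  refine ((h1.const_mul k).fun_sub ((hpc.const_mul (Complex.I / 2)).fun_mul h0)).congr_deriv ?_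
  have : (‖p x‖ : ℂ) ^ 2 = conj (p x) * p x := (Complex.conj_mul' _).symm
  simp only [jostR, this]
  simp [Matrix.mulVec, dotProduct, jostZ]
  have hI := Complex.I_sq
  linear_combination (-(k ^ 2 * conj (p x) * jost p k x 0)) * hI

theorem tendsto_jost_zero (hp : Potential p) (hk : 0 ≤ k.re * k.im) :
    Tendsto (fun x => jost p k x 0) atTop (𝓝 1) := by
  simpa using (tendsto_pi_nhds.1 (tendsto_jost hp hk)) 0

theorem tendsto_jostZ (hp : Potential p) (hk : 0 ≤ k.re * k.im) :
    Tendsto (jostZ p k) atTop (𝓝 0) := by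
  have h1 : Tendsto (fun x => jost p k x 1) atTop (𝓝 0) := by
    simpa using (tendsto_pi_nhds.1 (tendsto_jost hp hk)) 1
  have h0 := tendsto_jost_zero hp hk
  have hp0 : Tendsto (fun x => conj (p x)) atTop (𝓝 0) := by
    simpa [Function.comp_def] using
      (Complex.continuous_conj.tendsto 0).comp (hp.tendsto_zero.mono_left atTop_le_cocompact)
  have := (h1.const_mul k).sub ((hp0.const_mul (Complex.I / 2)).mul h0)
  have e : (0 : ℂ) = k * 0 - Complex.I / 2 * 0 * 1 := by ring
  rw [e]
  exact this

/-- In the derivative of the energy the diagonal terms `±i|p|²/2` drop out, and `-2ik² z`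
contributes a nonnegative term when `Im k² ≥ 0`. The off-diagonal terms are at least
`-transformedBound` times the energy. Backward Grönwall from the value `1` at `+∞` gives a bound
independent of `k`. -/
theorem jost_energy_le (hp : Potential p) (hk : 0 ≤ k.re * k.im) (x : ℝ) :
    ‖jost p k x 0‖ ^ 2 + ‖jostZ p k x‖ ^ 2 ≤ Real.exp (∫ y, transformedBound p y) := by
  have hE : ∀ x, HasDerivAt (fun y => ‖jost p k y 0‖ ^ 2 + ‖jostZ p k y‖ ^ 2) _ x := fun x =>
    (hasDerivAt_normSq (hasDerivAt_jost_zero hp hk x)).fun_add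
      (hasDerivAt_normSq (hasDerivAt_jostZ hp hk x))
  have hlim : Tendsto (fun y => ‖jost p k y 0‖ ^ 2 + ‖jostZ p k y‖ ^ 2) atTop (𝓝 1) := by
    have := ((tendsto_jost_zero hp hk).norm.pow 2).add ((tendsto_jostZ hp hk).norm.pow 2)
    simpa using this
  have h0 : ∀ y, 0 ≤ transformedBound p y := fun y => by unfold transformedBound; positivity
  refine (le_of_deriv_ge_neg_mul hE hp.transformedBound_continuous hp.transformedBound_integrable
    (fun x => ?_) hlim x).trans ?_
  · have e1 : conj (jost p k x 0) * (Complex.I / 2 * (‖p x‖ : ℂ) ^ 2 * jost p k x 0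
          + p x * jostZ p k x)
        = Complex.I * ((‖p x‖ ^ 2 / 2 * ‖jost p k x 0‖ ^ 2 : ℝ) : ℂ)
          + conj (jost p k x 0) * (p x * jostZ p k x) := by
      push_cast
      rw [← Complex.conj_mul' (jost p k x 0)]; ring
    have e2 : conj (jostZ p k x) * (-(2 * Complex.I * k ^ 2) * jostZ p k x
          + jostR p x * jost p k x 0 - Complex.I / 2 * (‖p x‖ : ℂ) ^ 2 * jostZ p k x)
        = (Complex.I * k ^ 2) * ((-2 * ‖jostZ p k x‖ ^ 2 : ℝ) : ℂ)
          + conj (jostZ p k x) * (jostR p x * jost p k x 0)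
          - Complex.I * ((‖p x‖ ^ 2 / 2 * ‖jostZ p k x‖ ^ 2 : ℝ) : ℂ) := by
      push_cast
      rw [← Complex.conj_mul' (jostZ p k x)]; ring
    rw [e1, e2, Complex.add_re, Complex.sub_re, Complex.add_re, Complex.re_mul_ofReal,
      Complex.re_mul_ofReal, Complex.re_mul_ofReal, Complex.I_mul_re, im_sq, Complex.I_re]
    have a1 := (abs_le.1 (abs_two_re_conj_mul_le (jost p k x 0) (jostZ p k x) (p x))).1
    have a2 := (abs_le.1 (abs_two_re_conj_mul_le (jostZ p k x) (jost p k x 0) (jostR p x))).1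
    have a3 := mul_le_mul_of_nonneg_right (norm_jostR_le p x)
      (by positivity : 0 ≤ ‖jost p k x 0‖ ^ 2 + ‖jostZ p k x‖ ^ 2)
    have a4 : 0 ≤ (k.re * k.im) * ‖jostZ p k x‖ ^ 2 := by positivity
    unfold transformedBound
    nlinarith
  · rw [one_mul]
    exact Real.exp_le_exp.2 (tail_le h0 hp.transformedBound_integrable x)

/-- The limit of `μ₊₁` as `k → ∞`. -/
def jostLimit (p : ℝ → ℂ) (x : ℝ) : ℂ :=
  Complex.exp (-(Complex.I * ((1 / 2 * tail (fun y => ‖p y‖ ^ 2) x : ℝ) : ℂ)))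

/-- The second component is `1/k` times quantities bounded by the energy. For the first, the factor
`e^{iw}` with `w = ½ ∫_x^∞ |p|²` removes the diagonal term, and the remaining `p z` is integrated by
parts using `z = -z'/(2ik²) + …`. -/
theorem jost_asymptotics (hp : Potential p) (x : ℝ) :
    ∃ C, 0 ≤ C ∧ ∀ k : ℂ, 0 ≤ k.re * k.im → 1 ≤ ‖k‖ →
      ‖jost p k x 0 - jostLimit p x‖ ≤ C / ‖k‖ ∧ ‖jost p k x 1‖ ≤ C / ‖k‖ := by
  obtain ⟨P, hP0, hP⟩ := hp.bounded
  -- With the extra `1`, the inequality `2a ≤ a² + 1` turns the energy bound into `a ≤ B` for each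
  -- component.
  set B : ℝ := Real.exp (∫ y, transformedBound p y) + 1 with hB
  have hB1 : 1 ≤ B := by have := Real.exp_pos (∫ y, transformedBound p y); linarith
  set D : ℝ → ℝ := fun y => B * (P * ‖p y‖ ^ 2 + ‖deriv p y‖ + P * (‖deriv p y‖ + ‖p y‖ ^ 3)
    + P * ‖p y‖ ^ 2) with hD
  have hDi : Integrable D := (((((hp.integrable_norm_pow 1).const_mul P).add
    hp.integrable_deriv.norm).add ((hp.integrable_deriv.norm.add
      (hp.integrable_norm_pow 2)).const_mul P)).add
      ((hp.integrable_norm_pow 1).const_mul P)).const_mul B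
  have hD0 : ∀ y, 0 ≤ D y := fun y => by simp only [hD]; positivity
  have hDI : 0 ≤ ∫ y, D y := integral_nonneg hD0
  refine ⟨(∫ y, D y) + P * B + B, by positivity, fun k hk hk1 => ?_⟩
  have hE := jost_energy_le hp hk
  have hm : ∀ y, ‖jost p k y 0‖ ≤ B := fun y => by
    have := hE y
    nlinarith [sq_nonneg (‖jost p k y 0‖ - 1), sq_nonneg ‖jostZ p k y‖, norm_nonneg (jost p k y 0)]
  have hz : ∀ y, ‖jostZ p k y‖ ≤ B := fun y => by
    have := hE y
    nlinarith [sq_nonneg (‖jostZ p k y‖ - 1), sq_nonneg ‖jost p k y 0‖, norm_nonneg (jostZ p k y)]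
  have hkpos : 0 < ‖k‖ := by linarith
  have hk0 : k ≠ 0 := norm_pos_iff.1 hkpos
  constructor
  · set w : ℝ → ℝ := fun y => 1 / 2 * tail (fun y => ‖p y‖ ^ 2) y with hw
    have hpn : ∀ x, IntegrableOn (fun y => ‖p y‖ ^ 2) (Set.Ioi x) := fun x =>
      (hp.integrable_norm_pow 1).integrableOn
    have hpc := hp.continuous
    have hwd : ∀ y, HasDerivAt (fun y => (w y : ℂ)) (-(1 / 2 * (‖p y‖ : ℂ) ^ 2)) y := fun y => by
      have := ((hasDerivAt_tail (by fun_prop) hpn y).const_mul (1 / 2 : ℝ)).ofReal_comp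
      refine this.congr_deriv ?_
      push_cast; ring
    set e : ℝ → ℂ := fun y => Complex.exp (Complex.I * w y) with he
    have hed : ∀ y, HasDerivAt e (e y * (Complex.I * -(1 / 2 * (‖p y‖ : ℂ) ^ 2))) y := fun y =>
      ((hwd y).const_mul Complex.I).cexp
    have hen : ∀ y, ‖e y‖ = 1 := fun y => by
      simp only [he]
      rw [mul_comm]
      exact Complex.norm_exp_ofReal_mul_I (w y)
    set Λ : ℂ := (2 * Complex.I * k ^ 2)⁻¹ with hΛ
    have hΛ0 : Λ * (2 * Complex.I * k ^ 2) = 1 := inv_mul_cancel₀ (by simp [hk0])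
    have hΛn : ‖Λ‖ ≤ 1 / ‖k‖ := by
      rw [hΛ, norm_inv, norm_mul, norm_mul, norm_pow, Complex.norm_I, one_div]
      simp only [Complex.norm_ofNat, mul_one]
      exact inv_anti₀ hkpos (by nlinarith)
    -- The correction `Λ p z` performs the integration by parts: its derivative cancels `p z`
    -- through `Λ · 2ik² = 1`, so that `h'` is `Λ` times a function dominated by the integrable `D`,
    -- while `h → 1` at `+∞`.
    set h : ℝ → ℂ := fun y => e y * (jost p k y 0 + Λ * (p y * jostZ p k y)) with hh
    set h' : ℝ → ℂ := fun y => Λ * (e y * (-(Complex.I / 2 * (‖p y‖ : ℂ) ^ 2) * (p y * jostZ p k y)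
      + deriv p y * jostZ p k y + p y * (jostR p y * jost p k y 0
        - Complex.I / 2 * (‖p y‖ : ℂ) ^ 2 * jostZ p k y))) with hh'
    have hhd : ∀ y, HasDerivAt h (h' y) y := fun y => by
      refine ((hed y).fun_mul ((hasDerivAt_jost_zero hp hk y).fun_add
        (((hp.hasDerivAt y).fun_mul (hasDerivAt_jostZ hp hk y)).const_mul Λ))).congr_deriv ?_
      simp only [hh']
      linear_combination (-(e y * p y * jostZ p k y)) * hΛ0
    have hbd : ∀ y, ‖h' y‖ ≤ ‖Λ‖ * D y := fun y => by
      simp only [hh']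
      rw [norm_mul, norm_mul, hen, one_mul]
      refine mul_le_mul_of_nonneg_left ?_ (norm_nonneg _)
      have n1 : ‖(Complex.I / 2 * (‖p y‖ : ℂ) ^ 2)‖ ≤ ‖p y‖ ^ 2 := by
        rw [norm_mul, norm_pow, Complex.norm_real, norm_norm]
        simp
        nlinarith [sq_nonneg ‖p y‖]
      have t1 : ‖-(Complex.I / 2 * (‖p y‖ : ℂ) ^ 2) * (p y * jostZ p k y)‖
          ≤ ‖p y‖ ^ 2 * (P * B) := by
        rw [norm_mul, norm_neg, norm_mul (p y)]
        gcongr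
        exacts [hP y, hz y]
      have t2 : ‖deriv p y * jostZ p k y‖ ≤ ‖deriv p y‖ * B := by
        rw [norm_mul]; gcongr; exact hz y
      have t3 : ‖p y * (jostR p y * jost p k y 0
          - Complex.I / 2 * (‖p y‖ : ℂ) ^ 2 * jostZ p k y)‖
          ≤ P * ((‖deriv p y‖ + ‖p y‖ ^ 3) * B + ‖p y‖ ^ 2 * B) := by
        rw [norm_mul]
        gcongr
        · exact hP y
        refine (norm_sub_le _ _).trans ?_
        rw [norm_mul, norm_mul _ (jostZ p k y)]
        gcongr
        exacts [norm_jostR_le p y, hm y, hz y]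
      refine (norm_add₃_le).trans ?_
      simp only [hD]
      linarith
    have hcont : Continuous h' := by
      have hj : Continuous fun y => jost p k y 0 :=
        continuous_iff_continuousAt.2 fun y => (hasDerivAt_jost_zero hp hk y).continuousAt
      have hjz : Continuous (jostZ p k) :=
        continuous_iff_continuousAt.2 fun y => (hasDerivAt_jostZ hp hk y).continuousAt
      have hec : Continuous e := continuous_iff_continuousAt.2 fun y => (hed y).continuousAt
      have hdc := hp.continuous_deriv
      have hR : Continuous (jostR p) := by unfold jostR; fun_prop
      simp only [hh']
      fun_prop
    have hint : Integrable h' := (hDi.const_mul ‖Λ‖).mono' hcont.aestronglyMeasurable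
      (Eventually.of_forall hbd)
    have hlim : Tendsto h atTop (𝓝 1) := by
      have hw0 : Tendsto (fun y => (w y : ℂ)) atTop (𝓝 0) := by
        have := (Complex.continuous_ofReal.tendsto _).comp ((tendsto_tail hpn).const_mul (1 / 2))
        simpa [hw, Function.comp_def] using this
      have he0 : Tendsto e atTop (𝓝 1) := by
        have := (Complex.continuous_exp.tendsto _).comp (hw0.const_mul Complex.I)
        simpa [he, Function.comp_def] using this
      have := he0.mul ((tendsto_jost_zero hp hk).add
        (((hp.tendsto_zero.mono_left atTop_le_cocompact).mul (tendsto_jostZ hp hk)).const_mul Λ))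
      simpa using this
    have hI := integral_Ioi_of_hasDerivAt_of_tendsto' (a := x) (fun y _ => hhd y)
      hint.integrableOn hlim
    have hIn : ‖1 - h x‖ ≤ ‖Λ‖ * ∫ y, D y := by
      rw [← hI]
      refine (norm_integral_le_of_norm_le (hDi.const_mul ‖Λ‖).integrableOn
        (Eventually.of_forall hbd)).trans ?_
      refine (setIntegral_le_integral (hDi.const_mul ‖Λ‖) (Eventually.of_forall fun y =>
        mul_nonneg (norm_nonneg _) (hD0 y))).trans ?_
      rw [integral_const_mul]
    have hlim_e : jostLimit p x * e x = 1 := by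
      rw [jostLimit, ← Complex.exp_add, neg_add_cancel, Complex.exp_zero]
    have hln : ‖jostLimit p x‖ = 1 := by
      have := congrArg norm hlim_e
      rwa [norm_mul, hen, mul_one, norm_one] at this
    have key : jost p k x 0 - jostLimit p x
        = jostLimit p x * -(1 - h x) - Λ * (p x * jostZ p k x) := by
      simp only [hh]
      linear_combination (-(jost p k x 0 + Λ * (p x * jostZ p k x))) * hlim_e
    rw [key]
    refine (norm_sub_le _ _).trans ?_
    rw [norm_mul, hln, one_mul, norm_neg, norm_mul, norm_mul]
    have : ‖p x‖ * ‖jostZ p k x‖ ≤ P * B := by gcongr; exacts [hP x, hz x]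
    calc ‖1 - h x‖ + ‖Λ‖ * (‖p x‖ * ‖jostZ p k x‖)
        ≤ ‖Λ‖ * (∫ y, D y) + ‖Λ‖ * (P * B) := by gcongr
      _ = ‖Λ‖ * ((∫ y, D y) + P * B) := by ring
      _ ≤ (1 / ‖k‖) * ((∫ y, D y) + P * B) := by gcongr
      _ ≤ ((∫ y, D y) + P * B + B) / ‖k‖ := by
        rw [one_div_mul_eq_div]
        exact div_le_div_of_nonneg_right (by linarith) hkpos.le
  · have e : jost p k x 1 = (jostZ p k x + Complex.I / 2 * conj (p x) * jost p k x 0) / k := by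
      rw [jostZ]; field_simp; ring
    rw [e, norm_div]
    gcongr
    refine (norm_add_le _ _).trans ?_
    rw [norm_mul, norm_mul, RCLike.norm_conj]
    have : ‖Complex.I / 2‖ ≤ 1 := by simp; norm_num
    have : ‖Complex.I / 2‖ * ‖p x‖ * ‖jost p k x 0‖ ≤ 1 * P * B := by
      gcongr
      exacts [hP x, hm x]
    linarith [hz x]

end transformed

end DNLS

namespace DNLS

/-! ### Cauchy integrals over the boundary of a quadrant -/

theorem integrableOn_Ioi_of_decay {g : ℝ → ℂ} (hg : ContinuousOn g (Set.Ici 0)) {C R : ℝ}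
    (hR : 0 < R) (hb : ∀ s, R ≤ s → ‖g s‖ ≤ C / s ^ 2) : IntegrableOn g (Set.Ioi 0) := by
  have h1 : IntegrableOn g (Set.Icc 0 R) :=
    (hg.mono Set.Icc_subset_Ici_self).integrableOn_compact isCompact_Icc
  have h2 : IntegrableOn g (Set.Ioi R) := by
    have hi : IntegrableOn (fun s : ℝ => C * s ^ (-2 : ℝ)) (Set.Ioi R) :=
      (integrableOn_Ioi_rpow_of_lt (by norm_num) hR).const_mul C
    refine hi.mono' ((hg.mono ?_).aestronglyMeasurable measurableSet_Ioi) ?_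
    · exact fun s hs => hR.le.trans (le_of_lt hs)
    · refine (ae_restrict_iff' measurableSet_Ioi).2 (Eventually.of_forall fun s hs => ?_)
      have hs0 : 0 < s := hR.trans hs
      rw [Real.rpow_neg hs0.le]
      norm_cast
      exact hb s (le_of_lt hs)
  refine (h1.union h2).mono_set fun s hs => ?_
  rcases le_or_gt s R with h | h
  · exact Or.inl ⟨le_of_lt hs, h⟩
  · exact Or.inr h

/-- `∫₀^∞ ds / (s² + a²) = π / (2a)` for `Re a > 0`. -/
theorem integral_Ioi_inv_sq_add_sq {a : ℂ} (ha : 0 < a.re) :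
    ∫ s in Set.Ioi (0 : ℝ), ((s : ℂ) ^ 2 + a ^ 2)⁻¹ = Real.pi / (2 * a)
      ∧ IntegrableOn (fun s : ℝ => ((s : ℂ) ^ 2 + a ^ 2)⁻¹) (Set.Ioi 0) := by
  have ha0 : a ≠ 0 := fun h => by simp [h] at ha
  have him : (Complex.I * a).im = a.re := by simp
  have hm : ∀ s : ℝ, (s : ℂ) - Complex.I * a ∈ Complex.slitPlane := fun s =>
    Or.inr (by simp [ha.ne'])
  have hp : ∀ s : ℝ, (s : ℂ) + Complex.I * a ∈ Complex.slitPlane := fun s =>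
    Or.inr (by simp [ha.ne'])
  have hfac : ∀ s : ℝ, (s : ℂ) ^ 2 + a ^ 2 = (s - Complex.I * a) * (s + Complex.I * a) := fun s => by
    linear_combination (a ^ 2) * Complex.I_sq
  have hne : ∀ s : ℝ, (s : ℂ) ^ 2 + a ^ 2 ≠ 0 := fun s => by
    rw [hfac]
    exact mul_ne_zero (Complex.slitPlane_ne_zero (hm s)) (Complex.slitPlane_ne_zero (hp s))
  have hint : IntegrableOn (fun s : ℝ => ((s : ℂ) ^ 2 + a ^ 2)⁻¹) (Set.Ioi 0) := by
    refine integrableOn_Ioi_of_decay (C := 2) (R := 2 * ‖a‖ + 1)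
      (ContinuousOn.inv₀ (by fun_prop) fun s _ => hne s) (by positivity) fun s hs => ?_
    have hs0 : 0 < s := by linarith [norm_nonneg a]
    have h1 : ‖(s : ℂ) ^ 2‖ = s ^ 2 := by
      rw [norm_pow, Complex.norm_real, Real.norm_of_nonneg hs0.le]
    have h2 : s ^ 2 / 2 ≤ ‖(s : ℂ) ^ 2 + a ^ 2‖ := by
      have h3 := norm_sub_norm_le ((s : ℂ) ^ 2) (-(a ^ 2))
      rw [norm_neg, norm_pow a, h1, sub_neg_eq_add] at h3
      nlinarith [norm_nonneg a]
    rw [norm_inv, ← inv_div]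
    exact inv_anti₀ (by positivity) h2
  refine ⟨?_, hint⟩
  -- The primitive comes from partial fractions. Both logarithms are smooth for all real `s` because
  -- `s ∓ ia` has imaginary part `∓Re a ≠ 0`. At infinity the two `log s` cancel; at `s = 0` the
  -- difference of the logarithms is `-πi`.
  have hd : ∀ s : ℝ, HasDerivAt (fun s : ℝ => (2 * Complex.I * a)⁻¹ *
      (Complex.log (s - Complex.I * a) - Complex.log (s + Complex.I * a)))
      (((s : ℂ) ^ 2 + a ^ 2)⁻¹) s := fun s => by
    have h1 : HasDerivAt (fun s : ℝ => (s : ℂ)) 1 s := Complex.ofRealCLM.hasDerivAt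
    refine ((((h1.sub_const _).clog_real (hm s)).fun_sub
      ((h1.add_const _).clog_real (hp s))).const_mul _).congr_deriv ?_
    have e1 := Complex.slitPlane_ne_zero (hm s)
    have e2 := Complex.slitPlane_ne_zero (hp s)
    have e3 := Complex.I_ne_zero
    rw [hfac]
    field_simp
    ring
  have hlim : Tendsto (fun s : ℝ => (2 * Complex.I * a)⁻¹ *
      (Complex.log (s - Complex.I * a) - Complex.log (s + Complex.I * a))) atTop (𝓝 0) := by
    have hz : Tendsto (fun s : ℝ => Complex.I * a / (s : ℂ)) atTop (𝓝 0) := by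
      have : Tendsto (fun s : ℝ => ((s⁻¹ : ℝ) : ℂ)) atTop (𝓝 ((0 : ℝ) : ℂ)) :=
        (Complex.continuous_ofReal.tendsto 0).comp tendsto_inv_atTop_zero
      simpa [div_eq_mul_inv] using this.const_mul (Complex.I * a)
    have hl : Tendsto Complex.log (𝓝 1) (𝓝 0) := by
      have := (Complex.differentiableAt_log Complex.one_mem_slitPlane).continuousAt.tendsto
      rwa [Complex.log_one] at this
    have t1 : Tendsto (fun s : ℝ => Complex.log (1 - Complex.I * a / s)) atTop (𝓝 0) :=
      hl.comp (by simpa using hz.const_sub 1)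
    have t2 : Tendsto (fun s : ℝ => Complex.log (1 + Complex.I * a / s)) atTop (𝓝 0) :=
      hl.comp (by simpa using hz.const_add 1)
    have := (t1.sub t2).const_mul (2 * Complex.I * a)⁻¹
    rw [sub_zero, mul_zero] at this
    refine this.congr' ?_
    filter_upwards [eventually_gt_atTop 0] with s hs
    have hs' : (s : ℂ) ≠ 0 := Complex.ofReal_ne_zero.2 hs.ne'
    have e1 : (s : ℂ) - Complex.I * a = s * (1 - Complex.I * a / s) := by field_simp
    have e2 : (s : ℂ) + Complex.I * a = s * (1 + Complex.I * a / s) := by field_simp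
    have n1 := Complex.slitPlane_ne_zero (hm s)
    have n2 := Complex.slitPlane_ne_zero (hp s)
    rw [e1] at n1 ⊢
    rw [e2] at n2 ⊢
    rw [Complex.log_ofReal_mul hs (right_ne_zero_of_mul n1),
      Complex.log_ofReal_mul hs (right_ne_zero_of_mul n2)]
    ring
  rw [integral_Ioi_of_hasDerivAt_of_tendsto' (fun s _ => hd s) hint hlim]
  have hlog : Complex.log (-(Complex.I * a)) = Complex.log (Complex.I * a) - Real.pi * Complex.I := by
    rw [Complex.log, Complex.log, norm_neg,
      Complex.arg_neg_eq_arg_sub_pi_of_im_pos (by rw [him]; exact ha)]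
    push_cast
    ring
  simp only [Complex.ofReal_zero, zero_sub, zero_add]
  rw [hlog]
  have e3 := Complex.I_ne_zero
  field_simp
  ring

/-- The closed first quadrant. -/
def closedQuadrant : Set ℂ := {z | 0 ≤ z.re ∧ 0 ≤ z.im}

theorem norm_le_of_re {z : ℂ} {r : ℝ} (h : r ≤ z.re) : r ≤ ‖z‖ :=
  h.trans ((le_abs_self _).trans (Complex.abs_re_le_norm z))

theorem norm_le_of_im {z : ℂ} {r : ℝ} (h : r ≤ z.im) : r ≤ ‖z‖ :=
  h.trans ((le_abs_self _).trans (Complex.abs_im_le_norm z))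

theorem integrableOn_ray_of_decay {f : ℂ → ℂ} {s : Set ℂ} (hf : ContinuousOn f s) {c : ℂ}
    (hc : ‖c‖ = 1) (hcs : ∀ r : ℝ, 0 ≤ r → c * r ∈ s) {C R : ℝ} (hR : 0 < R)
    (hb : ∀ z ∈ s, R ≤ ‖z‖ → ‖f z‖ ≤ C / ‖z‖ ^ 2) :
    IntegrableOn (fun r : ℝ => f (c * r)) (Set.Ioi 0) := by
  refine integrableOn_Ioi_of_decay (C := C) (R := R)
    (hf.comp (by fun_prop) fun r hr => hcs r hr) hR fun r hr => ?_
  have hr0 : 0 ≤ r := hR.le.trans hr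
  have hn : ‖c * (r : ℂ)‖ = r := by
    rw [norm_mul, hc, one_mul, Complex.norm_real, Real.norm_of_nonneg hr0]
  have := hb (c * r) (hcs r hr0) (by rw [hn]; exact hr)
  rwa [hn] at this

/-- Cauchy's theorem on the squares `[0,r]²`: the two outer sides have length `r` and integrand
`O(1/r²)`, so only the two boundary rays survive as `r → ∞`. One exceptional point `a`, where `f` is
merely continuous, is allowed for the sake of divided differences. -/
theorem quadrant_integral_eq_zero {f : ℂ → ℂ} (hf : ContinuousOn f closedQuadrant) {a : ℂ}
    (hd : ∀ z : ℂ, 0 < z.re → 0 < z.im → z ≠ a → DifferentiableAt ℂ f z) {C R : ℝ} (hR : 0 < R)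
    (hb : ∀ z ∈ closedQuadrant, R ≤ ‖z‖ → ‖f z‖ ≤ C / ‖z‖ ^ 2) :
    (∫ s in Set.Ioi (0 : ℝ), f s) - Complex.I * ∫ s in Set.Ioi (0 : ℝ), f (Complex.I * s) = 0 := by
  have i0 := integrableOn_ray_of_decay hf (c := 1) (by simp)
    (fun r hr => by simpa [closedQuadrant] using hr) hR hb
  have i1 := integrableOn_ray_of_decay hf (c := Complex.I) (by simp)
    (fun r hr => by simpa [closedQuadrant] using hr) hR hb
  simp only [one_mul] at i0
  have l0 := intervalIntegral_tendsto_integral_Ioi 0 i0 tendsto_id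
  have l1 := intervalIntegral_tendsto_integral_Ioi 0 i1 tendsto_id
  have hC : ∀ r, R ≤ r → 0 ≤ C / r ^ 2 := fun r hr => by
    have hr0 : 0 ≤ r := hR.le.trans hr
    have h := hb (r : ℂ) (by simpa [closedQuadrant] using hr0)
      (by rwa [Complex.norm_real, Real.norm_of_nonneg hr0])
    rw [Complex.norm_real, Real.norm_of_nonneg hr0] at h
    exact (norm_nonneg _).trans h
  have hb' : ∀ r, R ≤ r → ∀ z ∈ closedQuadrant, r ≤ ‖z‖ → ‖f z‖ ≤ C / r ^ 2 := by
    intro r hr z hz hrz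
    have hr0 : 0 < r := hR.trans_le hr
    have hC0 : 0 ≤ C := by
      have := hC r hr
      by_contra hneg
      have : C / r ^ 2 < 0 := div_neg_of_neg_of_pos (not_le.1 hneg) (by positivity)
      linarith
    exact (hb z hz (hr.trans hrz)).trans (by gcongr)
  have lim0 : Tendsto (fun r : ℝ => C / r ^ 2 * |r - 0|) atTop (𝓝 0) := by
    have : Tendsto (fun r : ℝ => C / r) atTop (𝓝 0) := tendsto_const_nhds.div_atTop tendsto_id
    refine this.congr' ?_
    filter_upwards [eventually_gt_atTop 0] with r hr
    rw [sub_zero, abs_of_pos hr]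
    field_simp
  have lr : Tendsto (fun r : ℝ => ∫ y in (0 : ℝ)..r, f (r + y * Complex.I)) atTop (𝓝 0) := by
    refine squeeze_zero_norm' ?_ lim0
    filter_upwards [eventually_ge_atTop R] with r hr
    refine intervalIntegral.norm_integral_le_of_norm_le_const fun y hy => ?_
    have hr0 : 0 ≤ r := hR.le.trans hr
    rw [Set.uIoc_of_le hr0] at hy
    refine hb' r hr _ ⟨by simpa using hr0, by simpa using hy.1.le⟩ (norm_le_of_re (by simp))
  have lt : Tendsto (fun r : ℝ => ∫ x in (0 : ℝ)..r, f (x + r * Complex.I)) atTop (𝓝 0) := by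
    refine squeeze_zero_norm' ?_ lim0
    filter_upwards [eventually_ge_atTop R] with r hr
    refine intervalIntegral.norm_integral_le_of_norm_le_const fun y hy => ?_
    have hr0 : 0 ≤ r := hR.le.trans hr
    rw [Set.uIoc_of_le hr0] at hy
    refine hb' r hr _ ⟨by simpa using hy.1.le, by simpa using hr0⟩ (norm_le_of_im (by simp))
  have key : ∀ r : ℝ, 0 ≤ r → (∫ s in (0 : ℝ)..r, f s)
      - (∫ x in (0 : ℝ)..r, f (x + r * Complex.I))
      + Complex.I * (∫ y in (0 : ℝ)..r, f (r + y * Complex.I))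
      - Complex.I * (∫ s in (0 : ℝ)..r, f (Complex.I * s)) = 0 := by
    intro r hr
    have := Complex.integral_boundary_rect_eq_zero_of_differentiable_on_off_countable f 0
      (r + r * Complex.I) {a} (Set.countable_singleton a) ?_ ?_
    · simpa [mul_comm] using this
    · refine hf.mono fun z hz => ?_
      rw [Complex.mem_reProdIm] at hz
      simp [Set.uIcc_of_le hr] at hz
      exact ⟨hz.1.1, hz.2.1⟩
    · rintro z ⟨hz, hza⟩
      rw [Complex.mem_reProdIm] at hz
      simp [hr] at hz
      exact hd z hz.1.1 hz.2.1 hza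
  have hlim := ((l0.sub lt).add (lr.const_mul Complex.I)).sub (l1.const_mul Complex.I)
  have h0 : Tendsto (fun _ : ℝ => (0 : ℂ)) atTop (𝓝 0) := tendsto_const_nhds
  have := tendsto_nhds_unique (hlim.congr' (by
    filter_upwards [eventually_ge_atTop 0] with r hr
    exact key r hr)) h0
  simpa using this

theorem inv_norm_sub_le {z k : ℂ} (h : 2 * ‖k‖ ≤ ‖z‖) (hz : 0 < ‖z‖) : ‖z - k‖⁻¹ ≤ 2 / ‖z‖ := by
  have : ‖z‖ / 2 ≤ ‖z - k‖ := by linarith [norm_sub_norm_le z k]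
  rw [← inv_div]
  exact inv_anti₀ (by positivity) this

theorem div_sub_decay {g : ℂ → ℂ} {s : Set ℂ} {C R : ℝ} (hR : 0 < R)
    (hb : ∀ z ∈ s, R ≤ ‖z‖ → ‖g z‖ ≤ C / ‖z‖) (k : ℂ) :
    ∀ z ∈ s, max R (2 * ‖k‖) ≤ ‖z‖ → ‖g z / (z - k)‖ ≤ 2 * C / ‖z‖ ^ 2 := by
  intro z hz hzn
  have hz0 : 0 < ‖z‖ := hR.trans_le ((le_max_left _ _).trans hzn)
  have h1 := hb z hz ((le_max_left _ _).trans hzn)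
  have h2 := inv_norm_sub_le ((le_max_right _ _).trans hzn) hz0
  rw [div_eq_mul_inv, norm_mul, norm_inv]
  calc _ ≤ C / ‖z‖ * (2 / ‖z‖) := mul_le_mul h1 h2 (by positivity) ((norm_nonneg _).trans h1)
    _ = _ := by field_simp

theorem quadrant_cauchy_outside {g : ℂ → ℂ} (hg : ContinuousOn g closedQuadrant)
    (hd : ∀ z : ℂ, 0 < z.re → 0 < z.im → DifferentiableAt ℂ g z) {C R : ℝ} (hR : 0 < R)
    (hb : ∀ z ∈ closedQuadrant, R ≤ ‖z‖ → ‖g z‖ ≤ C / ‖z‖) {k : ℂ} (hk : k ∉ closedQuadrant) :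
    (∫ s in Set.Ioi (0 : ℝ), g s / (s - k))
      - Complex.I * ∫ s in Set.Ioi (0 : ℝ), g (Complex.I * s) / (Complex.I * s - k) = 0 := by
  have hne : ∀ z ∈ closedQuadrant, z - k ≠ 0 := fun z hz h => hk (sub_eq_zero.1 h ▸ hz)
  -- No exceptional point is needed here; `0` is a dummy, not lying in the open quadrant.
  refine quadrant_integral_eq_zero (f := fun z => g z / (z - k)) (a := 0)
    (hg.div (by fun_prop) hne) (fun z h1 h2 _ => ?_) (lt_max_of_lt_left hR)
    (div_sub_decay hR hb k)
  exact (hd z h1 h2).div (by fun_prop) (hne z ⟨h1.le, h2.le⟩)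

/-- Subtract from `g` the multiple `g(k) · 2k/(z+k)`, which takes the value `g(k)` at `k`, is
`O(1/z)`, and has its pole `-k` outside the closed quadrant. The difference vanishes at `k`, so its
divided difference has zero boundary integral. What was subtracted leaves `2k/(z² - k²)`, whose
integrals along the two rays are explicit. -/
theorem quadrant_cauchy_inside {g : ℂ → ℂ} (hg : ContinuousOn g closedQuadrant)
    (hd : ∀ z : ℂ, 0 < z.re → 0 < z.im → DifferentiableAt ℂ g z) {C R : ℝ} (hR : 0 < R)
    (hb : ∀ z ∈ closedQuadrant, R ≤ ‖z‖ → ‖g z‖ ≤ C / ‖z‖) {k : ℂ} (hk : 0 < k.re ∧ 0 < k.im) :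
    (∫ s in Set.Ioi (0 : ℝ), g s / (s - k))
      - Complex.I * ∫ s in Set.Ioi (0 : ℝ), g (Complex.I * s) / (Complex.I * s - k)
        = 2 * Real.pi * Complex.I * g k := by
  have hk0 : k ≠ 0 := fun h => by simp [h] at hk
  have hkn : 0 < ‖k‖ := norm_pos_iff.2 hk0
  have hkQ : closedQuadrant ∈ 𝓝 k := by
    have : {z : ℂ | 0 < z.re ∧ 0 < z.im} ∈ 𝓝 k :=
      ((isOpen_lt continuous_const Complex.continuous_re).inter
        (isOpen_lt continuous_const Complex.continuous_im)).mem_nhds hk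
    exact mem_of_superset this fun z hz => ⟨hz.1.le, hz.2.le⟩
  have hpk : ∀ z ∈ closedQuadrant, z + k ≠ 0 := fun z hz h => by
    have := congrArg Complex.re h
    simp at this
    linarith [hz.1, hk.1]
  set φ : ℂ → ℂ := fun z => g z - g k * (2 * k / (z + k)) with hφ
  have hφk : φ k = 0 := by
    simp only [hφ]
    rw [← two_mul, div_self (by simp [hk0])]
    ring
  have hφc : ContinuousOn φ closedQuadrant :=
    hg.sub (continuousOn_const.mul (continuousOn_const.div (by fun_prop) hpk))
  have hφd : ∀ z : ℂ, 0 < z.re → 0 < z.im → DifferentiableAt ℂ φ z := fun z h1 h2 =>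
    (hd z h1 h2).sub ((differentiableAt_const _).mul
      ((differentiableAt_const _).div (by fun_prop) (hpk z ⟨h1.le, h2.le⟩)))
  have hφb : ∀ z ∈ closedQuadrant, max R (2 * ‖k‖) ≤ ‖z‖ →
      ‖φ z‖ ≤ (C + ‖g k‖ * (2 * ‖k‖ * 2)) / ‖z‖ := by
    intro z hz hzn
    have hz0 : 0 < ‖z‖ := hR.trans_le ((le_max_left _ _).trans hzn)
    have h1 := hb z hz ((le_max_left _ _).trans hzn)
    have h2 := inv_norm_sub_le (k := -k) (by rw [norm_neg]; exact (le_max_right _ _).trans hzn) hz0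
    rw [sub_neg_eq_add] at h2
    refine (norm_sub_le _ _).trans ?_
    rw [add_div, norm_mul, div_eq_mul_inv (2 * k), norm_mul, norm_mul, norm_inv,
      Complex.norm_ofNat, mul_div_assoc, mul_div_assoc]
    gcongr
  have hds : ∀ z, z ≠ k → dslope φ k z = φ z / (z - k) := fun z hz => by
    rw [dslope_of_ne _ hz, slope_def_field, hφk, sub_zero]
  have key := quadrant_integral_eq_zero (f := dslope φ k) (a := k)
    ((continuousOn_dslope hkQ).2 ⟨hφc, hφd k hk.1 hk.2⟩)
    (fun z h1 h2 hz => (differentiableAt_dslope_of_ne hz).2 (hφd z h1 h2))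
    (R := max (max R (2 * ‖k‖)) (2 * ‖k‖)) (lt_max_of_lt_left (lt_max_of_lt_left hR))
    (fun z hz hzn => by
      rw [hds z (fun h => by
        rw [h] at hzn
        linarith [(le_max_right _ _).trans hzn])]
      exact div_sub_decay (lt_max_of_lt_left hR) hφb k z hz hzn)
  have hsub : ∀ s : ℝ, (s : ℂ) ≠ k := fun s h => by
    have := congrArg Complex.im h
    simp at this
    linarith [hk.2]
  have hsubI : ∀ s : ℝ, Complex.I * (s : ℂ) ≠ k := fun s h => by
    have := congrArg Complex.re h
    simp at this
    linarith [hk.1]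
  -- On the real ray `z² - k² = s² + (-ik)²`, on the imaginary ray `z² - k² = -(s² + k²)`; both
  -- `-ik` and `k` have positive real part because `k` is in the first quadrant. The two
  -- contributions `πi g(k)` add up to `2πi g(k)`.
  obtain ⟨v0, j0⟩ := integral_Ioi_inv_sq_add_sq (a := -Complex.I * k) (by simpa using hk.2)
  obtain ⟨v1, j1⟩ := integral_Ioi_inv_sq_add_sq (a := k) hk.1
  have hdc : ContinuousOn (fun z => g z / (z - k)) (closedQuadrant \ {k}) :=
    (hg.mono Set.sdiff_subset).div (by fun_prop) fun z hz => sub_ne_zero.2 hz.2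
  have hdb := fun z (hz : z ∈ closedQuadrant \ {k}) => div_sub_decay hR hb k z hz.1
  have i0 := integrableOn_ray_of_decay hdc (c := 1) (by simp)
    (fun r hr => ⟨by simpa [closedQuadrant] using hr, by simpa using hsub r⟩)
    (lt_max_of_lt_left hR) hdb
  have i1 := integrableOn_ray_of_decay hdc (c := Complex.I) (by simp)
    (fun r hr => ⟨by simpa [closedQuadrant] using hr, by simpa using hsubI r⟩)
    (lt_max_of_lt_left hR) hdb
  simp only [one_mul] at i0
  have e0 : ∀ s ∈ Set.Ioi (0 : ℝ), dslope φ k s = g s / (s - k)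
      - 2 * k * g k * ((s : ℂ) ^ 2 + (-Complex.I * k) ^ 2)⁻¹ := fun s hs => by
    have h1 := sub_ne_zero.2 (hsub s)
    have h2 := hpk s (by simpa [closedQuadrant] using le_of_lt hs)
    have h3 : (s : ℂ) ^ 2 + (-Complex.I * k) ^ 2 = (s - k) * (s + k) := by
      linear_combination (k ^ 2) * Complex.I_sq
    rw [hds _ (hsub s), h3]
    simp only [hφ]
    field_simp
  have e1 : ∀ s ∈ Set.Ioi (0 : ℝ), dslope φ k (Complex.I * s) = g (Complex.I * s)
      / (Complex.I * s - k) + 2 * k * g k * ((s : ℂ) ^ 2 + k ^ 2)⁻¹ := fun s hs => by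
    have h1 := sub_ne_zero.2 (hsubI s)
    have h2 := hpk (Complex.I * s) (by simpa [closedQuadrant] using le_of_lt hs)
    have h3 : (s : ℂ) ^ 2 + k ^ 2 = -((Complex.I * s - k) * (Complex.I * s + k)) := by
      linear_combination ((s : ℂ) ^ 2) * Complex.I_sq
    rw [hds _ (hsubI s), h3]
    simp only [hφ]
    field_simp
    ring
  rw [setIntegral_congr_fun measurableSet_Ioi e0, setIntegral_congr_fun measurableSet_Ioi e1,
    integral_sub i0 (j0.const_mul _), integral_add i1 (j1.const_mul _), integral_const_mul,
    integral_const_mul, v0, v1] at key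
  have hI := Complex.I_ne_zero
  have hw : 2 * k * g k * (Real.pi / (2 * (-Complex.I * k))) = Real.pi * Complex.I * g k := by
    field_simp
    rw [Complex.I_sq]
    ring
  have hw1 : 2 * k * g k * (Real.pi / (2 * k)) = Real.pi * g k := by field_simp
  rw [hw, hw1] at key
  linear_combination key

end DNLS

namespace DNLS

/-! ### Cauchy integrals over the contour `Σ` -/

theorem rotated_mem {c z : ℂ} (hc : ‖c‖ = 1) : ‖c * z‖ = ‖z‖ := by rw [norm_mul, hc, one_mul]

/-- Cauchy's formula on the quadrant `c * Q`, where `Q` is the first quadrant. -/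
theorem rotated_quadrant_cauchy {g : ℂ → ℂ} {c : ℂ} (hc : ‖c‖ = 1) {S D : Set ℂ}
    (hS : ∀ z ∈ closedQuadrant, c * z ∈ S) (hD : ∀ z : ℂ, 0 < z.re → 0 < z.im → c * z ∈ D)
    (hDo : IsOpen D)
    (hg : ContinuousOn g S) (hd : DifferentiableOn ℂ g D) {C R : ℝ} (hR : 0 < R)
    (hb : ∀ z ∈ S, R ≤ ‖z‖ → ‖g z‖ ≤ C / ‖z‖) {k : ℂ} :
    (c⁻¹ * k ∉ closedQuadrant →
      c * (∫ s in Set.Ioi (0 : ℝ), g (c * s) / (c * s - k))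
      - c * Complex.I * ∫ s in Set.Ioi (0 : ℝ), g (c * Complex.I * s) / (c * Complex.I * s - k) = 0)
    ∧ (0 < (c⁻¹ * k).re → 0 < (c⁻¹ * k).im →
      c * (∫ s in Set.Ioi (0 : ℝ), g (c * s) / (c * s - k))
      - c * Complex.I * ∫ s in Set.Ioi (0 : ℝ), g (c * Complex.I * s) / (c * Complex.I * s - k)
        = 2 * Real.pi * Complex.I * g k) := by
  have hc0 : c ≠ 0 := norm_pos_iff.1 (by rw [hc]; exact one_pos)
  have hcont : ContinuousOn (fun z => g (c * z)) closedQuadrant :=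
    hg.comp (by fun_prop) fun z hz => hS z hz
  have hdiff : ∀ z : ℂ, 0 < z.re → 0 < z.im → DifferentiableAt ℂ (fun z => g (c * z)) z :=
    fun z h1 h2 => ((hd.differentiableAt (hDo.mem_nhds (hD z h1 h2)))).comp
      (f := fun z => c * z) z (by fun_prop)
  have hbd : ∀ z ∈ closedQuadrant, R ≤ ‖z‖ → ‖g (c * z)‖ ≤ C / ‖z‖ := fun z hz hzn => by
    have := hb (c * z) (hS z hz) (by rwa [rotated_mem hc])
    rwa [rotated_mem hc] at this
  have e : ∀ w z : ℂ, c * (w / (c * z - k)) = w / (z - c⁻¹ * k) := fun w z => by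
    have : c * z - k = c * (z - c⁻¹ * k) := by
      rw [mul_sub, mul_inv_cancel_left₀ hc0]
    rw [this, mul_div_assoc', mul_div_mul_left _ _ hc0]
  have e1 : c * (∫ s in Set.Ioi (0 : ℝ), g (c * s) / (c * s - k))
      = ∫ s in Set.Ioi (0 : ℝ), g (c * s) / (s - c⁻¹ * k) := by
    rw [← integral_const_mul]
    exact integral_congr_ae (Eventually.of_forall fun s => e _ _)
  have e2 : c * Complex.I *
        (∫ s in Set.Ioi (0 : ℝ), g (c * Complex.I * s) / (c * Complex.I * s - k))
      = Complex.I * ∫ s in Set.Ioi (0 : ℝ), g (c * (Complex.I * s)) / (Complex.I * s - c⁻¹ * k) := by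
    rw [mul_assoc c Complex.I, mul_left_comm, ← integral_const_mul c]
    refine congrArg _ (integral_congr_ae (Eventually.of_forall fun s => ?_))
    have := e (g (c * (Complex.I * s))) (Complex.I * s)
    simp only [mul_assoc] at this ⊢
    exact this
  rw [e1, e2]
  refine ⟨fun hk => quadrant_cauchy_outside (g := fun z => g (c * z)) hcont hdiff hR hbd hk,
    fun h1 h2 => ?_⟩
  have := quadrant_cauchy_inside (g := fun z => g (c * z)) hcont hdiff hR hbd ⟨h1, h2⟩
  rwa [mul_inv_cancel_left₀ hc0] at this

/-- Closure of `D⁺`. -/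
def DplusC : Set ℂ := {k | 0 ≤ k.re * k.im}

/-- Closure of `D⁻`. -/
def DminusC : Set ℂ := {k | k.re * k.im ≤ 0}

/-- Functions holomorphic on `D`, continuous on `S` and `O(1/k)`. -/
structure DecayingHol (S D : Set ℂ) (g : ℂ → ℂ) : Prop where
  cont : ContinuousOn g S
  diff : DifferentiableOn ℂ g D
  decay : ∃ C R : ℝ, 0 < R ∧ ∀ z ∈ S, R ≤ ‖z‖ → ‖g z‖ ≤ C / ‖z‖

theorem mem_DplusC_of_Sig {z : ℂ} (hz : z ∈ Sig) : z ∈ DplusC := ge_of_eq hz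

theorem mem_DminusC_of_Sig {z : ℂ} (hz : z ∈ Sig) : z ∈ DminusC := le_of_eq hz

theorem ray_mem_Sig (r : ℝ) : (1 : ℂ) * r ∈ Sig ∧ Complex.I * r ∈ Sig ∧ (-1 : ℂ) * r ∈ Sig ∧
    (-Complex.I) * r ∈ Sig := by
  simp [Sig]

theorem sigIntegrable_iff (f : ℂ → ℂ) : SigIntegrable f ↔
    IntegrableOn (fun s : ℝ => f (1 * s)) (Set.Ioi 0) ∧
    IntegrableOn (fun s : ℝ => f (-1 * s)) (Set.Ioi 0) ∧
    IntegrableOn (fun s : ℝ => f (Complex.I * s)) (Set.Ioi 0) ∧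
    IntegrableOn (fun s : ℝ => f (-Complex.I * s)) (Set.Ioi 0) := by
  simp only [SigIntegrable, one_mul, neg_mul]

theorem sigIntegral_eq (f : ℂ → ℂ) : sigIntegral f =
    (∫ s in Set.Ioi (0 : ℝ), f (1 * s)) - (∫ s in Set.Ioi (0 : ℝ), f (-1 * s))
    - Complex.I * (∫ s in Set.Ioi (0 : ℝ), f (Complex.I * s))
    + Complex.I * (∫ s in Set.Ioi (0 : ℝ), f (-Complex.I * s)) := by
  simp only [sigIntegral, one_mul, neg_mul]

theorem sigIntegral_congr {f g : ℂ → ℂ} (h : ∀ z ∈ Sig, f z = g z) :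
    sigIntegral f = sigIntegral g := by
  rw [sigIntegral_eq, sigIntegral_eq]
  simp only [fun s : ℝ => h _ (ray_mem_Sig s).1, fun s : ℝ => h _ (ray_mem_Sig s).2.1,
    fun s : ℝ => h _ (ray_mem_Sig s).2.2.1, fun s : ℝ => h _ (ray_mem_Sig s).2.2.2]

theorem sigIntegrable_congr {f g : ℂ → ℂ} (h : ∀ z ∈ Sig, f z = g z) (hf : SigIntegrable f) :
    SigIntegrable g := by
  rw [sigIntegrable_iff] at hf ⊢
  simpa only [fun s : ℝ => h _ (ray_mem_Sig s).1, fun s : ℝ => h _ (ray_mem_Sig s).2.1,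
    fun s : ℝ => h _ (ray_mem_Sig s).2.2.1, fun s : ℝ => h _ (ray_mem_Sig s).2.2.2] using hf

theorem sigIntegrable_of_decay {f : ℂ → ℂ} (hf : ContinuousOn f Sig) {C R : ℝ} (hR : 0 < R)
    (hb : ∀ z ∈ Sig, R ≤ ‖z‖ → ‖f z‖ ≤ C / ‖z‖ ^ 2) : SigIntegrable f := by
  rw [sigIntegrable_iff]
  exact ⟨integrableOn_ray_of_decay hf (by simp) (fun r _ => (ray_mem_Sig r).1) hR hb,
    integrableOn_ray_of_decay hf (by simp) (fun r _ => (ray_mem_Sig r).2.2.1) hR hb,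
    integrableOn_ray_of_decay hf (by simp) (fun r _ => (ray_mem_Sig r).2.1) hR hb,
    integrableOn_ray_of_decay hf (by simp) (fun r _ => (ray_mem_Sig r).2.2.2) hR hb⟩

/-- Continuous functions on `Σ` that are `O(1/k)`. -/
structure DecayingOnSig (f : ℂ → ℂ) : Prop where
  cont : ContinuousOn f Sig
  decay : ∃ C R : ℝ, 0 < R ∧ ∀ z ∈ Sig, R ≤ ‖z‖ → ‖f z‖ ≤ C / ‖z‖

theorem DecayingHol.onSig {S D : Set ℂ} {g : ℂ → ℂ} (h : DecayingHol S D g) (hS : Sig ⊆ S) :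
    DecayingOnSig g :=
  ⟨h.cont.mono hS, let ⟨C, R, hR, hb⟩ := h.decay; ⟨C, R, hR, fun z hz => hb z (hS hz)⟩⟩

theorem DecayingOnSig.sub {f g : ℂ → ℂ} (hf : DecayingOnSig f) (hg : DecayingOnSig g) :
    DecayingOnSig fun z => f z - g z := by
  obtain ⟨C, R, hR, hb⟩ := hf.decay
  obtain ⟨C', R', hR', hb'⟩ := hg.decay
  refine ⟨hf.cont.sub hg.cont, C + C', max R R', lt_max_of_lt_left hR, fun z hz hzn => ?_⟩
  rw [add_div]
  exact (norm_sub_le _ _).trans (add_le_add (hb z hz ((le_max_left _ _).trans hzn))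
    (hb' z hz ((le_max_right _ _).trans hzn)))

theorem DecayingOnSig.sigIntegrable {f : ℂ → ℂ} (hf : DecayingOnSig f) {k : ℂ} (hk : k ∉ Sig) :
    SigIntegrable fun z => f z / (z - k) := by
  obtain ⟨C, R, hR, hb⟩ := hf.decay
  exact sigIntegrable_of_decay (hf.cont.div (by fun_prop) fun z hz h => hk (sub_eq_zero.1 h ▸ hz))
    (lt_max_of_lt_left hR) (div_sub_decay hR hb k)

/-- Division by `z - k` stays within the class, so statements about the kernel `(z - k)⁻²` reduce to
those about `(z - k)⁻¹`. -/
theorem DecayingOnSig.div_sub {f : ℂ → ℂ} (hf : DecayingOnSig f) {k : ℂ} (hk : k ∉ Sig) :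
    DecayingOnSig fun z => f z / (z - k) := by
  obtain ⟨C, R, hR, hb⟩ := hf.decay
  refine ⟨hf.cont.div (by fun_prop) fun z hz h => hk (sub_eq_zero.1 h ▸ hz),
    2 * C, max (max R (2 * ‖k‖)) 1, by positivity, fun z hz hzn => ?_⟩
  have h1 : 1 ≤ ‖z‖ := (le_max_right _ _).trans hzn
  have h := div_sub_decay hR hb k z hz ((le_max_left _ _).trans hzn)
  refine h.trans ?_
  have h0 : 0 ≤ 2 * C / ‖z‖ ^ 2 := (norm_nonneg _).trans h
  have : 2 * C / ‖z‖ = 2 * C / ‖z‖ ^ 2 * ‖z‖ := by field_simp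
  rw [this]
  exact le_mul_of_one_le_right h0 h1

theorem DecayingOnSig.sigIntegrable_sq {f : ℂ → ℂ} (hf : DecayingOnSig f) {k : ℂ} (hk : k ∉ Sig) :
    SigIntegrable fun z => f z / (z - k) ^ 2 := by
  refine sigIntegrable_congr (fun z _ => ?_) ((hf.div_sub hk).sigIntegrable hk)
  rw [div_div, pow_two]

theorem isClosed_Sig : IsClosed Sig :=
  isClosed_eq (Complex.continuous_re.mul Complex.continuous_im) continuous_const

/-- If the disc of radius `r` about `k` misses `Σ`, then moving `k` by less than `r/2` at most
halves its distance to any point of the ray. Twice the original integrand is therefore a majorant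
for all nearby parameters. -/
theorem hasDerivAt_ray_integral {f : ℂ → ℂ} {c : ℂ} (hc : ∀ r : ℝ, c * r ∈ Sig) {k : ℂ}
    (hk : k ∉ Sig) (hi : IntegrableOn (fun s : ℝ => f (c * s) / (c * s - k)) (Set.Ioi 0)) :
    HasDerivAt (fun k => ∫ s in Set.Ioi (0 : ℝ), f (c * s) / (c * s - k))
      (∫ s in Set.Ioi (0 : ℝ), f (c * s) / (c * s - k) ^ 2) k := by
  obtain ⟨r, hr, hball⟩ := Metric.isOpen_iff.1 isClosed_Sig.isOpen_compl k hk
  have hdist : ∀ s : ℝ, r ≤ ‖c * s - k‖ := fun s => by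
    by_contra h
    exact hball (show c * s ∈ Metric.ball k r by rw [mem_ball_iff_norm]; exact not_le.1 h) (hc s)
  have hlow : ∀ s : ℝ, ∀ k' ∈ Metric.ball k (r / 2), ‖c * s - k‖ / 2 ≤ ‖c * s - k'‖ := by
    intro s k' hk'
    rw [mem_ball_iff_norm] at hk'
    have h1 : c * s - k = (c * s - k') + (k' - k) := by ring
    have h2 : ‖c * s - k‖ ≤ ‖c * s - k'‖ + ‖k' - k‖ := by rw [h1]; exact norm_add_le _ _
    linarith [hdist s]
  have hne : ∀ s : ℝ, ∀ k' ∈ Metric.ball k (r / 2), c * s - k' ≠ 0 := fun s k' hk' h => by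
    have := hlow s k' hk'
    rw [h, norm_zero] at this
    linarith [hdist s]
  have hk0 : k ∈ Metric.ball k (r / 2) := Metric.mem_ball_self (by positivity)
  have key := hasDerivAt_integral_of_holomorphic (μ := volume.restrict (Set.Ioi (0 : ℝ)))
    (f := fun k' (s : ℝ) => f (c * s) / (c * s - k')) (U := Metric.ball k (r / 2))
    (bound := fun s : ℝ => 2 * ‖f (c * s) / (c * s - k)‖) Metric.isOpen_ball ?_ ?_
    (hi.norm.const_mul 2) ?_ hk0
  · refine key.congr_deriv (integral_congr_ae (Eventually.of_forall fun s => ?_))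
    have h := ((hasDerivAt_id k).const_sub (c * (s : ℂ))).inv (hne s k hk0)
    have h2 : HasDerivAt (fun k' => f (c * s) / (c * s - k')) (f (c * s) / (c * s - k) ^ 2) k := by
      have := h.const_mul (f (c * s))
      simpa [div_eq_mul_inv] using this
    exact h2.deriv
  · intro k' hk'
    have : (fun s : ℝ => f (c * s) / (c * s - k')) = fun s : ℝ =>
        (f (c * s) / (c * s - k)) * ((c * s - k) / (c * s - k')) := by
      funext s
      have h1 := hne s k' hk'
      have h2 := hne s k hk0
      field_simp
    rw [this]
    refine hi.aestronglyMeasurable.mul (Continuous.aestronglyMeasurable ?_)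
    exact Continuous.div (by fun_prop) (by fun_prop) fun s => hne s k' hk'
  · refine Eventually.of_forall fun s k' hk' => ?_
    have h1 : 0 < ‖c * s - k‖ := hr.trans_le (hdist s)
    rw [norm_div, norm_div]
    calc ‖f (c * s)‖ / ‖c * s - k'‖ ≤ ‖f (c * s)‖ / (‖c * s - k‖ / 2) := by
          gcongr
          exact hlow s k' hk'
      _ = _ := by field_simp
  · refine Eventually.of_forall fun s k' hk' => ?_
    exact (DifferentiableAt.div (by fun_prop) (by fun_prop) (hne s k' hk')).differentiableWithinAt

theorem hasDerivAt_sigIntegral {f : ℂ → ℂ} (hf : DecayingOnSig f) {k : ℂ} (hk : k ∉ Sig) :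
    HasDerivAt (fun k => sigIntegral fun z => f z / (z - k))
      (sigIntegral fun z => f z / (z - k) ^ 2) k := by
  have hi := (sigIntegrable_iff _).1 (hf.sigIntegrable hk)
  simp only [sigIntegral_eq]
  exact (((hasDerivAt_ray_integral (fun r => (ray_mem_Sig r).1) hk hi.1).sub
    (hasDerivAt_ray_integral (fun r => (ray_mem_Sig r).2.2.1) hk hi.2.1)).sub
    ((hasDerivAt_ray_integral (fun r => (ray_mem_Sig r).2.1) hk hi.2.2.1).const_mul _)).add
    ((hasDerivAt_ray_integral (fun r => (ray_mem_Sig r).2.2.2) hk hi.2.2.2).const_mul _)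

/-- The solution of the additive jump problem on `Σ` by a Cauchy integral. -/
theorem sigIntegral_jump {gp gm : ℂ → ℂ} (hp : DecayingHol DplusC Dplus gp)
    (hm : DecayingHol DminusC Dminus gm) {k : ℂ} (hk : k ∉ Sig) :
    sigIntegral (fun z => (gp z - gm z) / (z - k)) =
      2 * Real.pi * Complex.I * (if 0 < k.re * k.im then gp k else gm k) := by
  have ip := (sigIntegrable_iff _).1 ((hp.onSig fun z => mem_DplusC_of_Sig).sigIntegrable hk)
  have im := (sigIntegrable_iff _).1 ((hm.onSig fun z => mem_DminusC_of_Sig).sigIntegrable hk)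
  obtain ⟨Cp, Rp, hRp, hbp⟩ := hp.decay
  obtain ⟨Cm, Rm, hRm, hbm⟩ := hm.decay
  -- The function `gp` is used in the first and third quadrants, `gm` in the second and fourth.
  -- Every ray of `Σ` borders one quadrant of each kind with opposite orientations, so the four
  -- boundary integrals add up to the `Σ`-integral of `gp - gm`, and only the quadrant containing
  -- `k` contributes `2πi`.
  have q0 := rotated_quadrant_cauchy (c := 1) (k := k) (by simp)
    (fun z hz => by simpa [DplusC] using mul_nonneg hz.1 hz.2)
    (fun z h1 h2 => by simpa [Dplus] using mul_pos h1 h2) isOpen_Dplus hp.cont hp.diff hRp hbp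
  have q1 := rotated_quadrant_cauchy (c := Complex.I) (k := k) (by simp)
    (fun z hz => by simpa [DminusC] using mul_nonneg hz.2 hz.1)
    (fun z h1 h2 => by simpa [Dminus] using mul_pos h2 h1) isOpen_Dminus hm.cont hm.diff hRm hbm
  have q2 := rotated_quadrant_cauchy (c := -1) (k := k) (by simp)
    (fun z hz => by simpa [DplusC] using mul_nonneg hz.1 hz.2)
    (fun z h1 h2 => by simpa [Dplus] using mul_pos h1 h2) isOpen_Dplus hp.cont hp.diff hRp hbp
  have q3 := rotated_quadrant_cauchy (c := -Complex.I) (k := k) (by simp)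
    (fun z hz => by simpa [DminusC] using mul_nonneg hz.2 hz.1)
    (fun z h1 h2 => by simpa [Dminus] using mul_pos h2 h1) isOpen_Dminus hm.cont hm.diff hRm hbm
  have c0 : (1 : ℂ) * Complex.I = Complex.I := one_mul _
  have c1 : Complex.I * Complex.I = -1 := Complex.I_mul_I
  have c2 : (-1 : ℂ) * Complex.I = -Complex.I := neg_one_mul _
  have c3 : -Complex.I * Complex.I = 1 := by simp
  rw [c0] at q0
  rw [c1] at q1
  rw [c2] at q2
  rw [c3] at q3
  simp only [inv_one, Complex.inv_I, inv_neg, neg_neg, one_mul, closedQuadrant, Set.mem_ofPred_eq,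
    neg_mul, Complex.neg_re, Complex.neg_im, Complex.I_mul_re, Complex.I_mul_im] at q0 q1 q2 q3
  have split : sigIntegral (fun z => (gp z - gm z) / (z - k)) =
      sigIntegral (fun z => gp z / (z - k)) - sigIntegral (fun z => gm z / (z - k)) := by
    simp only [sigIntegral_eq, sub_div]
    rw [integral_sub ip.1 im.1, integral_sub ip.2.1 im.2.1, integral_sub ip.2.2.1 im.2.2.1,
      integral_sub ip.2.2.2 im.2.2.2]
    ring
  rw [split, sigIntegral, sigIntegral]
  have hk' : k.re * k.im ≠ 0 := hk
  have hre : k.re ≠ 0 := left_ne_zero_of_mul hk'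
  have him : k.im ≠ 0 := right_ne_zero_of_mul hk'
  rcases lt_or_gt_of_ne hre with h1 | h1 <;> rcases lt_or_gt_of_ne him with h2 | h2
  · have a0 := q0.1 (by intro h; linarith [h.1])
    have a1 := q1.1 (by intro h; linarith [h.1, h.2])
    have a2 := q2.2 (by linarith) (by linarith)
    have a3 := q3.1 (by intro h; linarith [h.1, h.2])
    rw [if_pos (mul_pos_of_neg_of_neg h1 h2)]
    linear_combination a0 + a1 + a2 + a3
  · have a0 := q0.1 (by intro h; linarith [h.1])
    have a1 := q1.2 (by linarith) (by linarith)
    have a2 := q2.1 (by intro h; linarith [h.1, h.2])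
    have a3 := q3.1 (by intro h; linarith [h.1, h.2])
    rw [if_neg (by nlinarith)]
    linear_combination a0 + a1 + a2 + a3
  · have a0 := q0.1 (by intro h; linarith [h.2])
    have a1 := q1.1 (by intro h; linarith [h.1, h.2])
    have a2 := q2.1 (by intro h; linarith [h.1, h.2])
    have a3 := q3.2 (by linarith) (by linarith)
    rw [if_neg (by nlinarith)]
    linear_combination a0 + a1 + a2 + a3
  · have a0 := q0.2 (by linarith) (by linarith)
    have a1 := q1.1 (by intro h; linarith [h.1, h.2])
    have a2 := q2.1 (by intro h; linarith [h.1, h.2])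
    have a3 := q3.1 (by intro h; linarith [h.1, h.2])
    rw [if_pos (mul_pos h1 h2)]
    linear_combination a0 + a1 + a2 + a3

end DNLS

namespace DNLS

/-! ### Linear differential equations on `[0, 1]` -/

section linearODE

attribute [local instance] Matrix.normedAddCommGroup Matrix.normedSpace

theorem norm_mulVec_le_two (A : Matrix (Fin 2) (Fin 2) ℂ) (v : Fin 2 → ℂ) :
    ‖A *ᵥ v‖ ≤ 2 * ‖A‖ * ‖v‖ := by
  refine (pi_norm_le_iff_of_nonneg (by positivity)).2 fun i => ?_
  rw [Matrix.mulVec, dotProduct, Fin.sum_univ_two]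
  refine (norm_add_le _ _).trans ?_
  rw [norm_mul, norm_mul]
  have h0 := mul_le_mul (Matrix.norm_entry_le_entrywise_sup_norm A (i := i) (j := 0))
    (norm_le_pi_norm v 0) (norm_nonneg _) (norm_nonneg _)
  have h1 := mul_le_mul (Matrix.norm_entry_le_entrywise_sup_norm A (i := i) (j := 1))
    (norm_le_pi_norm v 1) (norm_nonneg _) (norm_nonneg _)
  linarith

theorem _root_.HasDerivAt.matrix_mulVec {A : ℝ → Matrix (Fin 2) (Fin 2) ℂ}
    {A' : Matrix (Fin 2) (Fin 2) ℂ} {v : ℝ → Fin 2 → ℂ} {v' : Fin 2 → ℂ} {x : ℝ}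
    (hA : ∀ i j, HasDerivAt (fun y => A y i j) (A' i j) x) (hv : HasDerivAt v v' x) :
    HasDerivAt (fun y => A y *ᵥ v y) (A' *ᵥ v x + A x *ᵥ v') x := by
  refine hasDerivAt_pi.2 fun i => ?_
  simp only [Matrix.mulVec, dotProduct, Fin.sum_univ_two, Pi.add_apply]
  have h := fun j => (hA i j).fun_mul (hasDerivAt_pi.1 hv j)
  refine ((h 0).fun_add (h 1)).congr_deriv ?_
  ring

/-- Grönwall's inequality on `[0, 1]` with equal initial error and forcing. -/
theorem gronwall_unit {f f' : ℝ → Fin 2 → ℂ} {K η : ℝ} (hK : 1 ≤ K) (hη : 0 ≤ η)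
    (hf : ∀ τ ∈ Set.Icc (0 : ℝ) 1, HasDerivAt f (f' τ) τ) (h0 : ‖f 0‖ ≤ η)
    (hb : ∀ τ ∈ Set.Icc (0 : ℝ) 1, ‖f' τ‖ ≤ K * ‖f τ‖ + η) : ‖f 1‖ ≤ η * (2 * Real.exp K) := by
  have h := norm_le_gronwallBound_of_norm_deriv_right_le (a := 0) (b := 1)
    (fun τ hτ => (hf τ hτ).continuousAt.continuousWithinAt)
    (fun τ hτ => (hf τ ⟨hτ.1, hτ.2.le⟩).hasDerivWithinAt) h0
    (fun τ hτ => hb τ ⟨hτ.1, hτ.2.le⟩) 1 ⟨zero_le_one, le_rfl⟩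
  rw [gronwallBound_of_K_ne_0 (by linarith)] at h
  simp only [sub_zero, mul_one] at h
  have hE : 0 ≤ Real.exp K - 1 := by linarith [Real.add_one_le_exp K]
  have : η / K * (Real.exp K - 1) ≤ η * (Real.exp K - 1) :=
    mul_le_mul_of_nonneg_right (div_le_self hη hK) hE
  nlinarith

theorem exists_norm_bound_unit {A : ℝ → Matrix (Fin 2) (Fin 2) ℂ} (hA : Continuous A) :
    ∃ M, 0 ≤ M ∧ ∀ τ ∈ Set.Icc (0 : ℝ) 1, ‖A τ‖ ≤ M := by
  obtain ⟨M, hM⟩ := isCompact_Icc.exists_bound_of_continuousOn (s := Set.Icc (0 : ℝ) 1)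
    hA.continuousOn
  exact ⟨M, (norm_nonneg _).trans (hM 0 ⟨le_rfl, zero_le_one⟩), hM⟩

theorem linear_ode_unique {A : ℝ → Matrix (Fin 2) (Fin 2) ℂ} (hA : Continuous A)
    {f g : ℝ → Fin 2 → ℂ} (hf : ∀ τ ∈ Set.Icc (0 : ℝ) 1, HasDerivAt f (A τ *ᵥ f τ) τ)
    (hg : ∀ τ ∈ Set.Icc (0 : ℝ) 1, HasDerivAt g (A τ *ᵥ g τ) τ) (h0 : f 0 = g 0) : f 1 = g 1 := by
  obtain ⟨M, hM0, hM⟩ := exists_norm_bound_unit hA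
  have := gronwall_unit (f := fun τ => f τ - g τ) (K := 2 * M + 1) (η := 0) (by linarith) le_rfl
    (fun τ hτ => (hf τ hτ).fun_sub (hg τ hτ)) (by simp [h0]) (fun τ hτ => by
      rw [← Matrix.mulVec_sub]
      refine (norm_mulVec_le_two _ _).trans ?_
      have := mul_le_mul_of_nonneg_right (hM τ hτ) (norm_nonneg (f τ - g τ))
      nlinarith [norm_nonneg (f τ - g τ)])
  rw [zero_mul] at this
  exact sub_eq_zero.1 (norm_le_zero_iff.1 this)

/-- A flat connection transports horizontal sections: if `Ψ` solves `Ψ_τ = A Ψ`, solves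
`Ψ_x = B Ψ` at `τ = 0`, and `B_τ - A_x + [B, A] = 0`, then `Ψ_x = B Ψ` at `τ = 1`. -/
theorem hasDerivAt_of_zero_curvature {A B Ax Bt : ℝ → ℝ → Matrix (Fin 2) (Fin 2) ℂ}
    {Ψ : ℝ → ℝ → Fin 2 → ℂ}
    (hA : Continuous fun p : ℝ × ℝ => A p.1 p.2) (hAx : Continuous fun p : ℝ × ℝ => Ax p.1 p.2)
    (hAd : ∀ x τ i j, HasDerivAt (fun y => A y τ i j) (Ax x τ i j) x)
    (hBd : ∀ x τ i j, HasDerivAt (fun s => B x s i j) (Bt x τ i j) τ)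
    (hflat : ∀ x τ, Bt x τ - Ax x τ + B x τ * A x τ - A x τ * B x τ = 0)
    (hΨ : ∀ x, ∀ τ ∈ Set.Icc (0 : ℝ) 1, HasDerivAt (Ψ x) (A x τ *ᵥ Ψ x τ) τ)
    (hΨ0 : ∀ x, HasDerivAt (fun y => Ψ y 0) (B x 0 *ᵥ Ψ x 0) x) (x₀ : ℝ) :
    HasDerivAt (fun y => Ψ y 1) (B x₀ 1 *ᵥ Ψ x₀ 1) x₀ := by
  have hAd' : ∀ x τ, HasDerivAt (fun y => A y τ) (Ax x τ) x := fun x τ =>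
    hasDerivAt_pi.2 fun i => hasDerivAt_pi.2 fun j => hAd x τ i j
  obtain ⟨M, hM0, hM⟩ := exists_norm_bound_unit (A := fun τ => A x₀ τ) (by fun_prop)
  have hΨc : ContinuousOn (fun τ => Ψ x₀ τ) (Set.Icc 0 1) := fun τ hτ =>
    (hΨ x₀ τ hτ).continuousAt.continuousWithinAt
  have hBc : Continuous fun τ => B x₀ τ := continuous_matrix fun i j =>
    continuous_iff_continuousAt.2 fun τ => (hBd x₀ τ i j).continuousAt
  obtain ⟨C₁, hC₁⟩ := isCompact_Icc.exists_bound_of_continuousOn hΨc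
  obtain ⟨C₂, hC₂⟩ := isCompact_Icc.exists_bound_of_continuousOn
    (hBc.continuousOn.matrix_mulVec hΨc)
  have hC₁0 : 0 ≤ C₁ := (norm_nonneg _).trans (hC₁ 0 ⟨le_rfl, zero_le_one⟩)
  have hC₂0 : 0 ≤ C₂ := (norm_nonneg _).trans (hC₂ 0 ⟨le_rfl, zero_le_one⟩)
  set K : ℝ := 2 * (M + 1) + 1 with hK
  rw [hasDerivAt_iff_isLittleO, Asymptotics.isLittleO_iff]
  intro c hc
  -- The summands `2C₁` and `2C₂` come from the two forcing terms of the equation for `D`, the `1`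
  -- from the initial error, and `2 exp K` is the Grönwall factor; `ε ≤ 1` keeps `‖A x τ‖ ≤ M + 1`.
  set ε : ℝ := min 1 (c / ((2 * C₁ + 2 * C₂ + 1) * (2 * Real.exp K))) with hε
  have hε0 : 0 < ε := lt_min one_pos (by positivity)
  have ev1 : ∀ᶠ x in 𝓝 x₀, ∀ τ ∈ Set.Icc (0 : ℝ) 1, ‖A x τ - A x₀ τ‖ < ε := by
    refine isCompact_Icc.eventually_forall_of_forall_eventually fun τ _ => ?_
    have : Continuous fun z : ℝ × ℝ => ‖A z.1 z.2 - A x₀ z.2‖ :=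
      (hA.sub (hA.comp (by fun_prop : Continuous fun z : ℝ × ℝ => (x₀, z.2)))).norm
    exact this.continuousAt.eventually (gt_mem_nhds (by simpa using hε0))
  have ev2 : ∀ᶠ x in 𝓝 x₀, ∀ τ ∈ Set.Icc (0 : ℝ) 1, ‖Ax x τ - Ax x₀ τ‖ < ε := by
    refine isCompact_Icc.eventually_forall_of_forall_eventually fun τ _ => ?_
    have : Continuous fun z : ℝ × ℝ => ‖Ax z.1 z.2 - Ax x₀ z.2‖ :=
      (hAx.sub (hAx.comp (by fun_prop : Continuous fun z : ℝ × ℝ => (x₀, z.2)))).norm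
    exact this.continuousAt.eventually (gt_mem_nhds (by simpa using hε0))
  have ev3 := Asymptotics.isLittleO_iff.1 (hasDerivAt_iff_isLittleO.1 (hΨ0 x₀)) hε0
  obtain ⟨δ, hδ, hball⟩ := Metric.eventually_nhds_iff_ball.1 (ev1.and (ev2.and ev3))
  filter_upwards [Metric.ball_mem_nhds x₀ hδ] with x hx
  obtain ⟨h1, -, h3⟩ := hball x hx
  have h2 : ∀ τ ∈ Set.Icc (0 : ℝ) 1,
      ‖A x τ - A x₀ τ - (x - x₀) • Ax x₀ τ‖ ≤ ε * ‖x - x₀‖ := by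
    intro τ hτ
    have := (convex_ball x₀ δ).norm_image_sub_le_of_norm_hasDerivWithin_le
      (f := fun y => A y τ - (y - x₀) • Ax x₀ τ) (f' := fun y => Ax y τ - Ax x₀ τ) (C := ε)
      (fun y _ => ?_) (fun y hy => ((hball y hy).2.1 τ hτ).le)
      (Metric.mem_ball_self hδ) hx
    · convert this using 2
      simp only [sub_self, zero_smul, sub_zero]
      abel
    · have h := ((hasDerivAt_id y).sub_const x₀).smul_const (Ax x₀ τ)
      rw [one_smul] at h
      exact ((hAd' y τ).fun_sub h).hasDerivWithinAt
  -- `D` is the defect in the desired first-order expansion in `x`, as a function of `τ`. By zero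
  -- curvature the terms linear in `x - x₀` cancel in its equation, leaving `D' = A D` plus terms of
  -- size `ε ‖x - x₀‖`, and Grönwall carries the smallness from `τ = 0` to `τ = 1`. Only existence
  -- of the derivative of `B` in `τ` is used, not its continuity.
  set D : ℝ → Fin 2 → ℂ := fun τ => Ψ x τ - Ψ x₀ τ - (x - x₀) • (B x₀ τ *ᵥ Ψ x₀ τ) with hD
  set D' : ℝ → Fin 2 → ℂ := fun τ => A x τ *ᵥ D τ
    + ((A x τ - A x₀ τ - (x - x₀) • Ax x₀ τ) *ᵥ Ψ x₀ τ
      + (x - x₀) • ((A x τ - A x₀ τ) *ᵥ (B x₀ τ *ᵥ Ψ x₀ τ))) with hD'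
  have hDd : ∀ τ ∈ Set.Icc (0 : ℝ) 1, HasDerivAt D (D' τ) τ := fun τ hτ => by
    refine (((hΨ x τ hτ).fun_sub (hΨ x₀ τ hτ)).fun_sub
      ((HasDerivAt.matrix_mulVec (hBd x₀ τ) (hΨ x₀ τ hτ)).const_smul (x - x₀))).congr_deriv ?_
    have hfl : Bt x₀ τ + B x₀ τ * A x₀ τ = Ax x₀ τ + A x₀ τ * B x₀ τ := by
      have := hflat x₀ τ
      rw [← sub_eq_zero, ← this]
      abel
    rw [Matrix.mulVec_mulVec, ← Matrix.add_mulVec, hfl]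
    simp only [hD', hD, Matrix.mulVec_sub, Matrix.sub_mulVec, Matrix.add_mulVec,
      Matrix.mulVec_smul, Matrix.smul_mulVec, smul_add, smul_sub, Matrix.mulVec_mulVec,
      Matrix.sub_mul]
    abel
  have hη : (0 : ℝ) ≤ (2 * C₁ + 2 * C₂ + 1) * (ε * ‖x - x₀‖) := by positivity
  have hfin := gronwall_unit (K := K) (by linarith) hη hDd
    (by
      refine h3.trans ?_
      have : 0 ≤ ε * ‖x - x₀‖ := by positivity
      nlinarith)
    (fun τ hτ => by
      have a1 : ‖A x τ‖ ≤ M + 1 := by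
        have : A x τ = A x₀ τ + (A x τ - A x₀ τ) := by abel
        rw [this]
        refine (norm_add_le _ _).trans (add_le_add (hM τ hτ) ?_)
        exact (h1 τ hτ).le.trans (min_le_left _ _)
      have b1 : ‖A x τ *ᵥ D τ‖ ≤ 2 * (M + 1) * ‖D τ‖ :=
        (norm_mulVec_le_two _ _).trans (by gcongr)
      have b2 : ‖(A x τ - A x₀ τ - (x - x₀) • Ax x₀ τ) *ᵥ Ψ x₀ τ‖ ≤ 2 * (ε * ‖x - x₀‖) * C₁ :=
        (norm_mulVec_le_two _ _).trans (by gcongr; exacts [h2 τ hτ, hC₁ τ hτ])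
      have b3 : ‖(x - x₀) • ((A x τ - A x₀ τ) *ᵥ (B x₀ τ *ᵥ Ψ x₀ τ))‖
          ≤ ‖x - x₀‖ * (2 * ε * C₂) := by
        rw [norm_smul]
        gcongr
        exact (norm_mulVec_le_two _ _).trans (by gcongr; exacts [(h1 τ hτ).le, hC₂ τ hτ])
      have b4 : 0 ≤ ε * ‖x - x₀‖ := by positivity
      refine (norm_add_le _ _).trans ?_
      have := norm_add_le ((A x τ - A x₀ τ - (x - x₀) • Ax x₀ τ) *ᵥ Ψ x₀ τ)
        ((x - x₀) • ((A x τ - A x₀ τ) *ᵥ (B x₀ τ *ᵥ Ψ x₀ τ)))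
      nlinarith [norm_nonneg (D τ)])
  refine hfin.trans ?_
  have hεc : ε * ((2 * C₁ + 2 * C₂ + 1) * (2 * Real.exp K)) ≤ c := by
    rw [← le_div_iff₀ (by positivity)]
    exact min_le_right _ _
  calc _ = ε * ((2 * C₁ + 2 * C₂ + 1) * (2 * Real.exp K)) * ‖x - x₀‖ := by ring
    _ ≤ c * ‖x - x₀‖ := by gcongr

/-- Solutions of `m_τ = N m` stay close to an asymptotically stationary vector. -/
theorem tendsto_of_asymptotically_stationary {N : ℝ → ℝ → Matrix (Fin 2) (Fin 2) ℂ}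
    {m : ℝ → ℝ → Fin 2 → ℂ} {l : Filter ℝ} {v : Fin 2 → ℂ} {M : ℝ}
    (hm : ∀ x, ∀ τ ∈ Set.Icc (0 : ℝ) 1, HasDerivAt (m x) (N x τ *ᵥ m x τ) τ)
    (hM : ∀ᶠ x in l, ∀ τ ∈ Set.Icc (0 : ℝ) 1, ‖N x τ‖ ≤ M)
    (hv : ∀ ε > 0, ∀ᶠ x in l, ∀ τ ∈ Set.Icc (0 : ℝ) 1, ‖N x τ *ᵥ v‖ ≤ ε)
    (h0 : Tendsto (fun x => m x 0) l (𝓝 v)) : Tendsto (fun x => m x 1) l (𝓝 v) := by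
  set K : ℝ := 2 * |M| + 1 with hK
  rw [Metric.tendsto_nhds] at h0 ⊢
  intro ε hε
  set η : ℝ := ε / (4 * Real.exp K) with hη
  have hη0 : 0 < η := by positivity
  filter_upwards [hM, hv η hη0, h0 η hη0] with x hMx hvx h0x
  rw [dist_eq_norm] at h0x ⊢
  have := gronwall_unit (f := fun τ => m x τ - v) (K := K) (η := η)
    (by have := abs_nonneg M; linarith) hη0.le (fun τ hτ => (hm x τ hτ).sub_const v) h0x.le
    (fun τ hτ => by
      have e : N x τ *ᵥ m x τ = N x τ *ᵥ (m x τ - v) + N x τ *ᵥ v := by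
        rw [← Matrix.mulVec_add, sub_add_cancel]
      rw [e]
      refine (norm_add_le _ _).trans (add_le_add ((norm_mulVec_le_two _ _).trans ?_) (hvx τ hτ))
      gcongr
      linarith [hMx τ hτ, le_abs_self M])
  refine this.trans_lt ?_
  have : η * (2 * Real.exp K) = ε / 2 := by
    simp only [hη]; field_simp; norm_num
  rw [this]
  linarith

/-! ### Propagators -/

/-- Liouville's formula: the Wronskian grows at the rate `tr A`, which is zero. -/
theorem hasDerivAt_det_cols {u v : ℝ → Fin 2 → ℂ} {A : Matrix (Fin 2) (Fin 2) ℂ} {x : ℝ}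
    (hA : A 0 0 + A 1 1 = 0) (hu : HasDerivAt u (A *ᵥ u x) x) (hv : HasDerivAt v (A *ᵥ v x) x) :
    HasDerivAt (fun y => wr (u y) (v y)) 0 x := by
  have hu0 := hasDerivAt_pi.1 hu
  have hv0 := hasDerivAt_pi.1 hv
  simp only [wr, cols, Matrix.det_fin_two_of]
  refine (((hu0 0).fun_mul (hv0 1)).fun_sub ((hv0 0).fun_mul (hu0 1))).congr_deriv ?_
  simp only [Matrix.mulVec, dotProduct, Fin.sum_univ_two]
  linear_combination (u x 0 * v x 1 - v x 0 * u x 1) * hA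

/-- Multiplying a coefficient matrix by this bump makes it integrable without changing it on
`[0,1]`. The half-line Volterra theory then also solves initial value problems on `[0,1]`, with
continuity in `k`. -/
def cutoff (y : ℝ) : ℝ := max 0 (min 1 (3 - |y|))

theorem cutoff_eq_one {y : ℝ} (hy : |y| ≤ 2) : cutoff y = 1 := by
  rw [cutoff, min_eq_left (by linarith), max_eq_right zero_le_one]

theorem cutoff_eq_zero {y : ℝ} (hy : 3 ≤ |y|) : cutoff y = 0 := by
  rw [cutoff, max_eq_left]
  exact (min_le_right _ _).trans (by linarith)

theorem continuous_cutoff : Continuous cutoff := by unfold cutoff; fun_prop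

theorem cutoff_nonneg (y : ℝ) : 0 ≤ cutoff y := le_max_left _ _

theorem integrable_cutoff : Integrable cutoff := by
  refine continuous_cutoff.integrable_of_hasCompactSupport
    (HasCompactSupport.intro (isCompact_Icc (a := (-3 : ℝ)) (b := 3)) fun y hy => ?_)
  refine cutoff_eq_zero ?_
  by_contra h
  exact hy (abs_le.1 (not_le.1 h).le)

def cutoffKernel (A : ℂ → ℝ → Matrix (Fin 2) (Fin 2) ℂ) (k : ℂ) (_x y : ℝ) :
    Matrix (Fin 2) (Fin 2) ℂ := (-(cutoff y : ℂ)) • A k y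

theorem cutoffKernel_bound {A : ℂ → ℝ → Matrix (Fin 2) (Fin 2) ℂ}
    (hA : Continuous fun p : ℂ × ℝ => A p.1 p.2) (ρ : ℝ) :
    ∃ M, VolterraBound (cutoffKernel A) (Metric.closedBall 0 ρ) (fun y => M * cutoff y) := by
  obtain ⟨M, hM⟩ := ((isCompact_closedBall (0 : ℂ) ρ).prod
    (isCompact_Icc (a := (-3 : ℝ)) (b := 3))).exists_bound_of_continuousOn hA.continuousOn
  have hc := continuous_cutoff
  refine ⟨2 * |M|, ⟨?_, by fun_prop, fun y => mul_nonneg (by positivity) (cutoff_nonneg y),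
    integrable_cutoff.const_mul _, fun k hk x y _ v => ?_⟩⟩
  · unfold cutoffKernel
    have : Continuous fun p : ℂ × ℝ × ℝ => A p.1 p.2.2 :=
      hA.comp (by fun_prop : Continuous fun p : ℂ × ℝ × ℝ => (p.1, p.2.2))
    have h2 : Continuous fun p : ℂ × ℝ × ℝ => -(cutoff p.2.2 : ℂ) := by fun_prop
    exact h2.smul this
  · by_cases hy : 3 ≤ |y|
    · simp [cutoffKernel, cutoff_eq_zero hy]
    · have hAy : ‖A k y‖ ≤ |M| :=
        (hM (k, y) ⟨hk, abs_le.1 (not_le.1 hy).le⟩).trans (le_abs_self M)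
      rw [cutoffKernel, Matrix.smul_mulVec, norm_smul, norm_neg, Complex.norm_real,
        Real.norm_of_nonneg (cutoff_nonneg y)]
      calc cutoff y * ‖A k y *ᵥ v‖ ≤ cutoff y * (2 * |M| * ‖v‖) := by
            refine mul_le_mul_of_nonneg_left ?_ (cutoff_nonneg y)
            exact (norm_mulVec_le_two _ _).trans (by gcongr)
        _ = _ := by ring

theorem hasDerivAt_cutoff_volterra {A : ℂ → ℝ → Matrix (Fin 2) (Fin 2) ℂ}
    (hA : Continuous fun p : ℂ × ℝ => A p.1 p.2) (c : Fin 2 → ℂ) (k : ℂ) (x : ℝ) :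
    HasDerivAt (volterra (cutoffKernel A) c k)
      (((cutoff x : ℂ) • A k x) *ᵥ volterra (cutoffKernel A) c k x) x := by
  obtain ⟨M, hb⟩ := cutoffKernel_bound hA ‖k‖
  have hkS : k ∈ Metric.closedBall (0 : ℂ) ‖k‖ := by simp
  have hc : Continuous (volterra (cutoffKernel A) c k) := hb.continuous_volterra _ hkS
  set f : ℝ → Fin 2 → ℂ := fun y => cutoffKernel A k 0 y *ᵥ volterra (cutoffKernel A) c k y with hf
  have hfc : Continuous f := hb.continuous_kernel_mulVec 0 hc
  have hint : ∀ x, IntegrableOn f (Set.Ioi x) := fun x =>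
    hb.integrableOn_kernel_mulVec hkS x hc
      (C := ‖c‖ * Real.exp (∫ y, M * cutoff y)) fun y => (hb.norm_le c hkS y).trans
        (mul_le_mul_of_nonneg_left (Real.exp_le_exp.2 (tail_le hb.nonneg hb.integrable y))
          (norm_nonneg _))
  have heq : volterra (cutoffKernel A) c k = fun x => c + tail f x := by
    funext x
    exact hb.volterra_eq c hkS x
  have h := (hasDerivAt_tail hfc hint x).const_add c
  rw [← heq] at h
  refine h.congr_deriv ?_
  simp only [hf, cutoffKernel]
  rw [neg_smul, Matrix.neg_mulVec, neg_neg]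

/-- The propagator from `0` of `u_τ = A(k,τ) u` with `tr A = 0`. -/
theorem exists_propagator {A : ℂ → ℝ → Matrix (Fin 2) (Fin 2) ℂ}
    (hA : Continuous fun p : ℂ × ℝ => A p.1 p.2) (htr : ∀ k τ, A k τ 0 0 + A k τ 1 1 = 0) :
    ∃ U : ℂ → ℝ → Matrix (Fin 2) (Fin 2) ℂ, (∀ k, U k 0 = 1) ∧
      (∀ k, ∀ τ ∈ Set.Icc (0 : ℝ) 1, ∀ v : Fin 2 → ℂ,
        HasDerivAt (fun τ => U k τ *ᵥ v) (A k τ *ᵥ (U k τ *ᵥ v)) τ) ∧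
      (∀ τ, Continuous fun k => U k τ) ∧ ∀ k τ, (U k τ).det = 1 := by
  set u : ℂ → ℝ → Fin 2 → ℂ := volterra (cutoffKernel A) ![1, 0] with hu
  set w : ℂ → ℝ → Fin 2 → ℂ := volterra (cutoffKernel A) ![0, 1] with hw
  set V : ℂ → ℝ → Matrix (Fin 2) (Fin 2) ℂ := fun k τ => cols (u k τ) (w k τ) with hV
  have hdu := fun k x => hasDerivAt_cutoff_volterra hA ![1, 0] k x
  have hdw := fun k x => hasDerivAt_cutoff_volterra hA ![0, 1] k x
  have hdet : ∀ k τ, (V k τ).det = 1 := by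
    intro k τ
    have hd : ∀ x, HasDerivAt (fun y => wr (u k y) (w k y)) 0 x := fun x =>
      hasDerivAt_det_cols (by
        simp only [Matrix.smul_apply, smul_eq_mul]
        rw [← mul_add, htr, mul_zero]) (hdu k x) (hdw k x)
    have hconst := is_const_of_deriv_eq_zero (fun x => (hd x).differentiableAt)
      (fun x => (hd x).deriv)
    obtain ⟨M, hb⟩ := cutoffKernel_bound hA ‖k‖
    have hkS : k ∈ Metric.closedBall (0 : ℂ) ‖k‖ := by simp
    have l1 := tendsto_pi_nhds.1 (hb.tendsto_volterra ![1, 0] hkS)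
    have l2 := tendsto_pi_nhds.1 (hb.tendsto_volterra ![0, 1] hkS)
    -- The two solutions tend to the standard basis at `+∞`, which fixes the value of their constant
    -- Wronskian.
    have hlim : Tendsto (fun y => wr (u k y) (w k y)) atTop (𝓝 1) := by
      have := ((l1 0).mul (l2 1)).sub ((l2 0).mul (l1 1))
      simpa [wr, cols, Matrix.det_fin_two_of] using this
    have h2 : Tendsto (fun y => wr (u k y) (w k y)) atTop (𝓝 (wr (u k τ) (w k τ))) := by
      rw [show (fun y => wr (u k y) (w k y)) = fun _ => wr (u k τ) (w k τ) from
        funext fun y => hconst y τ]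
      exact tendsto_const_nhds
    exact tendsto_nhds_unique h2 hlim
  have hcontV : ∀ τ, Continuous fun k => V k τ := by
    have hcont : ∀ c τ, Continuous fun k => volterra (cutoffKernel A) c k τ := by
      intro c τ
      refine continuous_iff_continuousAt.2 fun k => ?_
      obtain ⟨M, hb⟩ := cutoffKernel_bound hA (‖k‖ + 1)
      have h := (hb.continuousOn_volterra c).comp (f := fun k : ℂ => (k, τ))
        (s := Metric.closedBall 0 (‖k‖ + 1)) (by fun_prop) (fun k hk => ⟨hk, trivial⟩)
      exact h.continuousAt (Metric.closedBall_mem_nhds_of_mem (by simp))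
    intro τ
    have h1 := fun i => (continuous_apply i).comp (hcont ![1, 0] τ)
    have h2 := fun i => (continuous_apply i).comp (hcont ![0, 1] τ)
    refine continuous_matrix fun i j => ?_
    fin_cases i <;> fin_cases j
    exacts [h1 0, h2 0, h1 1, h2 1]
  have hVv : ∀ k τ (c : Fin 2 → ℂ), V k τ *ᵥ c = c 0 • u k τ + c 1 • w k τ := by
    intro k τ c
    funext i
    fin_cases i <;> simp [hV, cols, Matrix.mulVec, dotProduct] <;> ring
  -- The solutions in `V` are normalised at `+∞`; since `det V = 1`, the adjugate of `V k 0` is its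
  -- inverse and moves the normalisation to `τ = 0`.
  refine ⟨fun k τ => V k τ * (V k 0).adjugate, fun k => ?_, fun k τ hτ v => ?_, fun τ => ?_,
    fun k τ => ?_⟩
  · show V k 0 * (V k 0).adjugate = 1
    rw [Matrix.mul_adjugate, hdet, one_smul]
  · simp only [← Matrix.mulVec_mulVec, hVv]
    generalize (V k 0).adjugate *ᵥ v = c
    have hcut : cutoff τ = 1 := cutoff_eq_one (by rw [abs_of_nonneg hτ.1]; linarith [hτ.2])
    have h1 := hdu k τ
    have h2 := hdw k τ
    rw [hcut, Complex.ofReal_one, one_smul] at h1 h2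
    refine ((h1.const_smul (c 0)).fun_add (h2.const_smul (c 1))).congr_deriv ?_
    rw [Matrix.mulVec_add, Matrix.mulVec_smul, Matrix.mulVec_smul]
  · exact (hcontV τ).matrix_mul (hcontV 0).matrix_adjugate
  · rw [Matrix.det_mul, Matrix.det_adjugate, hdet, hdet]
    simp

end linearODE

end DNLS

namespace DNLS

/-! ### Time evolution of the Jost solutions -/

section derivatives

variable {q : ℝ → ℝ → ℂ}

/-- `q_x`. -/
def qDx (q : ℝ → ℝ → ℂ) (x t : ℝ) : ℂ := deriv (fun y => q y t) x

theorem hasDerivAt_slice_fst {f : ℝ → ℝ → ℂ} {n : WithTop ℕ∞} (hn : n ≠ 0)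
    (hf : ContDiff ℝ n fun p : ℝ × ℝ => f p.1 p.2) (x t : ℝ) :
    HasDerivAt (fun y => f y t) (fderiv ℝ (fun p : ℝ × ℝ => f p.1 p.2) (x, t) (1, 0)) x := by
  have h := (hf.differentiable hn (x, t)).hasFDerivAt
  have hg : HasDerivAt (fun y : ℝ => (y, t)) ((1 : ℝ), (0 : ℝ)) x :=
    (hasDerivAt_id x).prodMk (hasDerivAt_const x t)
  exact h.comp_hasDerivAt (f := fun y : ℝ => (y, t)) x hg

theorem differentiableAt_slice_snd {f : ℝ → ℝ → ℂ} {n : WithTop ℕ∞} (hn : n ≠ 0)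
    (hf : ContDiff ℝ n fun p : ℝ × ℝ => f p.1 p.2) (x t : ℝ) :
    DifferentiableAt ℝ (fun s => f x s) t := by
  have h := (hf.differentiable hn (x, t)).hasFDerivAt
  have hg : HasDerivAt (fun s : ℝ => (x, s)) ((0 : ℝ), (1 : ℝ)) t :=
    (hasDerivAt_const t x).prodMk (hasDerivAt_id t)
  exact (h.comp_hasDerivAt (f := fun s : ℝ => (x, s)) t hg).differentiableAt

theorem IsSolutionZBC.continuous (hq : IsSolutionZBC q) : Continuous fun p : ℝ × ℝ => q p.1 p.2 :=
  hq.smooth.continuous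

theorem IsSolutionZBC.hasDerivAt_fst (hq : IsSolutionZBC q) (x t : ℝ) :
    HasDerivAt (fun y => q y t) (qDx q x t) x :=
  (hasDerivAt_slice_fst (by simp) hq.smooth x t).differentiableAt.hasDerivAt

theorem IsSolutionZBC.contDiff_qDx (hq : IsSolutionZBC q) :
    ContDiff ℝ 1 fun p : ℝ × ℝ => qDx q p.1 p.2 := by
  have e : (fun p : ℝ × ℝ => qDx q p.1 p.2)
      = fun p => fderiv ℝ (fun p : ℝ × ℝ => q p.1 p.2) p (1, 0) := by
    funext p
    exact (hasDerivAt_slice_fst (by simp) hq.smooth p.1 p.2).deriv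
  rw [e]
  exact (hq.smooth.fderiv_right (m := 1) (by norm_num)).clm_apply contDiff_const

theorem IsSolutionZBC.hasDerivAt_qDx (hq : IsSolutionZBC q) (x t : ℝ) :
    HasDerivAt (fun y => qDx q y t) (qDx (qDx q) x t) x :=
  (hasDerivAt_slice_fst (by simp) hq.contDiff_qDx x t).differentiableAt.hasDerivAt

theorem IsSolutionZBC.continuous_qDxx (hq : IsSolutionZBC q) :
    Continuous fun p : ℝ × ℝ => qDx (qDx q) p.1 p.2 := by
  have e : (fun p : ℝ × ℝ => qDx (qDx q) p.1 p.2)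
      = fun p => fderiv ℝ (fun p : ℝ × ℝ => qDx q p.1 p.2) p (1, 0) := by
    funext p
    exact (hasDerivAt_slice_fst (by simp) hq.contDiff_qDx p.1 p.2).deriv
  rw [e]
  exact (hq.contDiff_qDx.continuous_fderiv (by simp)).clm_apply continuous_const

theorem _root_.HasDerivAt.complex_conj {f : ℝ → ℂ} {f' : ℂ} {x : ℝ} (h : HasDerivAt f f' x) :
    HasDerivAt (fun y => conj (f y)) (conj f') x := by
  simpa using h.star

theorem IsSolutionZBC.equation (hq : IsSolutionZBC q) (x t : ℝ) :
    Complex.I * deriv (fun s => q x s) t + qDx (qDx q) x t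
      - Complex.I * (2 * q x t * qDx q x t * conj (q x t) + q x t ^ 2 * conj (qDx q x t)) = 0 := by
  have h := hq.dnls x t
  have e : (fun y => ((‖q y t‖ ^ 2 : ℝ) : ℂ) * q y t) = fun y => conj (q y t) * q y t * q y t := by
    funext y
    push_cast
    rw [Complex.conj_mul']
  have hx := hq.hasDerivAt_fst x t
  have hd := ((hx.complex_conj.fun_mul hx).fun_mul hx).deriv
  rw [e, hd] at h
  change Complex.I * deriv (fun s => q x s) t + qDx (qDx q) x t + _ = 0 at h
  rw [← h]
  ring

end derivatives

/-- The time part of the Lax pair. -/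
def laxT (q : ℝ → ℝ → ℂ) (x t : ℝ) (k : ℂ) : Matrix (Fin 2) (Fin 2) ℂ :=
  !![-2 * Complex.I * k ^ 4 + Complex.I * k ^ 2 * (q x t * conj (q x t)),
    -2 * k ^ 3 * q x t + k * (Complex.I * qDx q x t + q x t ^ 2 * conj (q x t));
    2 * k ^ 3 * conj (q x t) + k * (Complex.I * conj (qDx q x t) - q x t * conj (q x t) ^ 2),
    -(-2 * Complex.I * k ^ 4 + Complex.I * k ^ 2 * (q x t * conj (q x t)))]

/-- The `x`-derivative of the time part of the Lax pair. -/
def laxTx (q : ℝ → ℝ → ℂ) (x t : ℝ) (k : ℂ) : Matrix (Fin 2) (Fin 2) ℂ :=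
  !![Complex.I * k ^ 2 * (qDx q x t * conj (q x t) + q x t * conj (qDx q x t)),
    -2 * k ^ 3 * qDx q x t + k * (Complex.I * qDx (qDx q) x t
      + (2 * q x t * qDx q x t * conj (q x t) + q x t ^ 2 * conj (qDx q x t)));
    2 * k ^ 3 * conj (qDx q x t) + k * (Complex.I * conj (qDx (qDx q) x t)
      - (qDx q x t * conj (q x t) ^ 2 + 2 * q x t * conj (q x t) * conj (qDx q x t))),
    -(Complex.I * k ^ 2 * (qDx q x t * conj (q x t) + q x t * conj (qDx q x t)))]

/-- The `t`-derivative of the space part of the Lax pair. -/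
def laxXt (q : ℝ → ℝ → ℂ) (x t : ℝ) (k : ℂ) : Matrix (Fin 2) (Fin 2) ℂ :=
  !![0, k * deriv (fun s => q x s) t; -(k * conj (deriv (fun s => q x s) t)), 0]

/-! ### Zero curvature and uniqueness for the space equation. -/

section lax

variable {q : ℝ → ℝ → ℂ}

theorem hasDerivAt_laxT (hq : IsSolutionZBC q) (k : ℂ) (x t : ℝ) (i j : Fin 2) :
    HasDerivAt (fun y => laxT q y t k i j) (laxTx q x t k i j) x := by
  have h := hq.hasDerivAt_fst x t
  have hc := h.complex_conj
  have hx := hq.hasDerivAt_qDx x t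
  have hxc := hx.complex_conj
  have a := ((h.fun_mul hc).const_mul (Complex.I * k ^ 2)).const_add (-2 * Complex.I * k ^ 4)
  fin_cases i <;> fin_cases j
  · exact a
  · refine ((h.const_mul (-2 * k ^ 3)).fun_add (((hx.const_mul Complex.I).fun_add
      ((h.fun_pow 2).fun_mul hc)).const_mul k)).congr_deriv ?_
    change _ = laxTx q x t k 0 1
    simp only [laxTx, Matrix.of_apply, Matrix.cons_val_zero, Matrix.cons_val_one,
      Matrix.cons_val_fin_one]
    push_cast
    ring
  · refine ((hc.const_mul (2 * k ^ 3)).fun_add (((hxc.const_mul Complex.I).fun_sub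
      (h.fun_mul (hc.fun_pow 2))).const_mul k)).congr_deriv ?_
    change _ = laxTx q x t k 1 0
    simp only [laxTx, Matrix.of_apply, Matrix.cons_val_zero, Matrix.cons_val_one,
      Matrix.cons_val_fin_one]
    push_cast
    ring
  · exact a.fun_neg

theorem hasDerivAt_laxX (hq : IsSolutionZBC q) (k : ℂ) (x t : ℝ) (i j : Fin 2) :
    HasDerivAt (fun s => laxX q x s k i j) (laxXt q x t k i j) t := by
  have h := (differentiableAt_slice_snd (by simp) hq.smooth x t).hasDerivAt
  have hc := h.complex_conj
  fin_cases i <;> fin_cases j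
  · simpa [laxX, laxXt] using hasDerivAt_const t (Complex.I * k ^ 2)
  · simpa [laxX, laxXt] using h.const_mul k
  · simpa [laxX, laxXt] using (hc.const_mul k).fun_neg
  · simpa [laxX, laxXt] using hasDerivAt_const t (-(Complex.I * k ^ 2))

/-- Compatibility of the Lax pair. The diagonal entries vanish identically; the upper right entry is
a multiple of the differential equation for `q` and the lower left one of its complex conjugate. -/
theorem zero_curvature (hq : IsSolutionZBC q) (k : ℂ) (x t : ℝ) :
    laxXt q x t k - laxTx q x t k + laxX q x t k * laxT q x t k
      - laxT q x t k * laxX q x t k = 0 := by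
  have e := hq.equation x t
  have e' := congrArg conj e
  simp only [map_sub, map_add, map_mul, map_pow, Complex.conj_I, Complex.conj_conj, map_zero,
    Complex.conj_ofNat] at e'
  have hI := Complex.I_sq
  ext i j
  fin_cases i <;> fin_cases j <;>
    simp [laxX, laxT, laxTx, laxXt]
  · ring
  · linear_combination (-(Complex.I * k)) * e + (k * deriv (fun s => q x s) t
      - 2 * k * qDx q x t * q x t * conj (q x t) - k * q x t ^ 2 * conj (qDx q x t)
      + 2 * k ^ 3 * qDx q x t) * hI
  · linear_combination (-(Complex.I * k)) * e' + (-(k * conj (deriv (fun s => q x s) t))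
      + 2 * k * conj (qDx q x t) * q x t * conj (q x t) + k * conj (q x t) ^ 2 * qDx q x t
      - 2 * k ^ 3 * conj (qDx q x t)) * hI
  · ring

theorem continuous_laxX (hq : IsSolutionZBC q) :
    Continuous fun p : ℂ × ℝ × ℝ => laxX q p.2.1 p.2.2 p.1 := by
  have h : Continuous fun p : ℂ × ℝ × ℝ => q p.2.1 p.2.2 := hq.continuous.comp continuous_snd
  obtain ⟨f, hf⟩ : ∃ f : ℂ × ℝ × ℝ → ℂ, ∀ p, q p.2.1 p.2.2 = f p := ⟨_, fun _ => rfl⟩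
  simp only [laxX, hf] at h ⊢
  refine continuous_matrix fun i j => ?_
  fin_cases i <;> fin_cases j
  all_goals simp only [Fin.zero_eta, Fin.mk_one, Matrix.of_apply, Matrix.cons_val_zero,
    Matrix.cons_val_one, Matrix.cons_val_fin_one, Fin.isValue]
  all_goals fun_prop

theorem continuous_laxT (hq : IsSolutionZBC q) :
    Continuous fun p : ℂ × ℝ × ℝ => laxT q p.2.1 p.2.2 p.1 := by
  have h : Continuous fun p : ℂ × ℝ × ℝ => q p.2.1 p.2.2 := hq.continuous.comp continuous_snd
  have h' : Continuous fun p : ℂ × ℝ × ℝ => qDx q p.2.1 p.2.2 :=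
    hq.contDiff_qDx.continuous.comp continuous_snd
  obtain ⟨f, hf⟩ : ∃ f : ℂ × ℝ × ℝ → ℂ, ∀ p, q p.2.1 p.2.2 = f p := ⟨_, fun _ => rfl⟩
  obtain ⟨f', hf'⟩ : ∃ f : ℂ × ℝ × ℝ → ℂ, ∀ p, qDx q p.2.1 p.2.2 = f p := ⟨_, fun _ => rfl⟩
  simp only [laxT, hf, hf'] at h h' ⊢
  refine continuous_matrix fun i j => ?_
  fin_cases i <;> fin_cases j
  all_goals simp only [Fin.zero_eta, Fin.mk_one, Matrix.of_apply, Matrix.cons_val_zero,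
    Matrix.cons_val_one, Matrix.cons_val_fin_one, Fin.isValue]
  all_goals fun_prop

theorem continuous_laxTx (hq : IsSolutionZBC q) :
    Continuous fun p : ℂ × ℝ × ℝ => laxTx q p.2.1 p.2.2 p.1 := by
  have h : Continuous fun p : ℂ × ℝ × ℝ => q p.2.1 p.2.2 := hq.continuous.comp continuous_snd
  have h' : Continuous fun p : ℂ × ℝ × ℝ => qDx q p.2.1 p.2.2 :=
    hq.contDiff_qDx.continuous.comp continuous_snd
  have h'' : Continuous fun p : ℂ × ℝ × ℝ => qDx (qDx q) p.2.1 p.2.2 :=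
    hq.continuous_qDxx.comp continuous_snd
  obtain ⟨f, hf⟩ : ∃ f : ℂ × ℝ × ℝ → ℂ, ∀ p, q p.2.1 p.2.2 = f p := ⟨_, fun _ => rfl⟩
  obtain ⟨f', hf'⟩ : ∃ f : ℂ × ℝ × ℝ → ℂ, ∀ p, qDx q p.2.1 p.2.2 = f p := ⟨_, fun _ => rfl⟩
  obtain ⟨f₂, hf₂⟩ : ∃ f : ℂ × ℝ × ℝ → ℂ, ∀ p, qDx (qDx q) p.2.1 p.2.2 = f p :=
    ⟨_, fun _ => rfl⟩
  simp only [laxTx, hf, hf', hf₂] at h h' h'' ⊢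
  refine continuous_matrix fun i j => ?_
  fin_cases i <;> fin_cases j
  all_goals simp only [Fin.zero_eta, Fin.mk_one, Matrix.of_apply, Matrix.cons_val_zero,
    Matrix.cons_val_one, Matrix.cons_val_fin_one, Fin.isValue]
  all_goals fun_prop

theorem laxX_trace (x t : ℝ) (k : ℂ) : laxX q x t k 0 0 + laxX q x t k 1 1 = 0 := by
  simp [laxX]

/-- The segment from `x₀` to `x` is parametrised by `[0,1]`, which reduces the claim to Grönwall
there. -/
theorem laxX_unique (hq : IsSolutionZBC q) {t : ℝ} {k : ℂ} {φ ψ : ℝ → Fin 2 → ℂ}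
    (hφ : ∀ x, HasDerivAt φ (laxX q x t k *ᵥ φ x) x)
    (hψ : ∀ x, HasDerivAt ψ (laxX q x t k *ᵥ ψ x) x) {x₀ : ℝ} (h : φ x₀ = ψ x₀) : φ = ψ := by
  funext x
  have hd : ∀ {f : ℝ → Fin 2 → ℂ}, (∀ x, HasDerivAt f (laxX q x t k *ᵥ f x) x) →
      ∀ τ ∈ Set.Icc (0 : ℝ) 1, HasDerivAt (fun τ => f (x₀ + τ * (x - x₀)))
        ((((x - x₀ : ℝ) : ℂ) • laxX q (x₀ + τ * (x - x₀)) t k) *ᵥ f (x₀ + τ * (x - x₀))) τ := by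
    intro f hf τ _
    have h1 : HasDerivAt (fun τ : ℝ => x₀ + τ * (x - x₀)) (x - x₀) τ := by
      simpa using ((hasDerivAt_id τ).mul_const (x - x₀)).const_add x₀
    refine ((hf _).scomp τ h1).congr_deriv ?_
    rw [Matrix.smul_mulVec, Complex.coe_smul]
  have hc : Continuous fun τ : ℝ => ((x - x₀ : ℝ) : ℂ) • laxX q (x₀ + τ * (x - x₀)) t k :=
    ((continuous_laxX hq).comp
      (by fun_prop : Continuous fun τ : ℝ => (k, x₀ + τ * (x - x₀), t))).const_smul ((x - x₀ : ℝ) : ℂ)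
  have := linear_ode_unique hc (hd hφ) (hd hψ) (by simpa using h)
  simpa using this

end lax

/-! ### Transport of Jost columns in time and space. -/

section evolution

attribute [local instance] Matrix.normedAddCommGroup Matrix.normedSpace

variable {q : ℝ → ℝ → ℂ}

/-- The matrix of the equation `m_τ = N m` for a Jost column without its phase. -/
def stationaryT (q : ℝ → ℝ → ℂ) (t : ℝ) (k : ℂ) (j : Fin 2) (x τ : ℝ) :
    Matrix (Fin 2) (Fin 2) ℂ :=
  (t : ℂ) • laxT q x (t * τ) k + (2 * sgn j * Complex.I * k ^ 4 * t) • 1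

/-- Stripping off the phase of the `j`-th column cancels the term `∓2ik⁴` in the `j`-th diagonal
entry and doubles it in the other. Hence column `j` of the matrix decays with `q`, and the whole
matrix stays bounded. -/
theorem stationaryT_entries (q : ℝ → ℝ → ℂ) (t : ℝ) (k : ℂ) (j : Fin 2) (x τ : ℝ) :
    stationaryT q t k j x τ 0 0
        = (t : ℂ) * (Complex.I * k ^ 2 * (q x (t * τ) * conj (q x (t * τ))))
          - ![0, 4 * Complex.I * k ^ 4 * t] j ∧
      stationaryT q t k j x τ 1 1
        = -((t : ℂ) * (Complex.I * k ^ 2 * (q x (t * τ) * conj (q x (t * τ))))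
          - ![4 * Complex.I * k ^ 4 * t, 0] j) ∧
      stationaryT q t k j x τ 0 1 = (t : ℂ) * laxT q x (t * τ) k 0 1 ∧
      stationaryT q t k j x τ 1 0 = (t : ℂ) * laxT q x (t * τ) k 1 0 := by
  refine ⟨?_, ?_, by simp [stationaryT], by simp [stationaryT]⟩ <;> fin_cases j <;>
    simp [stationaryT, laxT, sgn] <;> ring

/-- The hypothesis that `q` and `q_x` decay uniformly for `|s| ≤ |t|` is what makes the bound
uniform along the whole time segment `t τ`. -/
theorem exists_decay_laxT (hq : IsSolutionZBC q) (t : ℝ) (k : ℂ) :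
    ∃ g : ℝ → ℝ, Tendsto g (cocompact ℝ) (𝓝 0) ∧ ∀ x, ∀ τ ∈ Set.Icc (0 : ℝ) 1,
      ‖(t : ℂ) * (Complex.I * k ^ 2 * (q x (t * τ) * conj (q x (t * τ))))‖ ≤ g x ∧
      ‖(t : ℂ) * laxT q x (t * τ) k 0 1‖ ≤ g x ∧ ‖(t : ℂ) * laxT q x (t * τ) k 1 0‖ ≤ g x := by
  obtain ⟨g, -, hg, hb⟩ := hq.decay |t|
  refine ⟨fun x => |t| * (‖k‖ ^ 2 * g x ^ 2 + (2 * ‖k‖ ^ 3 * g x + ‖k‖ * (g x + g x ^ 3))), ?_,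
    fun x τ hτ => ?_⟩
  · have := ((((hg.pow 2).const_mul (‖k‖ ^ 2)).add ((hg.const_mul (2 * ‖k‖ ^ 3)).add
      ((hg.add (hg.pow 3)).const_mul ‖k‖)))).const_mul |t|
    simpa using this
  · have hτt : |t * τ| ≤ |t| := by
      rw [abs_mul, abs_of_nonneg hτ.1]
      exact mul_le_of_le_one_right (abs_nonneg t) hτ.2
    obtain ⟨h1, h2⟩ := hb x (t * τ) hτt
    have hg0 : 0 ≤ g x := (norm_nonneg _).trans h1
    change ‖qDx q x (t * τ)‖ ≤ g x at h2
    simp only [laxT, Matrix.of_apply, Matrix.cons_val_zero, Matrix.cons_val_one,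
      Matrix.cons_val_fin_one]
    generalize q x (t * τ) = a at *
    have p2 : ‖a‖ ^ 2 ≤ g x ^ 2 := by gcongr
    have p3 : ‖a‖ ^ 3 ≤ g x ^ 3 := by gcongr
    have n0 : 0 ≤ ‖k‖ ^ 2 * g x ^ 2 := by positivity
    have n1 : 0 ≤ 2 * ‖k‖ ^ 3 * g x + ‖k‖ * (g x + g x ^ 3) := by positivity
    generalize qDx q x (t * τ) = b at *
    have hG : 0 ≤ |t| := abs_nonneg t
    have hI2 : ‖(2 : ℂ)‖ = 2 := Complex.norm_ofNat 2
    simp only [norm_mul, Complex.norm_real, Real.norm_eq_abs]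
    refine ⟨mul_le_mul_of_nonneg_left ?_ hG, mul_le_mul_of_nonneg_left ?_ hG,
      mul_le_mul_of_nonneg_left ?_ hG⟩
    · rw [Complex.norm_I, RCLike.norm_conj, norm_pow, one_mul, ← pow_two]
      have : ‖k‖ ^ 2 * ‖a‖ ^ 2 ≤ ‖k‖ ^ 2 * g x ^ 2 := by gcongr
      linarith
    · refine (?_ : _ ≤ 2 * ‖k‖ ^ 3 * g x + ‖k‖ * (g x + g x ^ 3)).trans (by linarith)
      refine (norm_add_le _ _).trans (add_le_add ?_ ?_)
      · rw [norm_mul, norm_mul, norm_neg, hI2, norm_pow]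
        gcongr
      · rw [norm_mul]
        refine mul_le_mul_of_nonneg_left ((norm_add_le _ _).trans (add_le_add ?_ ?_))
          (norm_nonneg k)
        · rw [norm_mul, Complex.norm_I, one_mul]; exact h2
        · rw [norm_mul, RCLike.norm_conj, norm_pow, ← pow_succ]; exact p3
    · refine (?_ : _ ≤ 2 * ‖k‖ ^ 3 * g x + ‖k‖ * (g x + g x ^ 3)).trans (by linarith)
      refine (norm_add_le _ _).trans (add_le_add ?_ ?_)
      · rw [norm_mul, norm_mul, hI2, norm_pow, RCLike.norm_conj]
        gcongr
      · rw [norm_mul]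
        refine mul_le_mul_of_nonneg_left ((norm_sub_le _ _).trans (add_le_add ?_ ?_))
          (norm_nonneg k)
        · rw [norm_mul, Complex.norm_I, one_mul, RCLike.norm_conj]; exact h2
        · rw [norm_mul, norm_pow, RCLike.norm_conj, ← pow_succ']; exact p3

/-- Jost columns at time `0` are carried to Jost columns at time `t` by the time part of the
Lax pair. -/
theorem exists_time_propagator (hq : IsSolutionZBC q) (t : ℝ) :
    ∃ U : ℝ → ℂ → Matrix (Fin 2) (Fin 2) ℂ, (∀ x, Continuous (U x)) ∧
      (∀ x k, (U x k).det = 1) ∧ ∀ (l : Filter ℝ), l ≤ cocompact ℝ → ∀ (j : Fin 2) (k : ℂ)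
        (φ : ℝ → Fin 2 → ℂ), IsJostColumn q l j 0 k φ →
          IsJostColumn q l j t k (fun x => U x k *ᵥ φ x) := by
  have hprop := fun x : ℝ => exists_propagator
    (A := fun k τ => (t : ℂ) • laxT q x (t * τ) k)
    (((continuous_laxT hq).comp (by fun_prop : Continuous fun p : ℂ × ℝ =>
      (p.1, x, t * p.2))).const_smul (t : ℂ))
    (fun k τ => by simp [laxT]; ring)
  choose U hU0 hUd hUc hUdet using hprop
  refine ⟨fun x k => U x k 1, fun x => hUc x 1, fun x k => hUdet x k 1, ?_⟩
  rintro l hl j k φ ⟨hφd, hφl⟩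
  set Ψ : ℝ → ℝ → Fin 2 → ℂ := fun x τ => U x k τ *ᵥ φ x with hΨ
  have hΨd : ∀ x, ∀ τ ∈ Set.Icc (0 : ℝ) 1,
      HasDerivAt (Ψ x) (((t : ℂ) • laxT q x (t * τ) k) *ᵥ Ψ x τ) τ := fun x τ hτ =>
    hUd x k τ hτ (φ x)
  have hΨ0 : ∀ x, Ψ x 0 = φ x := fun x => by
    simp only [hΨ, hU0, Matrix.one_mulVec]
  have hτ1 : ∀ τ : ℝ, HasDerivAt (fun τ : ℝ => t * τ) t τ := fun τ => by
    simpa using (hasDerivAt_id τ).const_mul t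
  constructor
  · intro x
    -- The space equation holds at time `0` and is carried to time `t` by the flat connection, with
    -- time rescaled to `τ ∈ [0,1]`.
    have := hasDerivAt_of_zero_curvature
      (A := fun x τ => (t : ℂ) • laxT q x (t * τ) k) (B := fun x τ => laxX q x (t * τ) k)
      (Ax := fun x τ => (t : ℂ) • laxTx q x (t * τ) k)
      (Bt := fun x τ => (t : ℂ) • laxXt q x (t * τ) k) (Ψ := Ψ)
      (((continuous_laxT hq).comp (by fun_prop : Continuous fun p : ℝ × ℝ =>
        (k, p.1, t * p.2))).const_smul (t : ℂ))
      (((continuous_laxTx hq).comp (by fun_prop : Continuous fun p : ℝ × ℝ =>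
        (k, p.1, t * p.2))).const_smul (t : ℂ))
      (fun x τ i j => (hasDerivAt_laxT hq k x (t * τ) i j).const_mul _)
      (fun x τ i j => by
        refine ((hasDerivAt_laxX hq k x (t * τ) i j).scomp τ (hτ1 τ)).congr_deriv ?_
        rw [Matrix.smul_apply, Complex.coe_smul])
      (fun x τ => by
        rw [Matrix.mul_smul, Matrix.smul_mul, ← smul_sub, ← smul_add, ← smul_sub,
          zero_curvature hq, smul_zero])
      hΨd (fun x => by
        simp only [hΨ0, mul_zero]
        exact hφd x) x
    simp only [mul_one] at this
    exact this
  · set m : ℝ → ℝ → Fin 2 → ℂ := fun x τ =>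
      Complex.exp (-(sgn j * Complex.I * theta x (t * τ) k)) • Ψ x τ with hm
    obtain ⟨g, hg, hb⟩ := exists_decay_laxT hq t k
    have hgl : Tendsto g l (𝓝 0) := hg.mono_left hl
    -- The bound consists of the surviving diagonal term `4ik⁴t` and of the decaying part, which is
    -- eventually below `1`. Since `N e_j → 0`, the normalisation at the end `l` is preserved.
    have key := tendsto_of_asymptotically_stationary (N := stationaryT q t k j) (m := m) (l := l)
      (v := Pi.single j 1) (M := |t| * (4 * ‖k‖ ^ 4) + 1)
      (fun x τ hτ => by
        have hth : HasDerivAt (fun τ : ℝ => -(sgn j * Complex.I * theta x (t * τ) k))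
            (2 * sgn j * Complex.I * k ^ 4 * t) τ := by
          have h1 : HasDerivAt (fun τ : ℝ => ((t * τ : ℝ) : ℂ)) (t : ℂ) τ := (hτ1 τ).ofReal_comp
          have := ((((h1.const_mul (2 * k ^ 2)).const_sub (x : ℂ)).const_mul (k ^ 2)).const_mul
            (sgn j * Complex.I)).fun_neg
          refine this.congr_deriv ?_
          ring
        refine ((hth.cexp).fun_smul (hΨd x τ hτ)).congr_deriv ?_
        simp only [stationaryT, hm, Matrix.add_mulVec, Matrix.mulVec_smul, Matrix.smul_mulVec,
          Matrix.one_mulVec, smul_smul, smul_add])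
      ?_ ?_ ?_
    · simp only [hm, mul_one] at key
      exact key
    · filter_upwards [hgl.eventually (gt_mem_nhds one_pos)] with x hx τ hτ
      obtain ⟨h1, h2, h3⟩ := hb x τ hτ
      have h4 : ‖4 * Complex.I * k ^ 4 * (t : ℂ)‖ = |t| * (4 * ‖k‖ ^ 4) := by
        simp only [norm_mul, norm_pow, Complex.norm_I, Complex.norm_real, Complex.norm_ofNat,
          Real.norm_eq_abs]
        ring
      have h4' : 0 ≤ |t| * (4 * ‖k‖ ^ 4) := by positivity
      refine (Matrix.norm_le_iff (by positivity)).2 fun a b => ?_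
      obtain ⟨d0, d1, d2, d3⟩ := stationaryT_entries q t k j x τ
      fin_cases a <;> fin_cases b
      · change ‖stationaryT q t k j x τ 0 0‖ ≤ _
        rw [d0]
        fin_cases j
        · simpa using (h1.trans hx.le).trans (by linarith)
        · refine (norm_sub_le _ _).trans ?_
          simp only [Fin.mk_one, Fin.isValue, Matrix.cons_val_one, Matrix.cons_val_fin_one, h4]
          linarith
      · change ‖stationaryT q t k j x τ 0 1‖ ≤ _
        rw [d2]
        linarith
      · change ‖stationaryT q t k j x τ 1 0‖ ≤ _
        rw [d3]
        linarith
      · change ‖stationaryT q t k j x τ 1 1‖ ≤ _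
        rw [d1, norm_neg]
        fin_cases j
        · refine (norm_sub_le _ _).trans ?_
          simp only [Fin.zero_eta, Fin.isValue, Matrix.cons_val_zero, h4]
          linarith
        · simpa using (h1.trans hx.le).trans (by linarith)
    · intro ε hε
      filter_upwards [hgl.eventually (gt_mem_nhds hε)] with x hx τ hτ
      obtain ⟨h1, h2, h3⟩ := hb x τ hτ
      refine (pi_norm_le_iff_of_nonneg hε.le).2 fun i => ?_
      obtain ⟨d0, d1, d2, d3⟩ := stationaryT_entries q t k j x τ
      rw [Matrix.mulVec_single_one, Matrix.col_apply]
      fin_cases i <;> fin_cases j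
      · change ‖stationaryT q t k 0 x τ 0 0‖ ≤ _
        simpa using (congrArg norm d0).le.trans (by simpa using h1.trans hx.le)
      · exact (congrArg norm d2).le.trans (h2.trans hx.le)
      · exact (congrArg norm d3).le.trans (h3.trans hx.le)
      · change ‖stationaryT q t k 1 x τ 1 1‖ ≤ _
        simpa using (congrArg norm d1).le.trans (by simpa using h1.trans hx.le)
    · simpa [hm, hΨ0] using hφl

/-- The evolution of all Jost columns from `(0, 0)` to `(x, t)`. -/
theorem exists_lax_propagator (hq : IsSolutionZBC q) (x t : ℝ) :
    ∃ G : ℂ → Matrix (Fin 2) (Fin 2) ℂ, Continuous G ∧ (∀ k, (G k).det = 1) ∧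
      ∀ (l : Filter ℝ), l ≤ cocompact ℝ → ∀ (j : Fin 2) (k : ℂ) (φ : ℝ → Fin 2 → ℂ),
        IsJostColumn q l j 0 k φ → ∃ ψ, IsJostColumn q l j t k ψ ∧ ψ x = G k *ᵥ φ 0 := by
  obtain ⟨U, hUc, hUdet, hU⟩ := exists_time_propagator hq t
  obtain ⟨W, hW0, hWd, hWc, hWdet⟩ := exists_propagator
    (A := fun k τ => (x : ℂ) • laxX q (x * τ) t k)
    (((continuous_laxX hq).comp (by fun_prop : Continuous fun p : ℂ × ℝ =>
      (p.1, x * p.2, t))).const_smul (x : ℂ))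
    (fun k τ => by simp [laxX])
  -- First evolve in time at `x = 0`, then in space at time `t`.
  refine ⟨fun k => W k 1 * U 0 k, (hWc 1).matrix_mul (hUc 0), fun k => by
    rw [Matrix.det_mul, hWdet, hUdet, one_mul], fun l hl j k φ hφ => ?_⟩
  have hψ := hU l hl j k φ hφ
  refine ⟨_, hψ, ?_⟩
  set ψ : ℝ → Fin 2 → ℂ := fun x => U x k *ᵥ φ x with hψdef
  have := linear_ode_unique (A := fun τ => (x : ℂ) • laxX q (x * τ) t k)
    (f := fun τ => ψ (x * τ)) (g := fun τ => W k τ *ᵥ ψ 0)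
    (((continuous_laxX hq).comp (by fun_prop : Continuous fun τ : ℝ =>
      (k, x * τ, t))).const_smul (x : ℂ))
    (fun τ _ => by
      have h1 : HasDerivAt (fun τ : ℝ => x * τ) x τ := by
        simpa using (hasDerivAt_id τ).const_mul x
      refine ((hψ.1 _).scomp τ h1).congr_deriv ?_
      rw [Matrix.smul_mulVec, Complex.coe_smul])
    (fun τ hτ => hWd k τ hτ (ψ 0)) (by simp [hW0])
  simp only [mul_one, hψdef, Matrix.mulVec_mulVec] at this
  exact this

end evolution

end DNLS

namespace DNLS

/-! ### The four Jost columns -/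

variable {q : ℝ → ℝ → ℂ}

theorem IsSolutionZBC.potential (hq : IsSolutionZBC q) (t : ℝ) : Potential (fun x => q x t) := by
  obtain ⟨g, hgi, hg, hb⟩ := hq.decay |t|
  have hc : ContDiff ℝ 1 (fun x => q x t) :=
    (hq.smooth.of_le (by norm_num)).comp (contDiff_id.prodMk contDiff_const)
  exact ⟨hc, hgi.mono' hc.continuous.aestronglyMeasurable
      (Eventually.of_forall fun x => (hb x t le_rfl).1),
    hgi.mono' (hc.continuous_deriv le_rfl).aestronglyMeasurable
      (Eventually.of_forall fun x => (hb x t le_rfl).2),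
    squeeze_zero_norm (fun x => (hb x t le_rfl).1) hg⟩

/-- The potential `x ↦ conj (p (-x))`. -/
def reflect (p : ℝ → ℂ) (x : ℝ) : ℂ := conj (p (-x))

theorem Potential.reflect {p : ℝ → ℂ} (hp : Potential p) : Potential (reflect p) := by
  have hd : deriv (DNLS.reflect p) = fun x => -conj (deriv p (-x)) := by
    funext x
    have h1 : HasDerivAt (fun x => p (-x)) (-deriv p (-x)) x := by
      simpa [Function.comp_def] using (hp.hasDerivAt (-x)).scomp x (hasDerivAt_neg x)
    rw [← map_neg]
    exact h1.complex_conj.deriv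
  refine ⟨?_, ?_, ?_, ?_⟩
  · exact (Complex.conjCLE.contDiff (n := 1)).comp (hp.contDiff.comp contDiff_neg)
  · exact (Complex.conjCLE.toContinuousLinearMap).integrable_comp hp.integrable.comp_neg
  · rw [hd]
    exact ((Complex.conjCLE.toContinuousLinearMap).integrable_comp
      hp.integrable_deriv.comp_neg).neg
  · have h1 : Tendsto (fun x => p (-x)) (cocompact ℝ) (𝓝 0) :=
      hp.tendsto_zero.comp (Homeomorph.neg ℝ).isClosedEmbedding.tendsto_cocompact
    have h2 := (Complex.continuous_conj.tendsto 0).comp h1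
    rwa [map_zero] at h2

theorem hasDerivAt_theta (x t : ℝ) (k : ℂ) :
    HasDerivAt (fun y : ℝ => theta y t k) (k ^ 2) x := by
  have h : HasDerivAt (fun y : ℝ => (y : ℂ)) 1 x := Complex.ofRealCLM.hasDerivAt
  refine ((h.sub_const (2 * k ^ 2 * t)).const_mul (k ^ 2)).congr_deriv (mul_one _)

theorem isJostColumn_plus_zero (hq : IsSolutionZBC q) (t : ℝ) {k : ℂ} (hk : k ∈ DplusC) :
    IsJostColumn q atTop 0 t k
      (fun x => Complex.exp (Complex.I * theta x t k) • jost (fun y => q y t) k x) := by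
  have hp := hq.potential t
  constructor
  · intro x
    refine ((((hasDerivAt_theta x t k).const_mul Complex.I).cexp).fun_smul
      (hasDerivAt_jost hp hk x)).congr_deriv ?_
    ext i
    fin_cases i <;> simp [laxX, Matrix.mulVec, dotProduct] <;> ring
  · refine (tendsto_jost hp hk).congr' (Eventually.of_forall fun x => ?_) |>.trans_eq ?_
    · rw [smul_smul, ← Complex.exp_add]
      simp [sgn]
    · congr 1
      ext i
      fin_cases i <;> simp

/-- Under `x ↦ -x` with the two components exchanged, the equation for `μ₋₂` with potential `q`
becomes the equation for `μ₊₁` with potential `q(-x)^*`, at the same `k`. So the column at `-∞`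
needs no new construction. -/
theorem isJostColumn_minus_one (hq : IsSolutionZBC q) (t : ℝ) {k : ℂ} (hk : k ∈ DplusC) :
    IsJostColumn q atBot 1 t k (fun x => Complex.exp (-(Complex.I * theta x t k)) •
      ![jost (reflect fun y => q y t) k (-x) 1, jost (reflect fun y => q y t) k (-x) 0]) := by
  have hp := (hq.potential t).reflect
  set m := jost (reflect fun y => q y t) k with hm
  constructor
  · intro x
    have h := hasDerivAt_jost hp hk (-x)
    have h0 : HasDerivAt (fun x => m (-x) 0) _ x :=
      (hasDerivAt_pi.1 h 0).scomp x (hasDerivAt_neg x)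
    have h1 : HasDerivAt (fun x => m (-x) 1) _ x :=
      (hasDerivAt_pi.1 h 1).scomp x (hasDerivAt_neg x)
    have hv : HasDerivAt (fun x => ![m (-x) 1, m (-x) 0]) ![_, _] x :=
      hasDerivAt_pi.2 (Fin.forall_fin_two.2 ⟨h1, h0⟩)
    refine ((((hasDerivAt_theta x t k).const_mul Complex.I).fun_neg.cexp).fun_smul
      hv).congr_deriv ?_
    ext i
    fin_cases i <;> simp [laxX, Matrix.mulVec, dotProduct, reflect, ← hm] <;> ring
  · have hl := (tendsto_pi_nhds.1 (tendsto_jost hp hk))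
    have h0 : Tendsto (fun x => m (-x) 0) atBot (𝓝 1) := (hl 0).comp tendsto_neg_atBot_atTop
    have h1 : Tendsto (fun x => m (-x) 1) atBot (𝓝 0) := (hl 1).comp tendsto_neg_atBot_atTop
    have hv : Tendsto (fun x => ![m (-x) 1, m (-x) 0]) atBot (𝓝 (Pi.single 1 1)) :=
      tendsto_pi_nhds.2 (Fin.forall_fin_two.2 ⟨by simpa using h1, by simpa using h0⟩)
    refine hv.congr' (Eventually.of_forall fun x => ?_)
    dsimp only
    rw [smul_smul, ← Complex.exp_add]
    simp [sgn]

/-- The symmetry `u ↦ (-u₂^*, u₁^*)`. -/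
def conjSwap (v : Fin 2 → ℂ) : Fin 2 → ℂ := ![-conj (v 1), conj (v 0)]

theorem conjSwap_smul (c : ℂ) (v : Fin 2 → ℂ) : conjSwap (c • v) = conj c • conjSwap v := by
  ext i
  fin_cases i <;> simp [conjSwap]

theorem continuous_conjSwap : Continuous conjSwap := by
  have := Complex.continuous_conj
  refine continuous_pi fun i => ?_
  fin_cases i
  · exact (this.comp (continuous_apply 1)).neg
  · exact this.comp (continuous_apply 0)

theorem theta_conj (x t : ℝ) (k : ℂ) : theta x t (conj k) = conj (theta x t k) := by
  simp only [theta, map_mul, map_sub, map_pow, Complex.conj_ofReal, map_ofNat]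

/-- The map `u ↦ (-u₂^*, u₁^*)` intertwines `X(k)` with `X(k^*)`, thanks to the form of `Q`. It
exchanges `D⁺` and `D⁻` and the two columns, so the columns on `D⁻` follow from those on `D⁺`. -/
theorem hasDerivAt_conjSwap {t : ℝ} {k : ℂ} {φ : ℝ → Fin 2 → ℂ} {x : ℝ}
    (h : HasDerivAt φ (laxX q x t k *ᵥ φ x) x) :
    HasDerivAt (fun x => conjSwap (φ x)) (laxX q x t (conj k) *ᵥ conjSwap (φ x)) x := by
  have h0 := (hasDerivAt_pi.1 h 0).complex_conj
  have h1 := (hasDerivAt_pi.1 h 1).complex_conj.fun_neg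
  have hv : HasDerivAt (fun x => conjSwap (φ x)) ![_, _] x :=
    hasDerivAt_pi.2 (Fin.forall_fin_two.2 ⟨h1, h0⟩)
  refine hv.congr_deriv ?_
  ext i
  fin_cases i <;> simp [laxX, Matrix.mulVec, dotProduct, conjSwap] <;> ring

theorem IsJostColumn.conjSwap_zero {l : Filter ℝ} {t : ℝ} {k : ℂ} {φ : ℝ → Fin 2 → ℂ}
    (h : IsJostColumn q l 0 t k φ) :
    IsJostColumn q l 1 t (conj k) (fun x => conjSwap (φ x)) := by
  refine ⟨fun x => hasDerivAt_conjSwap (h.1 x), ?_⟩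
  have := (continuous_conjSwap.tendsto _).comp h.2
  refine (this.congr fun x => ?_).trans_eq ?_
  · rw [Function.comp_apply, conjSwap_smul, ← Complex.exp_conj]
    congr 2
    simp [sgn, theta_conj]
  · congr 1
    ext i
    fin_cases i <;> simp [conjSwap]

theorem IsJostColumn.conjSwap_one {l : Filter ℝ} {t : ℝ} {k : ℂ} {φ : ℝ → Fin 2 → ℂ}
    (h : IsJostColumn q l 1 t k φ) :
    IsJostColumn q l 0 t (conj k) (fun x => -conjSwap (φ x)) := by
  refine ⟨fun x => ?_, ?_⟩
  · rw [Matrix.mulVec_neg]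
    exact (hasDerivAt_conjSwap (h.1 x)).neg
  · have := ((continuous_conjSwap.tendsto _).comp h.2).neg
    refine (this.congr fun x => ?_).trans_eq ?_
    · rw [Function.comp_apply, conjSwap_smul, ← Complex.exp_conj, smul_neg]
      congr 3
      simp [sgn, theta_conj]
    · congr 1
      ext i
      fin_cases i <;> simp [conjSwap]

/-- The symmetry `k ↦ -k`. -/
theorem IsJostColumn.neg {l : Filter ℝ} {j : Fin 2} {t : ℝ} {k : ℂ} {φ : ℝ → Fin 2 → ℂ}
    (h : IsJostColumn q l j t k φ) :
    IsJostColumn q l j t (-k) (fun x => sgn j • ![φ x 0, -φ x 1]) := by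
  constructor
  · intro x
    have h0 := hasDerivAt_pi.1 (h.1 x) 0
    have h1 := (hasDerivAt_pi.1 (h.1 x) 1).fun_neg
    have hv : HasDerivAt (fun x => ![φ x 0, -φ x 1]) ![_, _] x :=
      hasDerivAt_pi.2 (Fin.forall_fin_two.2 ⟨h0, h1⟩)
    rw [Matrix.mulVec_smul]
    refine (hv.const_smul (sgn j)).congr_deriv ?_
    congr 1
    ext i
    fin_cases i <;> simp [laxX, Matrix.mulVec, dotProduct] <;> ring
  · have hl := tendsto_pi_nhds.1 h.2
    refine tendsto_pi_nhds.2 fun i => ?_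
    have he : ∀ x : ℝ, theta x t (-k) = theta x t k := fun x => by simp [theta]
    simp only [he]
    have := (hl i).const_mul (sgn j * sgn i)
    fin_cases i <;> fin_cases j <;> simpa [sgn] using this

/-- The phase `e^{2 σ i θ}` of the `j`-th column stays bounded along `l`. -/
def Admissible (l : Filter ℝ) (j : Fin 2) (k : ℂ) : Prop :=
  ∀ᶠ x in l, 0 ≤ (sgn j).re * (k.re * k.im) * x

theorem admissible_atTop_zero {k : ℂ} (hk : k ∈ DplusC) : Admissible atTop 0 k := by
  filter_upwards [eventually_ge_atTop 0] with x hx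
  simpa [sgn] using mul_nonneg hk hx

theorem admissible_atBot_one {k : ℂ} (hk : k ∈ DplusC) : Admissible atBot 1 k := by
  filter_upwards [eventually_le_atBot 0] with x hx
  simpa [sgn] using mul_nonpos_of_nonneg_of_nonpos hk hx

theorem admissible_atTop_one {k : ℂ} (hk : k ∈ DminusC) : Admissible atTop 1 k := by
  filter_upwards [eventually_ge_atTop 0] with x hx
  simpa [sgn] using mul_nonpos_of_nonpos_of_nonneg hk hx

theorem admissible_atBot_zero {k : ℂ} (hk : k ∈ DminusC) : Admissible atBot 0 k := by
  filter_upwards [eventually_le_atBot 0] with x hx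
  simpa [sgn] using mul_nonneg_of_nonpos_of_nonpos hk hx

theorem wr_smul_smul (a b : ℂ) (u v : Fin 2 → ℂ) : wr (a • u) (b • v) = a * b * wr u v := by
  simp [wr, cols, Matrix.det_fin_two_of]; ring

theorem wr_eq (u v : Fin 2 → ℂ) : wr u v = u 0 * v 1 - v 0 * u 1 := by
  rw [wr, cols, Matrix.det_fin_two_of]

theorem wr_mulVec (G : Matrix (Fin 2) (Fin 2) ℂ) (u v : Fin 2 → ℂ) :
    wr (G *ᵥ u) (G *ᵥ v) = G.det * wr u v := by
  simp only [wr_eq, Matrix.det_fin_two, Matrix.mulVec, dotProduct, Fin.sum_univ_two]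
  ring

theorem continuous_wr : Continuous fun p : (Fin 2 → ℂ) × (Fin 2 → ℂ) => wr p.1 p.2 := by
  simp only [wr, cols, Matrix.det_fin_two_of]
  fun_prop

theorem eq_smul_of_wr_eq_zero {u v : Fin 2 → ℂ} (hv : v ≠ 0) (h : wr u v = 0) :
    ∃ c : ℂ, u = c • v := by
  simp only [wr, cols, Matrix.det_fin_two_of] at h
  by_cases h0 : v 0 = 0
  · have h1 : v 1 ≠ 0 := fun h1 => hv (by ext i; fin_cases i <;> simp [h0, h1])
    refine ⟨u 1 / v 1, ?_⟩
    ext i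
    fin_cases i
    · have : u 0 * v 1 = 0 := by simpa [h0] using h
      simp [h0, (mul_eq_zero.1 this).resolve_right h1]
    · simp [h1]
  · refine ⟨u 0 / v 0, ?_⟩
    ext i
    fin_cases i
    · simp [h0]
    · simp only [Fin.mk_one, Fin.isValue, Pi.smul_apply, smul_eq_mul]
      field_simp
      linear_combination -h

theorem wr_const {t : ℝ} {k : ℂ} {φ ψ : ℝ → Fin 2 → ℂ}
    (hφ : ∀ x, HasDerivAt φ (laxX q x t k *ᵥ φ x) x)
    (hψ : ∀ x, HasDerivAt ψ (laxX q x t k *ᵥ ψ x) x) (x y : ℝ) :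
    wr (φ x) (ψ x) = wr (φ y) (ψ y) := by
  have hd := fun x => hasDerivAt_det_cols (laxX_trace x t k) (hφ x) (hψ x)
  exact is_const_of_deriv_eq_zero (fun x => (hd x).differentiableAt) (fun x => (hd x).deriv) x y

theorem norm_exp_theta (j : Fin 2) (x t : ℝ) (k : ℂ) :
    ‖Complex.exp (2 * (sgn j * Complex.I * theta x t k))‖ =
      Real.exp (-(4 * ((sgn j).re * (k.re * k.im) * x)) + 4 * (sgn j).re * t * (k ^ 4).im) := by
  rw [Complex.norm_exp]
  congr 1
  have e : theta x t k = k ^ 2 * (x : ℝ) - k ^ 4 * ((2 * t : ℝ) : ℂ) := by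
    simp only [theta]; push_cast; ring
  have him : (theta x t k).im = 2 * (k.re * k.im) * x - (k ^ 4).im * (2 * t) := by
    rw [e, Complex.sub_im, Complex.im_mul_ofReal, Complex.im_mul_ofReal, im_sq]
  have hs : sgn j = ((sgn j).re : ℂ) := by fin_cases j <;> simp [sgn]
  have e2 : 2 * (sgn j * Complex.I * theta x t k)
      = ((2 * (sgn j).re : ℝ) : ℂ) * (Complex.I * theta x t k) := by
    rw [hs]; push_cast; simp only [Complex.ofReal_re]; ring
  rw [e2, Complex.re_ofReal_mul, Complex.I_mul_re, him]
  ring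

/-- The Wronskian of the difference with `φ` is constant in `x`. It equals the bounded factor
`e^{2σiθ}` times a Wronskian of normalised columns that tends to zero along `l`, so it vanishes. The
difference is then a constant multiple of `φ`, and the normalisation forces the constant to be zero.
-/
theorem jostColumn_unique (hq : IsSolutionZBC q) {l : Filter ℝ} [l.NeBot] {j : Fin 2} {t : ℝ}
    {k : ℂ} (hadm : Admissible l j k) {φ ψ : ℝ → Fin 2 → ℂ} (hφ : IsJostColumn q l j t k φ)
    (hψ : IsJostColumn q l j t k ψ) : ψ = φ := by
  set e : ℝ → ℂ := fun x => Complex.exp (-(sgn j * Complex.I * theta x t k)) with he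
  have hd : ∀ x, HasDerivAt (fun x => ψ x - φ x) (laxX q x t k *ᵥ (ψ x - φ x)) x := fun x => by
    rw [Matrix.mulVec_sub]
    exact (hψ.1 x).fun_sub (hφ.1 x)
  have hdl : Tendsto (fun x => e x • (ψ x - φ x)) l (𝓝 0) := by
    have := hψ.2.sub hφ.2
    simpa only [smul_sub, sub_self] using this
  have hW : wr (ψ 0 - φ 0) (φ 0) = 0 := by
    have h1 : Tendsto (fun x => wr (e x • (ψ x - φ x)) (e x • φ x)) l (𝓝 0) := by
      have := (continuous_wr.tendsto (0, Pi.single j 1)).comp (hdl.prodMk_nhds hφ.2)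
      simpa [wr, cols, Matrix.det_fin_two_of, Function.comp_def] using this
    have h2 : ∀ x, ‖wr (ψ 0 - φ 0) (φ 0)‖
        = ‖Complex.exp (2 * (sgn j * Complex.I * theta x t k))‖
          * ‖wr (e x • (ψ x - φ x)) (e x • φ x)‖ := by
      intro x
      rw [← norm_mul, wr_smul_smul, wr_const hd hφ.1 0 x, ← mul_assoc]
      simp only [he]
      rw [← Complex.exp_add, ← Complex.exp_add]
      have : 2 * (sgn j * Complex.I * theta x t k) + (-(sgn j * Complex.I * theta x t k)
        + -(sgn j * Complex.I * theta x t k)) = 0 := by ring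
      rw [this, Complex.exp_zero, one_mul]
    have h3 : Tendsto (fun x => Real.exp (4 * (sgn j).re * t * (k ^ 4).im)
        * ‖wr (e x • (ψ x - φ x)) (e x • φ x)‖) l (𝓝 0) := by
      simpa using h1.norm.const_mul (Real.exp (4 * (sgn j).re * t * (k ^ 4).im))
    have h4 : ‖wr (ψ 0 - φ 0) (φ 0)‖ ≤ 0 := by
      refine ge_of_tendsto h3 ?_
      filter_upwards [hadm] with x hx
      rw [h2 x, norm_exp_theta]
      gcongr
      linarith
    exact norm_le_zero_iff.1 h4
  have hex : ∃ x₁, φ x₁ ≠ 0 := by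
    by_contra! h
    have : Tendsto (fun x => e x • φ x) l (𝓝 0) := by
      simp only [h, smul_zero]
      exact tendsto_const_nhds
    have := congrFun (tendsto_nhds_unique hφ.2 this) j
    simp at this
  obtain ⟨x₁, hx₁⟩ := hex
  obtain ⟨c, hc⟩ := eq_smul_of_wr_eq_zero hx₁
    ((wr_const hd hφ.1 x₁ 0).trans hW)
  have hall : (fun x => ψ x - φ x) = fun x => c • φ x := by
    refine laxX_unique hq hd (fun x => ?_) hc
    rw [Matrix.mulVec_smul]
    exact (hφ.1 x).const_smul c
  have hlim : Tendsto (fun x => e x • (ψ x - φ x)) l (𝓝 (c • Pi.single j 1)) := by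
    have := hφ.2.const_smul c
    refine this.congr fun x => ?_
    rw [congrFun hall x, smul_comm]
  have hc0 : c = 0 := by
    have := congrFun (tendsto_nhds_unique hlim hdl) j
    simpa using this
  funext x
  have := congrFun hall x
  simp only [hc0, zero_smul] at this
  exact sub_eq_zero.1 this

/-- The Jost solution is defined by choice; existence and uniqueness identify it with any explicit
column having the defining properties. -/
theorem phiPlus_eq (hq : IsSolutionZBC q) {j : Fin 2} {t : ℝ} {k : ℂ}
    (hadm : Admissible atTop j k) {φ : ℝ → Fin 2 → ℂ} (hφ : IsJostColumn q atTop j t k φ)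
    (x : ℝ) : phiPlus q j x t k = φ x :=
  congrFun (jostColumn_unique hq hadm hφ (Classical.epsilon_spec ⟨φ, hφ⟩)) x

theorem phiMinus_eq (hq : IsSolutionZBC q) {j : Fin 2} {t : ℝ} {k : ℂ}
    (hadm : Admissible atBot j k) {φ : ℝ → Fin 2 → ℂ} (hφ : IsJostColumn q atBot j t k φ)
    (x : ℝ) : phiMinus q j x t k = φ x :=
  congrFun (jostColumn_unique hq hadm hφ (Classical.epsilon_spec ⟨φ, hφ⟩)) x

theorem conj_mem_DplusC {k : ℂ} (hk : k ∈ DminusC) : conj k ∈ DplusC := by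
  have : k.re * k.im ≤ 0 := hk
  simpa [DplusC] using this

theorem conj_mem_DminusC {k : ℂ} (hk : k ∈ DplusC) : conj k ∈ DminusC := by
  have : 0 ≤ k.re * k.im := hk
  simpa [DminusC] using this

theorem isJostColumn_plus_one (hq : IsSolutionZBC q) (t : ℝ) {k : ℂ} (hk : k ∈ DminusC) :
    IsJostColumn q atTop 1 t k (fun x => conjSwap
      (Complex.exp (Complex.I * theta x t (conj k)) • jost (fun y => q y t) (conj k) x)) := by
  have := (isJostColumn_plus_zero hq t (conj_mem_DplusC hk)).conjSwap_zero
  rwa [Complex.conj_conj] at this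

theorem isJostColumn_minus_zero (hq : IsSolutionZBC q) (t : ℝ) {k : ℂ} (hk : k ∈ DminusC) :
    IsJostColumn q atBot 0 t k (fun x => -conjSwap
      (Complex.exp (-(Complex.I * theta x t (conj k))) •
        ![jost (reflect fun y => q y t) (conj k) (-x) 1,
          jost (reflect fun y => q y t) (conj k) (-x) 0])) := by
  have := (isJostColumn_minus_one hq t (conj_mem_DplusC hk)).conjSwap_one
  rwa [Complex.conj_conj] at this

theorem isJostColumn_phiPlus_zero (hq : IsSolutionZBC q) (t : ℝ) {k : ℂ} (hk : k ∈ DplusC) :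
    IsJostColumn q atTop 0 t k (fun x => phiPlus q 0 x t k) :=
  Classical.epsilon_spec ⟨_, isJostColumn_plus_zero hq t hk⟩

theorem isJostColumn_phiMinus_one (hq : IsSolutionZBC q) (t : ℝ) {k : ℂ} (hk : k ∈ DplusC) :
    IsJostColumn q atBot 1 t k (fun x => phiMinus q 1 x t k) :=
  Classical.epsilon_spec ⟨_, isJostColumn_minus_one hq t hk⟩

theorem isJostColumn_phiPlus_one (hq : IsSolutionZBC q) (t : ℝ) {k : ℂ} (hk : k ∈ DminusC) :
    IsJostColumn q atTop 1 t k (fun x => phiPlus q 1 x t k) :=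
  Classical.epsilon_spec ⟨_, isJostColumn_plus_one hq t hk⟩

theorem isJostColumn_phiMinus_zero (hq : IsSolutionZBC q) (t : ℝ) {k : ℂ} (hk : k ∈ DminusC) :
    IsJostColumn q atBot 0 t k (fun x => phiMinus q 0 x t k) :=
  Classical.epsilon_spec ⟨_, isJostColumn_minus_zero hq t hk⟩

theorem muPlus_zero_eq (hq : IsSolutionZBC q) (x t : ℝ) {k : ℂ} (hk : k ∈ DplusC) :
    muPlus q 0 x t k = jost (fun y => q y t) k x := by
  rw [muPlus, phiPlus_eq hq (admissible_atTop_zero hk) (isJostColumn_plus_zero hq t hk),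
    smul_smul, ← Complex.exp_add]
  simp [sgn]

theorem muMinus_one_eq (hq : IsSolutionZBC q) (x t : ℝ) {k : ℂ} (hk : k ∈ DplusC) :
    muMinus q 1 x t k = ![jost (reflect fun y => q y t) k (-x) 1,
      jost (reflect fun y => q y t) k (-x) 0] := by
  rw [muMinus, phiMinus_eq hq (admissible_atBot_one hk) (isJostColumn_minus_one hq t hk),
    smul_smul, ← Complex.exp_add]
  simp [sgn]

theorem phiPlus_one_conj (hq : IsSolutionZBC q) (x t : ℝ) {k : ℂ} (hk : k ∈ DplusC) :
    phiPlus q 1 x t (conj k) = conjSwap (phiPlus q 0 x t k) :=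
  phiPlus_eq hq (admissible_atTop_one (conj_mem_DminusC hk))
    (isJostColumn_phiPlus_zero hq t hk).conjSwap_zero x

theorem phiMinus_zero_conj (hq : IsSolutionZBC q) (x t : ℝ) {k : ℂ} (hk : k ∈ DplusC) :
    phiMinus q 0 x t (conj k) = -conjSwap (phiMinus q 1 x t k) :=
  phiMinus_eq hq (admissible_atBot_zero (conj_mem_DminusC hk))
    (isJostColumn_phiMinus_one hq t hk).conjSwap_one x

theorem muPlus_one_conj (hq : IsSolutionZBC q) (x t : ℝ) {k : ℂ} (hk : k ∈ DplusC) :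
    muPlus q 1 x t (conj k) = conjSwap (muPlus q 0 x t k) := by
  rw [muPlus, muPlus, phiPlus_one_conj hq x t hk, conjSwap_smul, ← Complex.exp_conj]
  congr 2
  simp [sgn, theta_conj]

theorem muMinus_zero_conj (hq : IsSolutionZBC q) (x t : ℝ) {k : ℂ} (hk : k ∈ DplusC) :
    muMinus q 0 x t (conj k) = -conjSwap (muMinus q 1 x t k) := by
  rw [muMinus, muMinus, phiMinus_zero_conj hq x t hk, conjSwap_smul, ← Complex.exp_conj, smul_neg]
  congr 3
  simp [sgn, theta_conj]

theorem wr_conjSwap (u v : Fin 2 → ℂ) : wr (conjSwap u) (conjSwap v) = conj (wr u v) := by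
  simp [wr, cols, Matrix.det_fin_two_of, conjSwap]; ring

theorem s22_conj (hq : IsSolutionZBC q) {k : ℂ} (hk : k ∈ DplusC) :
    s22 q (conj k) = conj (s11 q k) := by
  rw [s22, s11, phiMinus_zero_conj hq 0 0 hk, phiPlus_one_conj hq 0 0 hk, ← wr_conjSwap]
  simp [wr, cols, Matrix.det_fin_two_of]; ring

/-- `X(-k) = σ₃ X(k) σ₃` carries both Jost columns to `-k`, up to signs whose product cancels in the
Wronskian. -/
theorem s11_neg (hq : IsSolutionZBC q) {k : ℂ} (hk : k ∈ DplusC) : s11 q (-k) = s11 q k := by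
  have hk' : -k ∈ DplusC := by
    have : 0 ≤ k.re * k.im := hk
    simpa [DplusC] using this
  rw [s11, s11, phiPlus_eq hq (admissible_atTop_zero hk') (isJostColumn_phiPlus_zero hq 0 hk).neg,
    phiMinus_eq hq (admissible_atBot_one hk') (isJostColumn_phiMinus_one hq 0 hk).neg]
  simp [wr, cols, Matrix.det_fin_two_of, sgn]

/-- All Jost columns evolve from `(0, 0)` to `(x, t)` by the same unimodular matrix. -/
theorem exists_phi_propagator (hq : IsSolutionZBC q) (x t : ℝ) :
    ∃ G : ℂ → Matrix (Fin 2) (Fin 2) ℂ, Continuous G ∧ (∀ k, (G k).det = 1) ∧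
      (∀ k ∈ DplusC, phiPlus q 0 x t k = G k *ᵥ phiPlus q 0 0 0 k ∧
        phiMinus q 1 x t k = G k *ᵥ phiMinus q 1 0 0 k) ∧
      ∀ k ∈ DminusC, phiPlus q 1 x t k = G k *ᵥ phiPlus q 1 0 0 k ∧
        phiMinus q 0 x t k = G k *ᵥ phiMinus q 0 0 0 k := by
  obtain ⟨G, hGc, hGd, hG⟩ := exists_lax_propagator hq x t
  refine ⟨G, hGc, hGd, fun k hk => ⟨?_, ?_⟩, fun k hk => ⟨?_, ?_⟩⟩
  · obtain ⟨ψ, h1, h2⟩ := hG atTop atTop_le_cocompact 0 k _ (isJostColumn_phiPlus_zero hq 0 hk)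
    rw [phiPlus_eq hq (admissible_atTop_zero hk) h1, h2]
  · obtain ⟨ψ, h1, h2⟩ := hG atBot atBot_le_cocompact 1 k _ (isJostColumn_phiMinus_one hq 0 hk)
    rw [phiMinus_eq hq (admissible_atBot_one hk) h1, h2]
  · obtain ⟨ψ, h1, h2⟩ := hG atTop atTop_le_cocompact 1 k _ (isJostColumn_phiPlus_one hq 0 hk)
    rw [phiPlus_eq hq (admissible_atTop_one hk) h1, h2]
  · obtain ⟨ψ, h1, h2⟩ := hG atBot atBot_le_cocompact 0 k _ (isJostColumn_phiMinus_zero hq 0 hk)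
    rw [phiMinus_eq hq (admissible_atBot_zero hk) h1, h2]

end DNLS

namespace DNLS

/-! ### Holomorphic functions with a limit at infinity -/

/-- `k → ∞` inside `S`. -/
abbrev atInf (S : Set ℂ) : Filter ℂ := Bornology.cobounded ℂ ⊓ 𝓟 S

theorem isBigO_inv_iff {S : Set ℂ} {f : ℂ → ℂ} : f =O[atInf S] (fun k => k⁻¹) ↔
    ∃ C R : ℝ, 0 < R ∧ ∀ z ∈ S, R ≤ ‖z‖ → ‖f z‖ ≤ C / ‖z‖ := by
  rw [Asymptotics.isBigO_iff]
  constructor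
  · rintro ⟨C, h⟩
    rw [eventually_inf_principal, hasBasis_cobounded_norm.eventually_iff] at h
    obtain ⟨R, -, hR⟩ := h
    refine ⟨C, max R 1, by positivity, fun z hz hzR => ?_⟩
    rw [div_eq_mul_inv, ← norm_inv]
    exact hR ((le_max_left _ _).trans hzR) hz
  · rintro ⟨C, R, -, h⟩
    refine ⟨C, ?_⟩
    rw [eventually_inf_principal]
    filter_upwards [eventually_cobounded_le_norm R] with z hz hzS
    rw [norm_inv, ← div_eq_mul_inv]
    exact h z hzS hz

theorem tendsto_inv_atInf (S : Set ℂ) : Tendsto (fun k : ℂ => k⁻¹) (atInf S) (𝓝 0) :=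
  tendsto_inv₀_cobounded.mono_left inf_le_left

/-- Functions holomorphic on `D`, continuous on `S` and equal to `L + O(1/k)`. -/
structure HolAsymp (S D : Set ℂ) (f : ℂ → ℂ) (L : ℂ) : Prop where
  cont : ContinuousOn f S
  diff : DifferentiableOn ℂ f D
  asymp : (fun k => f k - L) =O[atInf S] fun k => k⁻¹

theorem tendsto_of_isBigO_inv {S : Set ℂ} {f : ℂ → ℂ} {L : ℂ}
    (h : (fun k => f k - L) =O[atInf S] fun k => k⁻¹) : Tendsto f (atInf S) (𝓝 L) :=
  tendsto_sub_nhds_zero_iff.1 (h.trans_tendsto (tendsto_inv_atInf S))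

theorem isBigO_inv_mul {S : Set ℂ} {f g : ℂ → ℂ} {L M : ℂ}
    (hf : (fun k => f k - L) =O[atInf S] fun k => k⁻¹)
    (hg : (fun k => g k - M) =O[atInf S] fun k => k⁻¹) :
    (fun k => f k * g k - L * M) =O[atInf S] fun k => k⁻¹ := by
  have h1 : (fun k => (f k - L) * g k) =O[atInf S] fun k => k⁻¹ * (1 : ℂ) :=
    hf.mul ((tendsto_of_isBigO_inv hg).isBigO_one ℂ)
  have h2 := h1.add ((hg.const_mul_left L).congr_right fun k => (mul_one k⁻¹).symm)
  refine h2.congr (fun k => ?_) fun k => mul_one _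
  ring

theorem isBigO_inv_inv {S : Set ℂ} {f : ℂ → ℂ} {L : ℂ} (hL : L ≠ 0)
    (hf : (fun k => f k - L) =O[atInf S] fun k => k⁻¹) :
    (fun k => (f k)⁻¹ - L⁻¹) =O[atInf S] fun k => k⁻¹ := by
  have hl := tendsto_of_isBigO_inv hf
  have h1 : (fun k => (f k - L) * ((f k)⁻¹ * -L⁻¹)) =O[atInf S] fun k => k⁻¹ * (1 : ℂ) :=
    hf.mul (((hl.inv₀ hL).mul_const (-L⁻¹)).isBigO_one ℂ)
  refine h1.congr' ?_ (Eventually.of_forall fun k => mul_one _)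
  filter_upwards [hl.eventually_ne hL] with k hk
  field_simp
  ring

theorem HolAsymp.congr {S D : Set ℂ} {f g : ℂ → ℂ} {L : ℂ} (h : HolAsymp S D f L) (hD : D ⊆ S)
    (hfg : ∀ k ∈ S, g k = f k) : HolAsymp S D g L where
  cont := h.cont.congr hfg
  diff := h.diff.congr fun k hk => hfg k (hD hk)
  asymp := by
    refine h.asymp.congr' ?_ EventuallyEq.rfl
    filter_upwards [mem_inf_of_right (mem_principal_self S)] with k hk
    rw [hfg k hk]

theorem HolAsymp.mul {S D : Set ℂ} {f g : ℂ → ℂ} {L M : ℂ} (hf : HolAsymp S D f L)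
    (hg : HolAsymp S D g M) : HolAsymp S D (fun k => f k * g k) (L * M) :=
  ⟨hf.cont.mul hg.cont, hf.diff.fun_mul hg.diff, isBigO_inv_mul hf.asymp hg.asymp⟩

theorem HolAsymp.sub {S D : Set ℂ} {f g : ℂ → ℂ} {L M : ℂ} (hf : HolAsymp S D f L)
    (hg : HolAsymp S D g M) : HolAsymp S D (fun k => f k - g k) (L - M) :=
  ⟨hf.cont.sub hg.cont, hf.diff.fun_sub hg.diff,
    (hf.asymp.sub hg.asymp).congr_left fun k => by ring⟩

theorem HolAsymp.neg {S D : Set ℂ} {f : ℂ → ℂ} {L : ℂ} (hf : HolAsymp S D f L) :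
    HolAsymp S D (fun k => -f k) (-L) :=
  ⟨hf.cont.neg, hf.diff.fun_neg, hf.asymp.neg_left.congr_left fun k => by ring⟩

theorem Dplus_subset : Dplus ⊆ DplusC := fun k (hk : 0 < k.re * k.im) => hk.le

theorem Dminus_subset : Dminus ⊆ DminusC := fun k (hk : k.re * k.im < 0) => hk.le

theorem conj_mem_Dplus {k : ℂ} (hk : k ∈ Dminus) : conj k ∈ Dplus := by
  have : k.re * k.im < 0 := hk
  simpa [Dplus] using this

theorem conj_mem_Dminus {k : ℂ} (hk : k ∈ Dplus) : conj k ∈ Dminus := by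
  have : 0 < k.re * k.im := hk
  simpa [Dminus] using this

theorem HolAsymp.conj_conj {f : ℂ → ℂ} {L : ℂ} (h : HolAsymp DplusC Dplus f L) :
    HolAsymp DminusC Dminus (fun k => conj (f (conj k))) (conj L) where
  cont := Complex.continuous_conj.comp_continuousOn
    (h.cont.comp Complex.continuous_conj.continuousOn fun _ => conj_mem_DplusC)
  diff k hk := by
    have h1 := (h.diff.differentiableAt (isOpen_Dplus.mem_nhds (conj_mem_Dplus hk))).conj_conj
    rw [Complex.conj_conj] at h1
    exact h1.differentiableWithinAt
  asymp := by
    obtain ⟨C, R, hR, hb⟩ := isBigO_inv_iff.1 h.asymp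
    refine isBigO_inv_iff.2 ⟨C, R, hR, fun z hz hzR => ?_⟩
    have := hb (conj z) (conj_mem_DplusC hz) (by rwa [Complex.norm_conj])
    rwa [← map_sub, Complex.norm_conj, ← Complex.norm_conj z]

/-! ### Analyticity and asymptotics of the Jost columns -/

variable {q : ℝ → ℝ → ℂ}

theorem jost_zero_holAsymp {p : ℝ → ℂ} (hp : Potential p) (x : ℝ) :
    HolAsymp DplusC Dplus (fun k => jost p k x 0) (jostLimit p x) where
  cont := continuousOn_pi.1 (continuousOn_jost hp x) 0
  diff := differentiableOn_pi.1 (differentiableOn_jost hp x) 0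
  asymp := by
    obtain ⟨C, -, h⟩ := jost_asymptotics hp x
    exact isBigO_inv_iff.2 ⟨C, 1, one_pos, fun k hk h1 => (h k hk h1).1⟩

theorem jost_one_holAsymp {p : ℝ → ℂ} (hp : Potential p) (x : ℝ) :
    HolAsymp DplusC Dplus (fun k => jost p k x 1) 0 where
  cont := continuousOn_pi.1 (continuousOn_jost hp x) 1
  diff := differentiableOn_pi.1 (differentiableOn_jost hp x) 1
  asymp := by
    obtain ⟨C, -, h⟩ := jost_asymptotics hp x
    refine isBigO_inv_iff.2 ⟨C, 1, one_pos, fun k hk h1 => ?_⟩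
    rw [sub_zero]
    exact (h k hk h1).2

/-- The tail of the reflected potential beyond `-x` is the integral of `|q|²` over `(-∞, x]`; this
is where `v₋` enters. -/
theorem jostLimit_reflect (q : ℝ → ℝ → ℂ) (x t : ℝ) :
    jostLimit (reflect fun y => q y t) (-x) = Complex.exp (-(Complex.I * vMinus q x t)) := by
  have h : tail (fun y => ‖reflect (fun y => q y t) y‖ ^ 2) (-x)
      = ∫ y in Set.Iic x, ‖q y t‖ ^ 2 := by
    have := integral_comp_neg_Ioi (-x) fun y => ‖q y t‖ ^ 2
    rw [neg_neg] at this
    rw [← this, tail]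
    simp only [reflect, Complex.norm_conj]
  rw [jostLimit, h, vMinus]

theorem jostLimit_ne_zero (p : ℝ → ℂ) (x : ℝ) : jostLimit p x ≠ 0 := Complex.exp_ne_zero _

theorem muPlus_zero_holAsymp (hq : IsSolutionZBC q) (x t : ℝ) (i : Fin 2) :
    HolAsymp DplusC Dplus (fun k => muPlus q 0 x t k i)
      (![jostLimit (fun y => q y t) x, 0] i) := by
  have hp := hq.potential t
  fin_cases i
  · exact (jost_zero_holAsymp hp x).congr Dplus_subset fun k hk =>
      congrFun (muPlus_zero_eq hq x t hk) 0
  · exact (jost_one_holAsymp hp x).congr Dplus_subset fun k hk =>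
      congrFun (muPlus_zero_eq hq x t hk) 1

theorem muMinus_one_holAsymp (hq : IsSolutionZBC q) (x t : ℝ) (i : Fin 2) :
    HolAsymp DplusC Dplus (fun k => muMinus q 1 x t k i)
      (![0, Complex.exp (-(Complex.I * vMinus q x t))] i) := by
  have hp := (hq.potential t).reflect
  rw [← jostLimit_reflect]
  fin_cases i
  · exact (jost_one_holAsymp hp (-x)).congr Dplus_subset fun k hk =>
      congrFun (muMinus_one_eq hq x t hk) 0
  · exact (jost_zero_holAsymp hp (-x)).congr Dplus_subset fun k hk =>
      congrFun (muMinus_one_eq hq x t hk) 1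

theorem muPlus_one_eq (hq : IsSolutionZBC q) (x t : ℝ) {k : ℂ} (hk : k ∈ DminusC) :
    muPlus q 1 x t k = conjSwap (muPlus q 0 x t (conj k)) := by
  rw [← muPlus_one_conj hq x t (conj_mem_DplusC hk), Complex.conj_conj]

theorem muMinus_zero_eq (hq : IsSolutionZBC q) (x t : ℝ) {k : ℂ} (hk : k ∈ DminusC) :
    muMinus q 0 x t k = -conjSwap (muMinus q 1 x t (conj k)) := by
  rw [← muMinus_zero_conj hq x t (conj_mem_DplusC hk), Complex.conj_conj]

theorem s22_eq (hq : IsSolutionZBC q) {k : ℂ} (hk : k ∈ DminusC) :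
    s22 q k = conj (s11 q (conj k)) := by
  rw [← s22_conj hq (conj_mem_DplusC hk), Complex.conj_conj]

theorem muPlus_one_holAsymp (hq : IsSolutionZBC q) (x t : ℝ) (i : Fin 2) :
    HolAsymp DminusC Dminus (fun k => muPlus q 1 x t k i)
      (![0, conj (jostLimit (fun y => q y t) x)] i) := by
  fin_cases i
  · have := (muPlus_zero_holAsymp hq x t 1).conj_conj.neg.congr Dminus_subset fun k hk =>
      congrFun (muPlus_one_eq hq x t hk) 0
    simpa using this
  · exact (muPlus_zero_holAsymp hq x t 0).conj_conj.congr Dminus_subset fun k hk =>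
      congrFun (muPlus_one_eq hq x t hk) 1

theorem muMinus_zero_holAsymp (hq : IsSolutionZBC q) (x t : ℝ) (i : Fin 2) :
    HolAsymp DminusC Dminus (fun k => muMinus q 0 x t k i)
      (![Complex.exp (Complex.I * vMinus q x t), 0] i) := by
  fin_cases i
  · have := (muMinus_one_holAsymp hq x t 1).conj_conj.congr Dminus_subset fun k hk =>
      (congrFun (muMinus_zero_eq hq x t hk) 0).trans (neg_neg _)
    simpa [← Complex.exp_conj] using this
  · have := (muMinus_one_holAsymp hq x t 0).conj_conj.neg.congr Dminus_subset fun k hk =>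
      congrFun (muMinus_zero_eq hq x t hk) 1
    simpa using this

/-! ### Scattering data at `(x, t)` -/

theorem exp_smul_mu (j : Fin 2) (x t : ℝ) (k : ℂ) (φ : Fin 2 → ℂ) :
    Complex.exp (sgn j * Complex.I * theta x t k) •
      (Complex.exp (-(sgn j * Complex.I * theta x t k)) • φ) = φ := by
  rw [smul_smul, ← Complex.exp_add, add_neg_cancel, Complex.exp_zero, one_smul]

theorem phiPlus_eq_mu (q : ℝ → ℝ → ℂ) (j : Fin 2) (x t : ℝ) (k : ℂ) :
    phiPlus q j x t k = Complex.exp (sgn j * Complex.I * theta x t k) • muPlus q j x t k :=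
  (exp_smul_mu j x t k _).symm

theorem phiMinus_eq_mu (q : ℝ → ℝ → ℂ) (j : Fin 2) (x t : ℝ) (k : ℂ) :
    phiMinus q j x t k = Complex.exp (sgn j * Complex.I * theta x t k) • muMinus q j x t k :=
  (exp_smul_mu j x t k _).symm

/-- The propagator has determinant one, so the Wronskian at `(x,t)` equals the one at `(0,0)`, and
the opposite phases of the two columns cancel. -/
theorem s11_eq_wr (hq : IsSolutionZBC q) (x t : ℝ) {k : ℂ} (hk : k ∈ DplusC) :
    s11 q k = wr (muPlus q 0 x t k) (muMinus q 1 x t k) := by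
  obtain ⟨G, -, hd, hG, -⟩ := exists_phi_propagator hq x t
  have h : wr (phiPlus q 0 x t k) (phiMinus q 1 x t k) = s11 q k := by
    rw [(hG k hk).1, (hG k hk).2, wr_mulVec, hd, one_mul, s11]
  rw [← h, phiPlus_eq_mu, phiMinus_eq_mu, wr_smul_smul, ← Complex.exp_add]
  simp [sgn]

theorem s22_eq_wr (hq : IsSolutionZBC q) (x t : ℝ) {k : ℂ} (hk : k ∈ DminusC) :
    s22 q k = wr (muMinus q 0 x t k) (muPlus q 1 x t k) := by
  obtain ⟨G, -, hd, -, hG⟩ := exists_phi_propagator hq x t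
  have h : wr (phiMinus q 0 x t k) (phiPlus q 1 x t k) = s22 q k := by
    rw [(hG k hk).1, (hG k hk).2, wr_mulVec, hd, one_mul, s22]
  rw [← h, phiPlus_eq_mu, phiMinus_eq_mu, wr_smul_smul, ← Complex.exp_add]
  simp [sgn]

/-- Here both columns carry the same phase, which survives squared; this is the source of the
exponentials in `J`. -/
theorem s12_eq_wr (hq : IsSolutionZBC q) (x t : ℝ) {k : ℂ} (hk : k ∈ Sig) :
    s12 q k = Complex.exp (-(2 * Complex.I * theta x t k)) *
      wr (muPlus q 1 x t k) (muMinus q 1 x t k) := by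
  obtain ⟨G, -, hd, hG, hG'⟩ := exists_phi_propagator hq x t
  have h : wr (phiPlus q 1 x t k) (phiMinus q 1 x t k) = s12 q k := by
    rw [(hG k (mem_DplusC_of_Sig hk)).2, (hG' k (mem_DminusC_of_Sig hk)).1, wr_mulVec, hd,
      one_mul, s12]
  rw [← h, phiPlus_eq_mu, phiMinus_eq_mu, wr_smul_smul, ← Complex.exp_add]
  congr 2
  simp [sgn]; ring

theorem s21_eq_wr (hq : IsSolutionZBC q) (x t : ℝ) {k : ℂ} (hk : k ∈ Sig) :
    s21 q k = Complex.exp (2 * Complex.I * theta x t k) *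
      wr (muMinus q 0 x t k) (muPlus q 0 x t k) := by
  obtain ⟨G, -, hd, hG, hG'⟩ := exists_phi_propagator hq x t
  have h : wr (phiMinus q 0 x t k) (phiPlus q 0 x t k) = s21 q k := by
    rw [(hG k (mem_DplusC_of_Sig hk)).1, (hG' k (mem_DminusC_of_Sig hk)).2, wr_mulVec, hd,
      one_mul, s21]
  rw [← h, phiPlus_eq_mu, phiMinus_eq_mu, wr_smul_smul, ← Complex.exp_add]
  congr 2
  simp [sgn]; ring

/-- The Wronskian does not depend on `x` and tends to `det I = 1` at `-∞`. -/
theorem wr_muMinus (hq : IsSolutionZBC q) (x t : ℝ) {k : ℂ} (hk : k ∈ Sig) :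
    wr (muMinus q 0 x t k) (muMinus q 1 x t k) = 1 := by
  have h0 := isJostColumn_phiMinus_zero hq t (mem_DminusC_of_Sig hk)
  have h1 := isJostColumn_phiMinus_one hq t (mem_DplusC_of_Sig hk)
  have he : ∀ y, wr (muMinus q 0 y t k) (muMinus q 1 y t k)
      = wr (phiMinus q 0 x t k) (phiMinus q 1 x t k) := fun y => by
    rw [muMinus, muMinus, wr_smul_smul, ← Complex.exp_add, wr_const h0.1 h1.1 y x]
    simp [sgn]
  have hl := (continuous_wr.tendsto (Pi.single 0 1, Pi.single 1 1)).comp (h0.2.prodMk_nhds h1.2)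
  have hl' : Tendsto (fun y => wr (muMinus q 0 y t k) (muMinus q 1 y t k)) atBot (𝓝 1) := by
    refine hl.trans_eq ?_
    simp [wr_eq]
  simp only [he] at hl' ⊢
  exact tendsto_nhds_unique tendsto_const_nhds hl'

theorem s11_holAsymp (hq : IsSolutionZBC q) (x t : ℝ) :
    HolAsymp DplusC Dplus (s11 q)
      (jostLimit (fun y => q y t) x * Complex.exp (-(Complex.I * vMinus q x t))) := by
  have h := ((muPlus_zero_holAsymp hq x t 0).mul (muMinus_one_holAsymp hq x t 1)).sub
    ((muMinus_one_holAsymp hq x t 0).mul (muPlus_zero_holAsymp hq x t 1))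
  simpa using h.congr Dplus_subset fun k hk => (s11_eq_wr hq x t hk).trans (wr_eq _ _)

theorem s22_holAsymp (hq : IsSolutionZBC q) (x t : ℝ) :
    HolAsymp DminusC Dminus (s22 q)
      (conj (jostLimit (fun y => q y t) x) * Complex.exp (Complex.I * vMinus q x t)) := by
  have h := (s11_holAsymp hq x t).conj_conj.congr Dminus_subset fun k hk => s22_eq hq hk
  simpa [← Complex.exp_conj] using h

/-! ### The jump -/

/-- Cramer's rule in a basis of determinant one. -/
theorem mulVec_jump {A B C D : Fin 2 → ℂ} (h : wr C D = 1) :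
    A = wr A D • C + wr C A • D ∧ B = wr B D • C + wr C B • D := by
  have key : ∀ A : Fin 2 → ℂ, A = wr A D • C + wr C A • D := fun A => by
    rw [wr_eq] at h
    ext i
    fin_cases i <;> simp [wr_eq]
    · linear_combination (-(A 0)) * h
    · linear_combination (-(A 1)) * h
  exact ⟨key A, key B⟩

theorem rhpJ_eq (q : ℝ → ℝ → ℂ) (x t : ℝ) (k : ℂ) :
    rhpJ q x t k = !![0, -(rhoTilde q k * Complex.exp (2 * Complex.I * theta x t k));
      rho q k * Complex.exp (-(2 * Complex.I * theta x t k)), rho q k * rhoTilde q k] := by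
  have e1 : Complex.exp (2 * Complex.I * theta x t k)
      = Complex.exp (Complex.I * theta x t k) * Complex.exp (Complex.I * theta x t k) := by
    rw [← Complex.exp_add]; congr 1; ring
  have e2 : Complex.exp (-(2 * Complex.I * theta x t k))
      = Complex.exp (-(Complex.I * theta x t k)) * Complex.exp (-(Complex.I * theta x t k)) := by
    rw [← Complex.exp_add]; congr 1; ring
  have e3 : Complex.exp (-(Complex.I * theta x t k)) * Complex.exp (Complex.I * theta x t k)
      = 1 := by
    rw [← Complex.exp_add, neg_add_cancel, Complex.exp_zero]
  rw [e1, e2]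
  ext i j
  fin_cases i <;> fin_cases j <;>
    simp [rhpJ, expSigma, Matrix.mul_apply, Matrix.diagonal]
  · ring
  · ring
  · linear_combination (rho q k * rhoTilde q k) * e3

/-- On `Σ`, expand both columns at `+∞` in the unimodular basis `μ₋₁, μ₋₂`; the coefficients are the
scattering data with their phases. Solving for the columns of `M⁻` in terms of those of `M⁺` gives
the jump, the phases of `s₁₂` and `s₂₁` cancelling in `ρρ̃`. -/
theorem mMinus_eq (hq : IsSolutionZBC q) (hsing : NoSpectralSingularity q) (x t : ℝ) {k : ℂ}
    (hk : k ∈ Sig) : mMinus q x t k = mPlus q x t k * (1 - rhpJ q x t k) := by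
  obtain ⟨hs1, hs2⟩ := hsing k hk
  obtain ⟨hA, hB⟩ := mulVec_jump (A := muPlus q 0 x t k) (B := muPlus q 1 x t k)
    (wr_muMinus hq x t hk)
  have h12 := s12_eq_wr hq x t hk
  have h21 := s21_eq_wr hq x t hk
  rw [← s11_eq_wr hq x t (mem_DplusC_of_Sig hk)] at hA
  rw [← s22_eq_wr hq x t (mem_DminusC_of_Sig hk)] at hB
  have e3 : Complex.exp (-(2 * Complex.I * theta x t k)) * Complex.exp (2 * Complex.I * theta x t k)
      = 1 := by
    rw [← Complex.exp_add, neg_add_cancel, Complex.exp_zero]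
  have w12 : wr (muPlus q 1 x t k) (muMinus q 1 x t k)
      = Complex.exp (2 * Complex.I * theta x t k) * s12 q k := by
    rw [h12, ← mul_assoc, mul_comm (Complex.exp (2 * Complex.I * theta x t k)), e3, one_mul]
  have w21 : wr (muMinus q 0 x t k) (muPlus q 0 x t k)
      = Complex.exp (-(2 * Complex.I * theta x t k)) * s21 q k := by
    rw [h21, ← mul_assoc, e3, one_mul]
  rw [w21] at hA
  rw [w12] at hB
  rw [rhpJ_eq, rho, rhoTilde, Matrix.one_fin_two]
  generalize Complex.exp (-(2 * Complex.I * theta x t k)) = e at *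
  generalize Complex.exp (2 * Complex.I * theta x t k) = f at *
  have first : ∀ i, muMinus q 0 x t k i = (s11 q k)⁻¹ * muPlus q 0 x t k i
      - muMinus q 1 x t k i * (s21 q k / s11 q k * e) := fun i => by
    have := congrFun hA i
    simp only [Pi.add_apply, Pi.smul_apply, smul_eq_mul] at this
    rw [this]
    field_simp
    ring
  have second : ∀ i, (s22 q k)⁻¹ * muPlus q 1 x t k i
      = (s11 q k)⁻¹ * muPlus q 0 x t k i * (s12 q k / s22 q k * f)
        + muMinus q 1 x t k i * (1 - s21 q k / s11 q k * (s12 q k / s22 q k)) := fun i => by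
    have h1 := congrFun hA i
    have h2 := congrFun hB i
    simp only [Pi.add_apply, Pi.smul_apply, smul_eq_mul] at h1 h2
    rw [h1, h2]
    field_simp
    linear_combination (-(muMinus q 1 x t k i * s21 q k * s12 q k)) * e3
  ext i j
  fin_cases j
  · simp only [mMinus, mPlus, cols, Matrix.mul_apply, Fin.sum_univ_two, Matrix.sub_apply]
    have := first i
    fin_cases i <;> simp at this ⊢ <;> rw [this] <;> ring
  · simp only [mMinus, mPlus, cols, Matrix.mul_apply, Fin.sum_univ_two, Matrix.sub_apply]
    have := second i
    fin_cases i <;> simp at this ⊢ <;> rw [this]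

end DNLS

namespace DNLS

/-! ### Double zeros and double poles -/

/-- The quotient is the divided difference `dslope`, for which the factorisation holds at every `z`,
not only near `η`. -/
theorem exists_eq_sub_mul {f : ℂ → ℂ} {η : ℂ} (hf : AnalyticAt ℂ f η) (h0 : f η = 0) :
    ∃ g : ℂ → ℂ, AnalyticAt ℂ g η ∧ ∀ z, f z = (z - η) * g z := by
  obtain ⟨p, hp⟩ := hf
  refine ⟨dslope f η, ⟨_, hp.has_fpower_series_dslope_fslope⟩, fun z => ?_⟩
  have := sub_smul_dslope f η z
  rw [h0, sub_zero] at this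
  exact this.symm

/-- In Leibniz' rule at `η` only the term with exactly one derivative on the linear factor survives.
-/
theorem iteratedDeriv_succ_sub_mul {g : ℂ → ℂ} {η : ℂ} (hg : AnalyticAt ℂ g η) (n : ℕ) :
    iteratedDeriv (n + 1) (fun z => (z - η) * g z) η = (n + 1) * iteratedDeriv n g η := by
  have hd : deriv (fun z => (z - η) * g z) =ᶠ[𝓝 η] fun z => g z + (z - η) * deriv g z := by
    filter_upwards [hg.eventually_analyticAt] with z hz
    have := ((hasDerivAt_id' z).sub_const η).fun_mul hz.differentiableAt.hasDerivAt
    rw [this.deriv, one_mul]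
  induction n generalizing g with
  | zero => simp [iteratedDeriv_one, hd.eq_of_nhds]
  | succ n ih =>
    have hd' : deriv (fun z => (z - η) * deriv g z)
        =ᶠ[𝓝 η] fun z => deriv g z + (z - η) * deriv (deriv g) z := by
      filter_upwards [hg.deriv.eventually_analyticAt] with z hz
      have := ((hasDerivAt_id' z).sub_const η).fun_mul hz.differentiableAt.hasDerivAt
      rw [this.deriv, one_mul]
    have h2 : AnalyticAt ℂ (fun z => (z - η) * deriv g z) η := by
      have := hg.deriv
      fun_prop
    rw [iteratedDeriv_succ', hd.iteratedDeriv_eq, iteratedDeriv_fun_add hg.contDiffAt h2.contDiffAt,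
      ih hg.deriv hd', ← iteratedDeriv_succ']
    push_cast
    ring

/-- Factorisation at a double zero. -/
theorem exists_eq_sub_sq_mul {f : ℂ → ℂ} {η : ℂ} (hf : AnalyticAt ℂ f η) (h0 : f η = 0)
    (h1 : deriv f η = 0) : ∃ u : ℂ → ℂ, AnalyticAt ℂ u η ∧ (∀ z, f z = (z - η) ^ 2 * u z) ∧
      iteratedDeriv 2 f η = 2 * u η ∧ iteratedDeriv 3 f η = 6 * deriv u η := by
  obtain ⟨g, hg, hfg⟩ := exists_eq_sub_mul hf h0
  obtain rfl : f = fun z => (z - η) * g z := funext hfg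
  have hg0 : g η = 0 := by
    have := iteratedDeriv_succ_sub_mul hg 0
    rw [zero_add, iteratedDeriv_one, h1] at this
    simpa using this.symm
  obtain ⟨u, hu, hgu⟩ := exists_eq_sub_mul hg hg0
  have e1 := iteratedDeriv_succ_sub_mul hg 1
  have e2 := iteratedDeriv_succ_sub_mul hg 2
  obtain rfl : g = fun z => (z - η) * u z := funext hgu
  have e3 : iteratedDeriv 1 (fun z => (z - η) * u z) η = _ := iteratedDeriv_succ_sub_mul hu 0
  have e4 := iteratedDeriv_succ_sub_mul hu 1
  refine ⟨u, hu, fun z => by ring, ?_, ?_⟩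
  · rw [e1, e3, iteratedDeriv_zero]
    push_cast
    ring
  · rw [e2, e4, iteratedDeriv_one]
    push_cast
    ring

/-- `α / (z - η)² + β / (z - η)`. -/
def polar (α β η z : ℂ) : ℂ := α / (z - η) ^ 2 + β / (z - η)

theorem hasDerivAt_polar (α β : ℂ) {η z : ℂ} (h : z ≠ η) :
    HasDerivAt (polar α β η) (-(2 * α / (z - η) ^ 3 + β / (z - η) ^ 2)) z := by
  have h0 : z - η ≠ 0 := sub_ne_zero.2 h
  have hs := (hasDerivAt_id' z).sub_const η
  have h1 := ((hs.fun_pow 2).fun_inv (pow_ne_zero 2 h0)).const_mul α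
  have h2 := (hs.fun_inv h0).const_mul β
  refine (h1.fun_add h2).congr_deriv ?_
  field_simp
  ring

/-- The polar part of `a / s` at a double zero of `s`. -/
theorem exists_polar_part {a s : ℂ → ℂ} {η : ℂ} (ha : AnalyticAt ℂ a η) (hs : AnalyticAt ℂ s η)
    (h0 : s η = 0) (h1 : deriv s η = 0) (h2 : iteratedDeriv 2 s η ≠ 0) :
    ∃ h : ℂ → ℂ, AnalyticAt ℂ h η ∧ ∀ᶠ z in 𝓝[≠] η, (s z)⁻¹ * a z =
      polar (2 / iteratedDeriv 2 s η * a η) (2 / iteratedDeriv 2 s η *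
        (deriv a η - iteratedDeriv 3 s η / (3 * iteratedDeriv 2 s η) * a η)) η z + h z := by
  obtain ⟨u, hu, hsu, e2, e3⟩ := exists_eq_sub_sq_mul hs h0 h1
  have hu0 : u η ≠ 0 := fun h => h2 (by rw [e2, h, mul_zero])
  -- With `s = (z - η)² u`, the polar part is `w(η)/(z - η)² + w'(η)/(z - η)` for `w = a/u`. Here `g
  -- η = w'(η)`, and `u = s''/2`, `u' = s'''/6` at `η` give the ratio `s'''/(3s'')`.
  set w : ℂ → ℂ := fun z => a z / u z with hw
  have hwa : AnalyticAt ℂ w η := ha.fun_div hu hu0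
  obtain ⟨g, hg, hwg⟩ := exists_eq_sub_mul (f := fun z => w z - w η)
    (hwa.sub analyticAt_const) (sub_self _)
  obtain ⟨h, hh, hgh⟩ := exists_eq_sub_mul (f := fun z => g z - g η)
    (hg.sub analyticAt_const) (sub_self _)
  have hgη : g η = (deriv a η * u η - a η * deriv u η) / u η ^ 2 := by
    have d1 : HasDerivAt w _ η := ha.differentiableAt.hasDerivAt.fun_div
      hu.differentiableAt.hasDerivAt hu0
    have d2 : HasDerivAt (fun z => w z - w η) (g η) η := by
      have := ((hasDerivAt_id' η).sub_const η).fun_mul hg.differentiableAt.hasDerivAt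
      simp only [one_mul, sub_self, zero_mul, add_zero] at this
      exact this.congr_of_eventuallyEq (Eventually.of_forall hwg)
    exact d2.unique (d1.sub_const _)
  refine ⟨h, hh, ?_⟩
  have hne : ∀ᶠ z in 𝓝[≠] η, u z ≠ 0 :=
    (hu.continuousAt.eventually_ne hu0).filter_mono nhdsWithin_le_nhds
  filter_upwards [hne, self_mem_nhdsWithin] with z hz hzη
  have hzη' : z - η ≠ 0 := sub_ne_zero.2 hzη
  have hwz : a z = u z * (w η + (z - η) * (g η + (z - η) * h z)) := by
    have e4 := hwg z
    have e5 := hgh z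
    have : a z = u z * w z := by simp only [hw]; field_simp
    rw [this]
    linear_combination u z * e4 + u z * (z - η) * e5
  rw [hsu z, hwz, e2, e3, hgη, polar]
  simp only [hw]
  field_simp
  ring

/-- The factor `s⁻¹` has order exactly `-2`, and an analytic factor has order at least `0`, with
equality precisely when it does not vanish. -/
theorem neg_two_le_meromorphicOrderAt_div {a s : ℂ → ℂ} {η : ℂ} (ha : AnalyticAt ℂ a η)
    (hs : AnalyticAt ℂ s η) (h0 : s η = 0) (h1 : deriv s η = 0) (h2 : iteratedDeriv 2 s η ≠ 0) :
    -2 ≤ meromorphicOrderAt (fun z => (s z)⁻¹ * a z) η ∧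
      (a η ≠ 0 → meromorphicOrderAt (fun z => (s z)⁻¹ * a z) η = -2) := by
  obtain ⟨u, hu, hsu, e2, -⟩ := exists_eq_sub_sq_mul hs h0 h1
  have hu0 : u η ≠ 0 := fun h => h2 (by rw [e2, h, mul_zero])
  have hsm : MeromorphicAt (fun z => (s z)⁻¹) η := hs.meromorphicAt.fun_inv
  have ho : meromorphicOrderAt (fun z => (s z)⁻¹) η = ((-2 : ℤ) : WithTop ℤ) := by
    rw [meromorphicOrderAt_eq_int_iff hsm]
    refine ⟨fun z => (u z)⁻¹, hu.fun_inv hu0, inv_ne_zero hu0, ?_⟩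
    filter_upwards [self_mem_nhdsWithin] with z hz
    rw [hsu z, smul_eq_mul, mul_inv, _root_.zpow_neg]
    norm_cast
  have hm : meromorphicOrderAt (fun z => (s z)⁻¹ * a z) η = _ :=
    meromorphicOrderAt_mul hsm ha.meromorphicAt
  rw [hm, ho]
  refine ⟨?_, fun h => ?_⟩
  · have := add_le_add (le_refl ((-2 : ℤ) : WithTop ℤ)) ha.meromorphicOrderAt_nonneg
    simpa using this
  · rw [ha.meromorphicOrderAt_eq, ha.analyticOrderAt_eq_zero.2 h]
    simp

/-! ### Removing finitely many double poles -/

/-- Redefine `F` on the finite set `P` by its local analytic extensions. Since `P` lies in the open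
set `D`, neither the behaviour on the rest of `S` nor that at infinity is affected. -/
theorem exists_decayingHol_of_removable {S D P : Set ℂ} (hD : IsOpen D)
    (hP : P.Finite) (hPD : P ⊆ D) {F : ℂ → ℂ} (hc : ContinuousOn F (S \ P))
    (hd : DifferentiableOn ℂ F (D \ P)) (ho : F =O[atInf S] fun k => k⁻¹)
    (hr : ∀ η ∈ P, ∃ h : ℂ → ℂ, AnalyticAt ℂ h η ∧ ∀ᶠ z in 𝓝[≠] η, F z = h z) :
    ∃ g, DecayingHol S D g ∧ ∀ z, z ∉ P → g z = F z := by
  classical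
  choose! H hH hFH using hr
  set g : ℂ → ℂ := fun z => if z ∈ P then H z z else F z with hg
  have hgF : ∀ z, z ∉ P → g z = F z := fun z hz => if_neg hz
  have hPo : IsOpen Pᶜ := hP.isClosed.isOpen_compl
  have hdiff : ∀ z ∈ D, DifferentiableAt ℂ g z := by
    intro z hz
    by_cases hzP : z ∈ P
    · refine (hH z hzP).differentiableAt.congr_of_eventuallyEq ?_
      -- Near `z` no other point of `P` occurs, so the modified function agrees with the one local
      -- extension.
      have h1 : (P \ {z})ᶜ ∈ 𝓝 z :=
        (hP.subset Set.sdiff_subset).isClosed.isOpen_compl.mem_nhds (by simp)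
      filter_upwards [h1, eventually_nhdsWithin_iff.1 (hFH z hzP)] with y hy hy'
      by_cases hyz : y = z
      · rw [hyz, hg]
        exact if_pos hzP
      · rw [hgF y fun h => hy ⟨h, hyz⟩, hy' hyz]
    · have h1 : D \ P ∈ 𝓝 z := (hD.inter hPo).mem_nhds ⟨hz, hzP⟩
      refine (hd.differentiableAt h1).congr_of_eventuallyEq ?_
      filter_upwards [hPo.mem_nhds hzP] with y hy using hgF y hy
  refine ⟨g, ⟨fun z hz => ?_, fun z hz => (hdiff z hz).differentiableWithinAt, ?_⟩, hgF⟩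
  · by_cases hzP : z ∈ P
    · exact (hdiff z (hPD hzP)).continuousAt.continuousWithinAt
    · have h1 := hc z ⟨hz, hzP⟩
      rw [Set.sdiff_eq, continuousWithinAt_inter (hPo.mem_nhds hzP)] at h1
      refine h1.congr_of_eventuallyEq ?_ (hgF z hzP)
      filter_upwards [mem_nhdsWithin_of_mem_nhds (hPo.mem_nhds hzP)] with y hy using hgF y hy
  · refine isBigO_inv_iff.1 (ho.congr' ?_ EventuallyEq.rfl)
    have : Pᶜ ∈ Bornology.cobounded ℂ := hP.isBounded
    filter_upwards [mem_inf_of_left this] with y hy using (hgF y hy).symm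

theorem isBigO_polar (α β η : ℂ) (S : Set ℂ) : polar α β η =O[atInf S] fun k => k⁻¹ := by
  refine Asymptotics.IsBigO.mono ?_ inf_le_left
  have h1 : (fun z : ℂ => (z - η)⁻¹) =O[Bornology.cobounded ℂ] fun k => k⁻¹ := by
    refine Asymptotics.IsBigO.of_bound 2 ?_
    filter_upwards [eventually_cobounded_le_norm (2 * ‖η‖ + 1)] with z hz
    rw [norm_inv, norm_inv]
    have h2 : ‖z‖ - ‖η‖ ≤ ‖z - η‖ := norm_sub_norm_le z η
    have h3 := norm_nonneg η
    rw [inv_le_iff_one_le_mul₀ (by linarith), mul_assoc, ← div_eq_inv_mul]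
    rw [← div_le_iff₀' two_pos, le_div_iff₀ (by linarith)]
    linarith
  have h2 : (fun z : ℂ => (z - η)⁻¹) =O[Bornology.cobounded ℂ] fun _ => (1 : ℂ) :=
    h1.trans (tendsto_inv₀_cobounded.isBigO_one ℂ)
  have h3 := ((h1.mul h2).const_mul_left α).add
    ((h1.const_mul_left β).congr_right fun k => (mul_one k⁻¹).symm)
  refine h3.congr (fun z => ?_) fun z => mul_one _
  rw [polar, div_eq_mul_inv, div_eq_mul_inv, ← inv_pow]
  ring

variable {ι : Type*} [Fintype ι]

/-- Subtracting the limit at infinity and the polar parts leaves a decaying holomorphic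
function. -/
theorem exists_decayingHol_of_poles {S D : Set ℂ} (hD : IsOpen D) {η : ι → ℂ}
    (hη : ∀ n, η n ∈ D) (hinj : Function.Injective η) {f : ℂ → ℂ} {L : ℂ} {α β : ι → ℂ}
    (hc : ContinuousOn f (S \ Set.range η)) (hd : DifferentiableOn ℂ f (D \ Set.range η))
    (ho : (fun k => f k - L) =O[atInf S] fun k => k⁻¹)
    (hr : ∀ n, ∃ h : ℂ → ℂ, AnalyticAt ℂ h (η n) ∧
      ∀ᶠ z in 𝓝[≠] η n, f z = polar (α n) (β n) (η n) z + h z) :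
    ∃ g, DecayingHol S D g ∧
      ∀ z, z ∉ Set.range η → g z = f z - L - ∑ n, polar (α n) (β n) (η n) z := by
  classical
  have hpd : ∀ z, z ∉ Set.range η → DifferentiableAt ℂ (fun z => ∑ n, polar (α n) (β n) (η n) z) z :=
    fun z hz => DifferentiableAt.fun_sum fun n _ =>
      (hasDerivAt_polar (α n) (β n) fun h => hz ⟨n, h.symm⟩).differentiableAt
  refine exists_decayingHol_of_removable hD (Set.finite_range η) (Set.range_subset_iff.2 hη)
    ((hc.sub continuousOn_const).sub fun z hz => (hpd z hz.2).continuousAt.continuousWithinAt)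
    ((hd.sub_const L).fun_sub fun z hz => (hpd z hz.2).differentiableWithinAt)
    (ho.sub (Asymptotics.IsBigO.fun_sum fun n _ => isBigO_polar (α n) (β n) (η n) S)) ?_
  rintro _ ⟨m, rfl⟩
  obtain ⟨h, hh, hfh⟩ := hr m
  refine ⟨fun z => h z - L - ∑ n ∈ Finset.univ.erase m, polar (α n) (β n) (η n) z, ?_, ?_⟩
  · refine (hh.fun_sub analyticAt_const).fun_sub (Finset.analyticAt_fun_sum _ fun n hn => ?_)
    have hne : η m - η n ≠ 0 := sub_ne_zero.2 fun e => Finset.ne_of_mem_erase hn (hinj e).symm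
    unfold polar
    have h1 : AnalyticAt ℂ (fun z => z - η n) (η m) := by fun_prop
    exact (analyticAt_const.fun_div (h1.fun_pow 2) (pow_ne_zero 2 hne)).fun_add
      (analyticAt_const.fun_div h1 hne)
  · filter_upwards [hfh] with z hz
    rw [hz, ← Finset.add_sum_erase _ _ (Finset.mem_univ m)]
    ring

/-- The counterpart of `exists_decayingHol_of_poles` on the other side of `Σ`: the same polar terms
can be subtracted harmlessly because their poles lie outside `S`. This keeps the jump unchanged. -/
theorem decayingHol_sub_polar {S D : Set ℂ} (hDS : D ⊆ S) {η : ι → ℂ} (hη : ∀ n, η n ∉ S)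
    {f : ℂ → ℂ} {L : ℂ} (hf : HolAsymp S D f L) (α β : ι → ℂ) :
    DecayingHol S D fun z => f z - L - ∑ n, polar (α n) (β n) (η n) z where
  cont := (hf.cont.sub continuousOn_const).sub <| continuousOn_finsetSum _ fun n _ z hz =>
    (hasDerivAt_polar (α n) (β n) fun h : z = η n => hη n (h ▸ hz)).continuousAt.continuousWithinAt
  diff := (hf.diff.sub_const L).fun_sub <| DifferentiableOn.fun_sum fun n _ z hz =>
    (hasDerivAt_polar (α n) (β n)
      fun h : z = η n => hη n (h ▸ hDS hz)).differentiableAt.differentiableWithinAt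
  decay := isBigO_inv_iff.1
    (hf.asymp.sub (Asymptotics.IsBigO.fun_sum fun n _ => isBigO_polar (α n) (β n) (η n) S))

end DNLS

namespace DNLS

/-! ### Norming constants -/

variable {q : ℝ → ℝ → ℂ}

theorem IsJostColumn.ne_zero (hq : IsSolutionZBC q) {l : Filter ℝ} [l.NeBot] {j : Fin 2} {t : ℝ}
    {k : ℂ} {φ : ℝ → Fin 2 → ℂ} (h : IsJostColumn q l j t k φ) (x : ℝ) : φ x ≠ 0 := by
  intro h0
  have hz : φ = fun _ => 0 := by
    refine laxX_unique (x₀ := x) hq h.1 (fun y => ?_) h0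
    rw [Matrix.mulVec_zero]
    exact hasDerivAt_const y 0
  have hl := h.2
  simp only [hz, smul_zero] at hl
  have := congrFun (tendsto_nhds_unique tendsto_const_nhds hl) j
  simp at this

theorem wr_neg_swap (u v : Fin 2 → ℂ) : wr u v = -1 * wr v u := by
  rw [wr_eq, wr_eq]; ring

theorem HasDerivAt.wr {u v : ℂ → Fin 2 → ℂ} {u' v' : Fin 2 → ℂ} {k : ℂ} (hu : HasDerivAt u u' k)
    (hv : HasDerivAt v v' k) :
    HasDerivAt (fun z => wr (u z) (v z)) (wr u' (v k) + wr (u k) v') k := by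
  simp only [wr_eq]
  have hu := hasDerivAt_pi.1 hu
  have hv := hasDerivAt_pi.1 hv
  refine (((hu 0).fun_mul (hv 1)).fun_sub ((hv 0).fun_mul (hu 1))).congr_deriv ?_
  ring

/-- Where `v` vanishes, the product rule needs only continuity of `G`: the difference quotient is `G
k` applied to that of `v`. The propagator is known only to be continuous in `k`. -/
theorem hasDerivAt_mulVec_of_eq_zero {G : ℂ → Matrix (Fin 2) (Fin 2) ℂ} {v : ℂ → Fin 2 → ℂ}
    {v' : Fin 2 → ℂ} {η : ℂ} (hG : ContinuousAt G η) (hv : HasDerivAt v v' η) (h0 : v η = 0) :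
    HasDerivAt (fun k => G k *ᵥ v k) (G η *ᵥ v') η := by
  rw [hasDerivAt_iff_tendsto_slope] at hv ⊢
  have hc : Continuous fun p : Matrix (Fin 2) (Fin 2) ℂ × (Fin 2 → ℂ) => p.1 *ᵥ p.2 :=
    continuous_fst.matrix_mulVec continuous_snd
  have := (hc.tendsto (G η, v')).comp
    ((hG.tendsto.mono_left nhdsWithin_le_nhds).prodMk_nhds hv)
  refine this.congr fun k => ?_
  simp only [Function.comp_apply, slope_def_module, h0, Matrix.mulVec_zero, sub_zero,
    Matrix.mulVec_smul]

/-- At the zero the columns are parallel, which gives `b`. Differentiating the Wronskian and using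
`s' = 0` shows that `φ₀' - bψ₀'` is again parallel to `ψ₀`, which gives `d`. Since `φ₀ - bψ₀`
vanishes at `η`, both relations are transported by `G`, with the same constants. -/
theorem norming_relation {φ₀ ψ₀ φ ψ : ℂ → Fin 2 → ℂ} {G : ℂ → Matrix (Fin 2) (Fin 2) ℂ}
    {s : ℂ → ℂ} {c η : ℂ} (hG : ContinuousAt G η) (hφ : ∀ᶠ k in 𝓝 η, φ k = G k *ᵥ φ₀ k)
    (hψ : ∀ᶠ k in 𝓝 η, ψ k = G k *ᵥ ψ₀ k) (dφ₀ : DifferentiableAt ℂ φ₀ η)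
    (dψ₀ : DifferentiableAt ℂ ψ₀ η) (dφ : DifferentiableAt ℂ φ η) (dψ : DifferentiableAt ℂ ψ η)
    (hφ0 : φ₀ η ≠ 0) (hψ0 : ψ₀ η ≠ 0) (hc : c ≠ 0) (hs : s =ᶠ[𝓝 η] fun k => c * wr (φ₀ k) (ψ₀ k))
    (h0 : s η = 0) (h1 : deriv s η = 0) :
    ratio (φ₀ η) (ψ₀ η) ≠ 0 ∧ φ η = ratio (φ₀ η) (ψ₀ η) • ψ η ∧
      deriv φ η = ratio (φ₀ η) (ψ₀ η) • deriv ψ η +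
        ratio (deriv φ₀ η - ratio (φ₀ η) (ψ₀ η) • deriv ψ₀ η) (ψ₀ η) • ψ η := by
  have hw0 : wr (φ₀ η) (ψ₀ η) = 0 := by
    rw [hs.eq_of_nhds] at h0
    exact (mul_eq_zero.1 h0).resolve_left hc
  have hb : φ₀ η = ratio (φ₀ η) (ψ₀ η) • ψ₀ η :=
    Classical.epsilon_spec (p := fun c : ℂ => φ₀ η = c • ψ₀ η) (eq_smul_of_wr_eq_zero hψ0 hw0)
  set b := ratio (φ₀ η) (ψ₀ η) with hbdef
  have hb0 : b ≠ 0 := fun h => hφ0 (by rw [hb, h, zero_smul])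
  have hw1 : wr (deriv φ₀ η - b • deriv ψ₀ η) (ψ₀ η) = 0 := by
    have hd := (HasDerivAt.wr dφ₀.hasDerivAt dψ₀.hasDerivAt).const_mul c
    rw [hs.deriv_eq, hd.deriv] at h1
    have h2 := (mul_eq_zero.1 h1).resolve_left hc
    rw [hb] at h2
    rw [← h2]
    simp only [wr_eq, Pi.sub_apply, Pi.smul_apply, smul_eq_mul]
    ring
  have hd : deriv φ₀ η - b • deriv ψ₀ η = ratio (deriv φ₀ η - b • deriv ψ₀ η) (ψ₀ η) • ψ₀ η :=
    Classical.epsilon_spec (p := fun c : ℂ => deriv φ₀ η - b • deriv ψ₀ η = c • ψ₀ η)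
      (eq_smul_of_wr_eq_zero hψ0 hw1)
  set d := ratio (deriv φ₀ η - b • deriv ψ₀ η) (ψ₀ η) with hddef
  refine ⟨hb0, ?_, ?_⟩
  · rw [hφ.self_of_nhds, hψ.self_of_nhds, hb, Matrix.mulVec_smul]
  · have hv : HasDerivAt (fun k => φ₀ k - b • ψ₀ k) (d • ψ₀ η) η :=
      (dφ₀.hasDerivAt.fun_sub (dψ₀.hasDerivAt.const_smul b)).congr_deriv hd
    have hw := hasDerivAt_mulVec_of_eq_zero hG hv (by rw [hb, sub_self])
    have hw' : HasDerivAt (fun k => φ k - b • ψ k) (deriv φ η - b • deriv ψ η) η :=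
      dφ.hasDerivAt.fun_sub (dψ.hasDerivAt.const_smul b)
    have heq : (fun k => φ k - b • ψ k) =ᶠ[𝓝 η] fun k => G k *ᵥ (φ₀ k - b • ψ₀ k) := by
      filter_upwards [hφ, hψ] with k h1 h2
      rw [h1, h2, Matrix.mulVec_sub, Matrix.mulVec_smul]
    have := hw'.unique (hw.congr_of_eventuallyEq heq)
    rw [Matrix.mulVec_smul, ← hψ.self_of_nhds] at this
    rw [← this]
    abel

/-- The two columns are normalised by opposite phases, so the proportionality factor acquires
`e^{-2εiθ}`. Its logarithmic derivative supplies the term `-2εiθ'` in `D_n` and `D̂_n`. -/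
theorem normalised_relation {φ ψ a c : ℂ → Fin 2 → ℂ} {th : ℂ → ℂ} {ε b d η : ℂ}
    (ha : ∀ k, a k = Complex.exp (-(ε * Complex.I * th k)) • φ k)
    (hc : ∀ k, c k = Complex.exp (ε * Complex.I * th k) • ψ k)
    (hth : DifferentiableAt ℂ th η) (dφ : DifferentiableAt ℂ φ η) (dψ : DifferentiableAt ℂ ψ η)
    (hb : b ≠ 0) (h : φ η = b • ψ η) (h' : deriv φ η = b • deriv ψ η + d • ψ η) :
    a η = (b * Complex.exp (-(2 * ε * Complex.I * th η))) • c η ∧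
      deriv a η = (b * Complex.exp (-(2 * ε * Complex.I * th η))) •
        (deriv c η + (d / b - 2 * ε * Complex.I * deriv th η) • c η) := by
  set e := Complex.exp (ε * Complex.I * th η) with he
  set e' := Complex.exp (-(ε * Complex.I * th η)) with he'
  have hee : e' * e = 1 := by rw [he, he', ← Complex.exp_add, neg_add_cancel, Complex.exp_zero]
  have he2 : Complex.exp (-(2 * ε * Complex.I * th η)) = e' * e' := by
    rw [he', ← Complex.exp_add]
    congr 1
    ring
  have hd1 := (hth.hasDerivAt.const_mul (ε * Complex.I)).fun_neg.cexp.fun_smul dφ.hasDerivAt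
  have hd2 := (hth.hasDerivAt.const_mul (ε * Complex.I)).cexp.fun_smul dψ.hasDerivAt
  rw [← funext ha] at hd1
  rw [← funext hc] at hd2
  rw [he2, hd1.deriv, hd2.deriv, ha η, hc η, h, h', ← he, ← he']
  constructor
  · rw [smul_smul, smul_smul]
    congr 1
    linear_combination (-(b * e')) * hee
  · ext i
    simp only [Pi.add_apply, Pi.smul_apply, smul_eq_mul]
    have hbb : d = b * (d / b) := by field_simp
    generalize d / b = r at *
    subst hbb
    linear_combination (-(b * e' * (deriv ψ η i + r * ψ η i
      - ε * Complex.I * deriv th η * ψ η i))) * hee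

/-- Puts the polar part into the shape of the summands in the formula for `M`. -/
theorem polar_eq (A e D c c' η k : ℂ) :
    polar (A * e * c) (A * e * (c' + D * c)) η k =
      A / (k - η) * e * (c' + (D + 1 / (k - η)) * c) := by
  simp only [polar, div_eq_mul_inv, ← inv_pow]
  ring

/-- Differentiating the summand in `k` explains the minus sign and the change from `1/(k - η)` to
`2/(k - η)` in the equations for the derivatives. -/
theorem polar_deriv_eq (A e D c c' η k : ℂ) :
    -(2 * (A * e * c) / (k - η) ^ 3 + A * e * (c' + D * c) / (k - η) ^ 2) =
      -(A / (k - η) * e / (k - η) * (c' + (D + 2 / (k - η)) * c)) := by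
  simp only [div_eq_mul_inv, ← inv_pow]
  ring

theorem differentiable_theta (x t : ℝ) : Differentiable ℂ (theta x t) := by
  unfold theta
  fun_prop

theorem HolAsymp.differentiableAt_vec {S D : Set ℂ} {f : ℂ → Fin 2 → ℂ} {L : Fin 2 → ℂ}
    (h : ∀ i, HolAsymp S D (fun k => f k i) (L i)) (hD : IsOpen D) {η : ℂ} (hη : η ∈ D) :
    DifferentiableAt ℂ f η :=
  differentiableAt_pi.2 fun i => (h i).diff.differentiableAt (hD.mem_nhds hη)

theorem HolAsymp.analyticAt {S D : Set ℂ} {f : ℂ → ℂ} {L : ℂ} (h : HolAsymp S D f L)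
    (hD : IsOpen D) {η : ℂ} (hη : η ∈ D) : AnalyticAt ℂ f η :=
  h.diff.analyticAt (hD.mem_nhds hη)

theorem differentiableAt_phiPlus (j : Fin 2) (x t : ℝ) {η : ℂ}
    (h : DifferentiableAt ℂ (fun k => muPlus q j x t k) η) :
    DifferentiableAt ℂ (fun k => phiPlus q j x t k) η := by
  have := differentiable_theta x t
  rw [funext fun k => phiPlus_eq_mu q j x t k]
  exact DifferentiableAt.fun_smul (by fun_prop) h

theorem differentiableAt_phiMinus (j : Fin 2) (x t : ℝ) {η : ℂ}
    (h : DifferentiableAt ℂ (fun k => muMinus q j x t k) η) :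
    DifferentiableAt ℂ (fun k => phiMinus q j x t k) η := by
  have := differentiable_theta x t
  rw [funext fun k => phiMinus_eq_mu q j x t k]
  exact DifferentiableAt.fun_smul (by fun_prop) h

theorem norming_plus (hq : IsSolutionZBC q) (x t : ℝ) {η : ℂ} (hη : η ∈ Dplus)
    (h0 : s11 q η = 0) (h1 : deriv (s11 q) η = 0) :
    muPlus q 0 x t η = (bCoeff q η * Complex.exp (-2 * Complex.I * theta x t η)) •
        muMinus q 1 x t η ∧
      deriv (fun k => muPlus q 0 x t k) η =
        (bCoeff q η * Complex.exp (-2 * Complex.I * theta x t η)) • (muMinus' q 1 x t η +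
          (dCoeff q η / bCoeff q η - 2 * Complex.I * deriv (theta x t) η) •
            muMinus q 1 x t η) := by
  obtain ⟨G, hGc, -, hG, -⟩ := exists_phi_propagator hq x t
  have hη' : 0 < η.re * η.im := hη
  have hev : ∀ᶠ k in 𝓝 η, k ∈ Dplus := isOpen_Dplus.mem_nhds hη
  have dP := fun x t => differentiableAt_phiPlus 0 x t
    (HolAsymp.differentiableAt_vec (muPlus_zero_holAsymp hq x t) isOpen_Dplus hη)
  have dM := fun x t => differentiableAt_phiMinus 1 x t
    (HolAsymp.differentiableAt_vec (muMinus_one_holAsymp hq x t) isOpen_Dplus hη)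
  have hD : η ∈ DplusC := Dplus_subset hη
  obtain ⟨hb, hr, hr'⟩ := norming_relation (φ₀ := fun k => phiPlus q 0 0 0 k)
    (ψ₀ := fun k => phiMinus q 1 0 0 k) (φ := fun k => phiPlus q 0 x t k)
    (ψ := fun k => phiMinus q 1 x t k) (s := s11 q) (c := 1) hGc.continuousAt
    (hev.mono fun k hk => (hG k (Dplus_subset hk)).1)
    (hev.mono fun k hk => (hG k (Dplus_subset hk)).2) (dP 0 0) (dM 0 0) (dP x t) (dM x t)
    ((isJostColumn_phiPlus_zero hq 0 hD).ne_zero hq 0)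
    ((isJostColumn_phiMinus_one hq 0 hD).ne_zero hq 0) one_ne_zero
    (Eventually.of_forall fun k => (one_mul _).symm) h0 h1
  have := normalised_relation (a := fun k => muPlus q 0 x t k) (c := fun k => muMinus q 1 x t k)
    (th := theta x t) (ε := 1) (fun k => rfl) (fun k => by simp [muMinus, sgn])
    (differentiable_theta x t η) (dP x t) (dM x t) hb hr hr'
  simpa [bCoeff, dCoeff, hη', muMinus'] using this

theorem norming_minus (hq : IsSolutionZBC q) (x t : ℝ) {η : ℂ} (hη : η ∈ Dminus)
    (h0 : s22 q η = 0) (h1 : deriv (s22 q) η = 0) :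
    muPlus q 1 x t η = (bCoeff q η * Complex.exp (2 * Complex.I * theta x t η)) •
        muMinus q 0 x t η ∧
      deriv (fun k => muPlus q 1 x t k) η =
        (bCoeff q η * Complex.exp (2 * Complex.I * theta x t η)) • (muMinus' q 0 x t η +
          (dCoeff q η / bCoeff q η + 2 * Complex.I * deriv (theta x t) η) •
            muMinus q 0 x t η) := by
  obtain ⟨G, hGc, -, -, hG⟩ := exists_phi_propagator hq x t
  have hη' : ¬ 0 < η.re * η.im := not_lt.2 (Dminus_subset hη)
  have hev : ∀ᶠ k in 𝓝 η, k ∈ Dminus := isOpen_Dminus.mem_nhds hη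
  have dP := fun x t => differentiableAt_phiPlus 1 x t
    (HolAsymp.differentiableAt_vec (muPlus_one_holAsymp hq x t) isOpen_Dminus hη)
  have dM := fun x t => differentiableAt_phiMinus 0 x t
    (HolAsymp.differentiableAt_vec (muMinus_zero_holAsymp hq x t) isOpen_Dminus hη)
  have hD : η ∈ DminusC := Dminus_subset hη
  -- The sign `-1` appears because the Wronskian defining `s₂₂` lists the column at `-∞` first.
  obtain ⟨hb, hr, hr'⟩ := norming_relation (φ₀ := fun k => phiPlus q 1 0 0 k)
    (ψ₀ := fun k => phiMinus q 0 0 0 k) (φ := fun k => phiPlus q 1 x t k)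
    (ψ := fun k => phiMinus q 0 x t k) (s := s22 q) (c := -1) hGc.continuousAt
    (hev.mono fun k hk => (hG k (Dminus_subset hk)).1)
    (hev.mono fun k hk => (hG k (Dminus_subset hk)).2) (dP 0 0) (dM 0 0) (dP x t) (dM x t)
    ((isJostColumn_phiPlus_one hq 0 hD).ne_zero hq 0)
    ((isJostColumn_phiMinus_zero hq 0 hD).ne_zero hq 0) (neg_ne_zero.2 one_ne_zero)
    (Eventually.of_forall fun k => wr_neg_swap _ _) h0 h1
  have := normalised_relation (a := fun k => muPlus q 1 x t k) (c := fun k => muMinus q 0 x t k)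
    (th := theta x t) (ε := -1) (fun k => rfl) (fun k => by simp [muMinus, sgn])
    (differentiable_theta x t η) (dP x t) (dM x t) hb hr hr'
  simpa [bCoeff, dCoeff, hη', muMinus'] using this

/-! ### Polar parts -/

/-- Substitutes the proportionality relations into `exists_polar_part`: only the values and
derivatives of the pole-free column `c` remain, which is why the final system closes. -/
theorem polarPart_of_relation {a c : ℂ → Fin 2 → ℂ} {s : ℂ → ℂ} {η b e r : ℂ}
    (da : DifferentiableAt ℂ a η) (ha : ∀ i, AnalyticAt ℂ (fun k => a k i) η)
    (hs : AnalyticAt ℂ s η) (h0 : s η = 0) (h1 : deriv s η = 0) (h2 : iteratedDeriv 2 s η ≠ 0)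
    (hr : a η = (b * e) • c η) (hr' : deriv a η = (b * e) • (deriv c η + r • c η)) (i : Fin 2) :
    ∃ h : ℂ → ℂ, AnalyticAt ℂ h η ∧ ∀ᶠ z in 𝓝[≠] η, (s z)⁻¹ * a z i =
      polar (2 * b / iteratedDeriv 2 s η * e * c η i) (2 * b / iteratedDeriv 2 s η * e *
        (deriv c η i + (r - iteratedDeriv 3 s η / (3 * iteratedDeriv 2 s η)) * c η i)) η z
      + h z := by
  obtain ⟨h, hh, hev⟩ := exists_polar_part (ha i) hs h0 h1 h2
  refine ⟨h, hh, hev.mono fun z hz => ?_⟩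
  have e1 : deriv (fun k => a k i) η = deriv a η i := (hasDerivAt_pi.1 da.hasDerivAt i).deriv
  rw [hz, e1, hr, hr']
  simp only [Pi.add_apply, Pi.smul_apply, smul_eq_mul]
  congr 2 <;> ring

theorem polarPart_plus (hq : IsSolutionZBC q) (x t : ℝ) {η : ℂ} (hη : η ∈ Dplus)
    (h0 : s11 q η = 0) (h1 : deriv (s11 q) η = 0) (h2 : iteratedDeriv 2 (s11 q) η ≠ 0)
    (i : Fin 2) :
    ∃ h : ℂ → ℂ, AnalyticAt ℂ h η ∧ ∀ᶠ z in 𝓝[≠] η, (s11 q z)⁻¹ * muPlus q 0 x t z i =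
      polar (aNorm q η * Complex.exp (-2 * Complex.I * theta x t η) * muMinus q 1 x t η i)
        (aNorm q η * Complex.exp (-2 * Complex.I * theta x t η) *
          (muMinus' q 1 x t η i + coefD q x t η * muMinus q 1 x t η i)) η z + h z := by
  have hη' : 0 < η.re * η.im := hη
  obtain ⟨hr, hr'⟩ := norming_plus hq x t hη h0 h1
  obtain ⟨h, hh, hev⟩ := polarPart_of_relation (c := fun k => muMinus q 1 x t k)
    (HolAsymp.differentiableAt_vec (muPlus_zero_holAsymp hq x t) isOpen_Dplus hη)
    (fun i => (muPlus_zero_holAsymp hq x t i).analyticAt isOpen_Dplus hη)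
    ((s11_holAsymp hq x t).analyticAt isOpen_Dplus hη) h0 h1 h2 hr hr' i
  refine ⟨h, hh, hev.mono fun z hz => hz.trans ?_⟩
  simp only [aNorm, coefD, bNorm, muMinus', if_pos hη']
  congr 4
  ring

theorem polarPart_minus (hq : IsSolutionZBC q) (x t : ℝ) {η : ℂ} (hη : η ∈ Dminus)
    (h0 : s22 q η = 0) (h1 : deriv (s22 q) η = 0) (h2 : iteratedDeriv 2 (s22 q) η ≠ 0)
    (i : Fin 2) :
    ∃ h : ℂ → ℂ, AnalyticAt ℂ h η ∧ ∀ᶠ z in 𝓝[≠] η, (s22 q z)⁻¹ * muPlus q 1 x t z i =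
      polar (aNorm q η * Complex.exp (2 * Complex.I * theta x t η) * muMinus q 0 x t η i)
        (aNorm q η * Complex.exp (2 * Complex.I * theta x t η) *
          (muMinus' q 0 x t η i + coefDhat q x t η * muMinus q 0 x t η i)) η z + h z := by
  have hη' : ¬ 0 < η.re * η.im := not_lt.2 (Dminus_subset hη)
  obtain ⟨hr, hr'⟩ := norming_minus hq x t hη h0 h1
  obtain ⟨h, hh, hev⟩ := polarPart_of_relation (c := fun k => muMinus q 0 x t k)
    (HolAsymp.differentiableAt_vec (muPlus_one_holAsymp hq x t) isOpen_Dminus hη)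
    (fun i => (muPlus_one_holAsymp hq x t i).analyticAt isOpen_Dminus hη)
    ((s22_holAsymp hq x t).analyticAt isOpen_Dminus hη) h0 h1 h2 hr hr' i
  refine ⟨h, hh, hev.mono fun z hz => hz.trans ?_⟩
  simp only [aNorm, coefDhat, bNorm, muMinus', if_neg hη']
  congr 4
  ring

/-! ### The discrete spectrum -/

variable {N : ℕ} {kn : Fin N → ℂ}

theorem eta_mem_iff (kn : Fin N → ℂ) (k : ℂ) :
    k ∈ Set.range (eta kn) ↔ ∃ n, k = kn n ∨ k = -kn n := by
  constructor
  · rintro ⟨m, rfl⟩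
    induction m using Fin.addCases with
    | left n => exact ⟨n, Or.inl (Fin.append_left _ _ n)⟩
    | right n => exact ⟨n, Or.inr (Fin.append_right _ _ n)⟩
  · rintro ⟨n, rfl | rfl⟩
    · exact ⟨Fin.castAdd N n, Fin.append_left _ _ n⟩
    · exact ⟨Fin.natAdd N n, Fin.append_right _ _ n⟩

theorem mem_discreteSpectrum_iff (kn : Fin N → ℂ) (k : ℂ) :
    k ∈ discreteSpectrum kn ↔ k ∈ Set.range (eta kn) ∨ conj k ∈ Set.range (eta kn) := by
  rw [eta_mem_iff, eta_mem_iff, ← exists_or]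
  refine exists_congr fun n => ?_
  have e1 : conj k = kn n ↔ k = conj (kn n) :=
    ⟨fun h => by rw [← h, Complex.conj_conj], fun h => by rw [h, Complex.conj_conj]⟩
  have e2 : conj k = -kn n ↔ k = -conj (kn n) :=
    ⟨fun h => by rw [← map_neg, ← h, Complex.conj_conj],
      fun h => by rw [h, map_neg, Complex.conj_conj]⟩
  rw [e1, e2]
  tauto

theorem HasDoubleZeros.eta_injective (h : HasDoubleZeros q kn) :
    Function.Injective (eta kn) := by
  have hne : ∀ m n, kn m ≠ -kn n := fun m n e => by
    have h1 := congrArg Complex.re e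
    rw [Complex.neg_re] at h1
    linarith [(h.mem m).1, (h.mem n).1]
  intro a b
  induction a using Fin.addCases with
  | left a =>
    induction b using Fin.addCases with
    | left b =>
      simp only [eta, Fin.append_left]
      exact fun e => congrArg _ (h.injective e)
    | right b =>
      simp only [eta, Fin.append_left, Fin.append_right]
      exact fun e => absurd e (hne a b)
  | right a =>
    induction b using Fin.addCases with
    | left b =>
      simp only [eta, Fin.append_left, Fin.append_right]
      exact fun e => absurd e.symm (hne b a)
    | right b =>
      simp only [eta, Fin.append_right]
      exact fun e => congrArg _ (h.injective (neg_injective e))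

theorem HasDoubleZeros.eta_mem (h : HasDoubleZeros q kn) (n : Fin (N + N)) :
    eta kn n ∈ Dplus := by
  obtain ⟨m, hm | hm⟩ := (eta_mem_iff kn _).1 ⟨n, rfl⟩ <;> rw [hm]
  · exact mul_pos (h.mem m).1 (h.mem m).2
  · have := mul_pos (h.mem m).1 (h.mem m).2
    simpa [Dplus] using this

/-- `D⁺` is the union of the open first and third quadrants. The first is covered by hypothesis, the
third by evenness of `s₁₁`. -/
theorem HasDoubleZeros.s11_eq_zero (hq : IsSolutionZBC q) (h : HasDoubleZeros q kn) {k : ℂ}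
    (hk : k ∈ Dplus) : s11 q k = 0 ↔ k ∈ Set.range (eta kn) := by
  rw [eta_mem_iff]
  have hpos : ∀ n, 0 < (kn n).re := fun n => (h.mem n).1
  rcases mul_pos_iff.1 (show 0 < k.re * k.im from hk) with ⟨h1, h2⟩ | ⟨h1, h2⟩
  · rw [h.zero_iff k h1 h2]
    refine exists_congr fun n => (or_iff_left fun e => ?_).symm
    have := hpos n
    rw [e, Complex.neg_re] at h1
    linarith
  · rw [← s11_neg hq (Dplus_subset hk), h.zero_iff (-k) (by simpa using h1) (by simpa using h2)]
    refine exists_congr fun n => ?_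
    rw [neg_eq_iff_eq_neg]
    refine (or_iff_right fun e => ?_).symm
    have := hpos n
    rw [e] at h1
    linarith

/-- Evenness transfers the derivatives from `k_n` to `-k_n`, up to a sign. -/
theorem HasDoubleZeros.deriv_eta (hq : IsSolutionZBC q) (h : HasDoubleZeros q kn)
    (n : Fin (N + N)) :
    deriv (s11 q) (eta kn n) = 0 ∧ iteratedDeriv 2 (s11 q) (eta kn n) ≠ 0 := by
  have hη := h.eta_mem n
  obtain ⟨m, hm | hm⟩ := (eta_mem_iff kn _).1 ⟨n, rfl⟩
  · rw [hm]
    exact ⟨h.deriv_eq m, h.deriv2_ne m⟩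
  · have hev : s11 q =ᶠ[𝓝 (eta kn n)] fun z => s11 q (-z) := by
      filter_upwards [isOpen_Dplus.mem_nhds hη] with z hz using (s11_neg hq (Dplus_subset hz)).symm
    have h1 := hev.iteratedDeriv_eq 1
    have h2 := hev.iteratedDeriv_eq 2
    rw [iteratedDeriv_comp_neg, hm, neg_neg] at h1 h2
    rw [hm, ← iteratedDeriv_one, h1, h2, iteratedDeriv_one, h.deriv_eq m]
    exact ⟨smul_zero _, by simpa using h.deriv2_ne m⟩

theorem HasDoubleZeros.s22_eq_zero (hq : IsSolutionZBC q) (h : HasDoubleZeros q kn) {k : ℂ}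
    (hk : k ∈ Dminus) : s22 q k = 0 ↔ k ∈ Set.range fun n => conj (eta kn n) := by
  rw [s22_eq hq (Dminus_subset hk), map_eq_zero, h.s11_eq_zero hq (conj_mem_Dplus hk)]
  refine exists_congr fun n => ?_
  exact ⟨fun e => by simp only [e, Complex.conj_conj], fun e => by simp only [← e, Complex.conj_conj]⟩

/-- Near the point, `s₂₂` is `s₁₁` conjugated before and after, so its complex derivatives are the
conjugates of those of `s₁₁`. -/
theorem HasDoubleZeros.deriv_conj_eta (hq : IsSolutionZBC q) (h : HasDoubleZeros q kn)
    (n : Fin (N + N)) :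
    deriv (s22 q) (conj (eta kn n)) = 0 ∧ iteratedDeriv 2 (s22 q) (conj (eta kn n)) ≠ 0 := by
  have hη := conj_mem_Dminus (h.eta_mem n)
  have hev : s22 q =ᶠ[𝓝 (conj (eta kn n))] conj ∘ s11 q ∘ conj := by
    filter_upwards [isOpen_Dminus.mem_nhds hη] with z hz using s22_eq hq (Dminus_subset hz)
  obtain ⟨h1, h2⟩ := h.deriv_eta hq n
  rw [hev.deriv_eq, hev.iteratedDeriv_eq, iteratedDeriv_succ, iteratedDeriv_one, deriv_conj_conj,
    deriv_conj_conj]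
  rw [iteratedDeriv_succ, iteratedDeriv_one] at h2
  simp only [Function.comp_apply, Complex.conj_conj]
  exact ⟨by rw [h1, map_zero], by rwa [Ne, map_eq_zero]⟩

end DNLS

namespace DNLS

/-! ### The representation of the columns of `M` -/

theorem pos_or_neg_of_notMem_Sig {k : ℂ} (hk : k ∉ Sig) : k ∈ Dplus ∨ k ∈ Dminus :=
  (lt_or_gt_of_ne hk).symm

theorem notMem_Sig_of_Dplus {k : ℂ} (hk : k ∈ Dplus) : k ∉ Sig := fun h =>
  (ne_of_gt (show 0 < k.re * k.im from hk)) h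

theorem notMem_Sig_of_Dminus {k : ℂ} (hk : k ∈ Dminus) : k ∉ Sig := fun h =>
  (ne_of_lt (show k.re * k.im < 0 from hk)) h

theorem notMem_DminusC_of_Dplus {k : ℂ} (hk : k ∈ Dplus) : k ∉ DminusC :=
  not_le.2 (show 0 < k.re * k.im from hk)

theorem notMem_DplusC_of_Dminus {k : ℂ} (hk : k ∈ Dminus) : k ∉ DplusC :=
  not_le.2 (show k.re * k.im < 0 from hk)

/-- On `Σ` only the jump `J` enters the Cauchy integral, so `gp` and `gm` may be forgotten there.
Differentiating under the integral raises the kernel to its second power. -/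
theorem cauchy_of_jump {gp gm J : ℂ → ℂ} (hp : DecayingHol DplusC Dplus gp)
    (hm : DecayingHol DminusC Dminus gm) (hJ : ∀ z ∈ Sig, gp z - gm z = J z) :
    (∀ k ∉ Sig, ∀ m : ℕ, m = 1 ∨ m = 2 → SigIntegrable fun z => J z / (z - k) ^ m) ∧
    (∀ k ∈ Dplus, gp k = (2 * Real.pi * Complex.I)⁻¹ * sigIntegral (fun z => J z / (z - k) ^ 1) ∧
      HasDerivAt gp
        ((2 * Real.pi * Complex.I)⁻¹ * sigIntegral (fun z => J z / (z - k) ^ 2)) k) ∧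
    ∀ k ∈ Dminus, gm k = (2 * Real.pi * Complex.I)⁻¹ * sigIntegral (fun z => J z / (z - k) ^ 1) ∧
      HasDerivAt gm
        ((2 * Real.pi * Complex.I)⁻¹ * sigIntegral (fun z => J z / (z - k) ^ 2)) k := by
  have hd := (hp.onSig fun z => mem_DplusC_of_Sig).sub (hm.onSig fun z => mem_DminusC_of_Sig)
  have hpi : (2 * Real.pi * Complex.I : ℂ) ≠ 0 := Complex.two_pi_I_ne_zero
  have hI : ∀ k m, sigIntegral (fun z => (gp z - gm z) / (z - k) ^ m)
      = sigIntegral fun z => J z / (z - k) ^ m := fun k m =>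
    sigIntegral_congr fun z hz => by rw [hJ z hz]
  have hjump : ∀ k ∉ Sig, (2 * Real.pi * Complex.I)⁻¹ * sigIntegral (fun z => J z / (z - k) ^ 1)
      = if 0 < k.re * k.im then gp k else gm k := fun k hk => by
    rw [← hI]
    simp only [pow_one]
    rw [sigIntegral_jump hp hm hk, inv_mul_cancel_left₀ hpi]
  have hder : ∀ k ∉ Sig, HasDerivAt (fun k => (2 * Real.pi * Complex.I)⁻¹ *
      sigIntegral (fun z => J z / (z - k) ^ 1))
      ((2 * Real.pi * Complex.I)⁻¹ * sigIntegral (fun z => J z / (z - k) ^ 2)) k := fun k hk => by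
    have := (hasDerivAt_sigIntegral hd hk).const_mul (2 * Real.pi * Complex.I)⁻¹
    rw [hI] at this
    refine this.congr_of_eventuallyEq (Eventually.of_forall fun k => ?_)
    dsimp only
    rw [← hI]
    simp only [pow_one]
  refine ⟨fun k hk m hm => ?_, fun k hk => ?_, fun k hk => ?_⟩
  · rcases hm with rfl | rfl
    · refine sigIntegrable_congr (fun z hz => ?_) (hd.sigIntegrable hk)
      rw [hJ z hz, pow_one]
    · exact sigIntegrable_congr (fun z hz => by rw [hJ z hz]) (hd.sigIntegrable_sq hk)
  · have e : ∀ z ∈ Dplus, gp z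
        = (2 * Real.pi * Complex.I)⁻¹ * sigIntegral (fun w => J w / (w - z) ^ 1) := fun z hz => by
      rw [hjump z (notMem_Sig_of_Dplus hz), if_pos (show 0 < z.re * z.im from hz)]
    refine ⟨e k hk, (hder k (notMem_Sig_of_Dplus hk)).congr_of_eventuallyEq ?_⟩
    filter_upwards [isOpen_Dplus.mem_nhds hk] with z hz using e z hz
  · have e : ∀ z ∈ Dminus, gm z
        = (2 * Real.pi * Complex.I)⁻¹ * sigIntegral (fun w => J w / (w - z) ^ 1) := fun z hz => by
      rw [hjump z (notMem_Sig_of_Dminus hz), if_neg (not_lt.2 (Dminus_subset hz))]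
    refine ⟨e k hk, (hder k (notMem_Sig_of_Dminus hk)).congr_of_eventuallyEq ?_⟩
    filter_upwards [isOpen_Dminus.mem_nhds hk] with z hz using e z hz

theorem HolAsymp.div_props {S D P : Set ℂ} {s a : ℂ → ℂ} {Ls La : ℂ} (hDS : D ⊆ S)
    (hs : HolAsymp S D s Ls) (hL : Ls ≠ 0) (ha : HolAsymp S D a La)
    (h0 : ∀ z ∈ S, z ∉ P → s z ≠ 0) :
    ContinuousOn (fun z => (s z)⁻¹ * a z) (S \ P) ∧
      DifferentiableOn ℂ (fun z => (s z)⁻¹ * a z) (D \ P) ∧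
      (fun z => (s z)⁻¹ * a z - Ls⁻¹ * La) =O[atInf S] fun z => z⁻¹ :=
  ⟨((hs.cont.mono Set.sdiff_subset).inv₀ fun z hz => h0 z hz.1 hz.2).mul
      (ha.cont.mono Set.sdiff_subset),
    ((hs.diff.mono Set.sdiff_subset).fun_inv fun z hz => h0 z (hDS hz.1) hz.2).fun_mul
      (ha.diff.mono Set.sdiff_subset),
    isBigO_inv_mul (isBigO_inv_inv hL hs.asymp) ha.asymp⟩

theorem cols_zero (u v : Fin 2 → ℂ) (i : Fin 2) : cols u v i 0 = u i := by
  fin_cases i <;> rfl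

theorem cols_one (u v : Fin 2 → ℂ) (i : Fin 2) : cols u v i 1 = v i := by
  fin_cases i <;> rfl

theorem expSigma_zero (z : ℂ) (i : Fin 2) :
    expSigma z i 0 = ![Complex.exp (Complex.I * z), 0] i := by
  fin_cases i <;> simp [expSigma]

theorem expSigma_one (z : ℂ) (i : Fin 2) :
    expSigma z i 1 = ![0, Complex.exp (-(Complex.I * z))] i := by
  fin_cases i <;> simp [expSigma]

variable {q : ℝ → ℝ → ℂ} {N : ℕ} {kn : Fin N → ℂ}

theorem s11_ne_zero (hq : IsSolutionZBC q) (hsing : NoSpectralSingularity q)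
    (hkn : HasDoubleZeros q kn) {z : ℂ} (hz : z ∈ DplusC) (hzη : z ∉ Set.range (eta kn)) :
    s11 q z ≠ 0 := by
  rcases (show 0 ≤ z.re * z.im from hz).eq_or_lt with h | h
  · exact (hsing z h.symm).1
  · exact fun h0 => hzη ((hkn.s11_eq_zero hq h).1 h0)

theorem s22_ne_zero (hq : IsSolutionZBC q) (hsing : NoSpectralSingularity q)
    (hkn : HasDoubleZeros q kn) {z : ℂ} (hz : z ∈ DminusC)
    (hzη : z ∉ Set.range fun n => conj (eta kn n)) : s22 q z ≠ 0 := by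
  rcases (show z.re * z.im ≤ 0 from hz).eq_or_lt with h | h
  · exact (hsing z h).2
  · exact fun h0 => hzη ((hkn.s22_eq_zero hq h).1 h0)

/-- Both the column and `s₁₁` have limits containing the total phase at `+∞`; it cancels in the
quotient, leaving `e^{iv₋}`. -/
theorem mPlus_zero_props (hq : IsSolutionZBC q) (hsing : NoSpectralSingularity q)
    (hkn : HasDoubleZeros q kn) (x t : ℝ) (i : Fin 2) :
    ContinuousOn (fun z => (s11 q z)⁻¹ * muPlus q 0 x t z i) (DplusC \ Set.range (eta kn)) ∧
      DifferentiableOn ℂ (fun z => (s11 q z)⁻¹ * muPlus q 0 x t z i)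
        (Dplus \ Set.range (eta kn)) ∧
      (fun z => (s11 q z)⁻¹ * muPlus q 0 x t z i - expSigma (vMinus q x t : ℂ) i 0)
        =O[atInf DplusC] fun z => z⁻¹ := by
  have hj := jostLimit_ne_zero (fun y => q y t) x
  have h := (s11_holAsymp hq x t).div_props Dplus_subset
    (mul_ne_zero hj (Complex.exp_ne_zero _)) (muPlus_zero_holAsymp hq x t i)
    (fun z hz hzη => s11_ne_zero hq hsing hkn hz hzη)
  have e : (jostLimit (fun y => q y t) x * Complex.exp (-(Complex.I * vMinus q x t)))⁻¹ *
      ![jostLimit (fun y => q y t) x, 0] i = expSigma (vMinus q x t : ℂ) i 0 := by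
    rw [expSigma_zero, mul_inv, ← Complex.exp_neg, neg_neg]
    fin_cases i
    · simp only [Fin.zero_eta, Matrix.cons_val_zero]
      field_simp
    · simp
  rwa [e] at h

theorem mMinus_one_props (hq : IsSolutionZBC q) (hsing : NoSpectralSingularity q)
    (hkn : HasDoubleZeros q kn) (x t : ℝ) (i : Fin 2) :
    ContinuousOn (fun z => (s22 q z)⁻¹ * muPlus q 1 x t z i)
        (DminusC \ Set.range fun n => conj (eta kn n)) ∧
      DifferentiableOn ℂ (fun z => (s22 q z)⁻¹ * muPlus q 1 x t z i)
        (Dminus \ Set.range fun n => conj (eta kn n)) ∧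
      (fun z => (s22 q z)⁻¹ * muPlus q 1 x t z i - expSigma (vMinus q x t : ℂ) i 1)
        =O[atInf DminusC] fun z => z⁻¹ := by
  have hj : conj (jostLimit (fun y => q y t) x) ≠ 0 :=
    (map_ne_zero _).2 (jostLimit_ne_zero _ _)
  have h := (s22_holAsymp hq x t).div_props Dminus_subset
    (mul_ne_zero hj (Complex.exp_ne_zero _)) (muPlus_one_holAsymp hq x t i)
    (fun z hz hzη => s22_ne_zero hq hsing hkn hz hzη)
  have e : (conj (jostLimit (fun y => q y t) x) * Complex.exp (Complex.I * vMinus q x t))⁻¹ *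
      ![0, conj (jostLimit (fun y => q y t) x)] i = expSigma (vMinus q x t : ℂ) i 1 := by
    rw [expSigma_one, mul_inv, ← Complex.exp_neg]
    fin_cases i
    · simp
    · simp only [Fin.mk_one, Matrix.cons_val_one, Matrix.cons_val_fin_one]
      field_simp
  rwa [e] at h

theorem mPlusJ_eq (hq : IsSolutionZBC q) (hsing : NoSpectralSingularity q) (x t : ℝ) {k : ℂ}
    (hk : k ∈ Sig) (i j : Fin 2) :
    mPlusJ q x t k i j = mPlus q x t k i j - mMinus q x t k i j := by
  rw [mMinus_eq hq hsing x t hk, mul_sub, mul_one, Matrix.sub_apply, sub_sub_cancel, mPlusJ]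

/-- The poles lie on the `D⁺` side, in `μ₊₁/s₁₁`. Subtracting the limit and the polar parts from
both `μ₊₁/s₁₁` and `μ₋₁` produces a decaying pair with jump `(M⁺J)₁`, to which `cauchy_of_jump`
applies. The value on `D⁺` gives the formula for `M`; on `D⁻` the value and its derivative also give
the equations at `η_n^*`. -/
theorem first_column (hq : IsSolutionZBC q) (hsing : NoSpectralSingularity q)
    (hkn : HasDoubleZeros q kn) (x t : ℝ) (i : Fin 2) :
    (∀ k ∉ Sig, ∀ m : ℕ, m = 1 ∨ m = 2 →
      SigIntegrable fun ζ => mPlusJ q x t ζ i 0 / (ζ - k) ^ m) ∧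
    (∀ k ∈ Dplus, k ∉ Set.range (eta kn) → (s11 q k)⁻¹ * muPlus q 0 x t k i =
      expSigma (vMinus q x t : ℂ) i 0 + cauchyCol q x t 1 k 0 i +
        ∑ n, coefC q x t (eta kn n) k * (muMinus' q 1 x t (eta kn n) i +
          (coefD q x t (eta kn n) + 1 / (k - eta kn n)) * muMinus q 1 x t (eta kn n) i)) ∧
    ∀ k ∈ Dminus, muMinus q 0 x t k i =
      expSigma (vMinus q x t : ℂ) i 0 + cauchyCol q x t 1 k 0 i +
        ∑ n, coefC q x t (eta kn n) k * (muMinus' q 1 x t (eta kn n) i +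
          (coefD q x t (eta kn n) + 1 / (k - eta kn n)) * muMinus q 1 x t (eta kn n) i) ∧
      muMinus' q 0 x t k i = cauchyCol q x t 2 k 0 i -
        ∑ n, coefC q x t (eta kn n) k / (k - eta kn n) * (muMinus' q 1 x t (eta kn n) i +
          (coefD q x t (eta kn n) + 2 / (k - eta kn n)) * muMinus q 1 x t (eta kn n) i) := by
  obtain ⟨hc, hd, ho⟩ := mPlus_zero_props hq hsing hkn x t i
  obtain ⟨gp, hgp, hgpe⟩ := exists_decayingHol_of_poles isOpen_Dplus hkn.eta_mem
    hkn.eta_injective hc hd ho fun n => polarPart_plus hq x t (hkn.eta_mem n)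
      ((hkn.s11_eq_zero hq (hkn.eta_mem n)).2 ⟨n, rfl⟩) (hkn.deriv_eta hq n).1
      (hkn.deriv_eta hq n).2 i
  have hM := muMinus_zero_holAsymp hq x t i
  rw [← expSigma_zero] at hM
  have hgm := decayingHol_sub_polar Dminus_subset
    (fun n => notMem_DminusC_of_Dplus (hkn.eta_mem n)) hM
    (fun n => aNorm q (eta kn n) * Complex.exp (-2 * Complex.I * theta x t (eta kn n)) *
      muMinus q 1 x t (eta kn n) i)
    (fun n => aNorm q (eta kn n) * Complex.exp (-2 * Complex.I * theta x t (eta kn n)) *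
      (muMinus' q 1 x t (eta kn n) i + coefD q x t (eta kn n) * muMinus q 1 x t (eta kn n) i))
  have hne : ∀ {k}, k ∉ Dplus → k ∉ Set.range (eta kn) := by
    rintro k hk ⟨n, rfl⟩
    exact hk (hkn.eta_mem n)
  obtain ⟨h1, h2, h3⟩ := cauchy_of_jump (J := fun ζ => mPlusJ q x t ζ i 0) hgp hgm
    fun z hz => by
      rw [hgpe z (hne fun h => notMem_Sig_of_Dplus h hz), mPlusJ_eq hq hsing x t hz, mPlus,
        mMinus, cols_zero, cols_zero, Pi.smul_apply, smul_eq_mul]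
      ring
  refine ⟨h1, fun k hk hkη => ?_, fun k hk => ⟨?_, ?_⟩⟩
  · have := (h2 k hk).1
    rw [hgpe k hkη] at this
    simp only [polar_eq] at this
    simp only [cauchyCol, coefC]
    linear_combination this
  · have := (h3 k hk).1
    simp only [polar_eq] at this
    simp only [cauchyCol, coefC]
    linear_combination this
  · have hkη : ∀ n, k ≠ eta kn n := fun n e =>
      hne (fun h => notMem_DminusC_of_Dplus h (Dminus_subset hk)) ⟨n, e.symm⟩
    have hsum := HasDerivAt.fun_sum (u := Finset.univ) fun n _ =>
      hasDerivAt_polar (aNorm q (eta kn n) * Complex.exp (-2 * Complex.I * theta x t (eta kn n)) *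
        muMinus q 1 x t (eta kn n) i)
        (aNorm q (eta kn n) * Complex.exp (-2 * Complex.I * theta x t (eta kn n)) *
      (muMinus' q 1 x t (eta kn n) i + coefD q x t (eta kn n) * muMinus q 1 x t (eta kn n) i))
        (hkη n)
    have hμ := hasDerivAt_pi.1 (HolAsymp.differentiableAt_vec (muMinus_zero_holAsymp hq x t)
      isOpen_Dminus hk).hasDerivAt i
    -- Two expressions for one derivative: termwise, from the subtracted column, and as the
    -- differentiated Cauchy integral.
    have := ((hμ.sub_const (expSigma (vMinus q x t : ℂ) i 0)).fun_sub hsum).unique (h3 k hk).2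
    simp only [polar_deriv_eq, Finset.sum_neg_distrib] at this
    rw [show muMinus' q 0 x t k i = deriv (fun z => muMinus q 0 x t z) k i from rfl]
    simp only [cauchyCol, coefC]
    linear_combination this

/-- The same argument with the sides exchanged: the poles are now those of `μ₊₂/s₂₂` at `η_n^*` in
`D⁻`, while `μ₋₂` is holomorphic in `D⁺`. -/
theorem second_column (hq : IsSolutionZBC q) (hsing : NoSpectralSingularity q)
    (hkn : HasDoubleZeros q kn) (x t : ℝ) (i : Fin 2) :
    (∀ k ∉ Sig, ∀ m : ℕ, m = 1 ∨ m = 2 →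
      SigIntegrable fun ζ => mPlusJ q x t ζ i 1 / (ζ - k) ^ m) ∧
    (∀ k ∈ Dminus, (k ∉ Set.range fun n => conj (eta kn n)) →
      (s22 q k)⁻¹ * muPlus q 1 x t k i =
      expSigma (vMinus q x t : ℂ) i 1 + cauchyCol q x t 1 k 1 i +
        ∑ n, coefChat q x t (conj (eta kn n)) k * (muMinus' q 0 x t (conj (eta kn n)) i +
          (coefDhat q x t (conj (eta kn n)) + 1 / (k - conj (eta kn n))) *
            muMinus q 0 x t (conj (eta kn n)) i)) ∧
    ∀ k ∈ Dplus, muMinus q 1 x t k i =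
      expSigma (vMinus q x t : ℂ) i 1 + cauchyCol q x t 1 k 1 i +
        ∑ n, coefChat q x t (conj (eta kn n)) k * (muMinus' q 0 x t (conj (eta kn n)) i +
          (coefDhat q x t (conj (eta kn n)) + 1 / (k - conj (eta kn n))) *
            muMinus q 0 x t (conj (eta kn n)) i) ∧
      muMinus' q 1 x t k i = cauchyCol q x t 2 k 1 i -
        ∑ n, coefChat q x t (conj (eta kn n)) k / (k - conj (eta kn n)) *
          (muMinus' q 0 x t (conj (eta kn n)) i +
          (coefDhat q x t (conj (eta kn n)) + 2 / (k - conj (eta kn n))) *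
            muMinus q 0 x t (conj (eta kn n)) i) := by
  have hmem : ∀ n, conj (eta kn n) ∈ Dminus := fun n => conj_mem_Dminus (hkn.eta_mem n)
  have hinj : Function.Injective fun n => conj (eta kn n) :=
    (starRingEnd ℂ).injective.comp hkn.eta_injective
  obtain ⟨hc, hd, ho⟩ := mMinus_one_props hq hsing hkn x t i
  obtain ⟨gm, hgm, hgme⟩ := exists_decayingHol_of_poles isOpen_Dminus hmem
    hinj hc hd ho fun n => polarPart_minus hq x t (hmem n)
      ((hkn.s22_eq_zero hq (hmem n)).2 ⟨n, rfl⟩) (hkn.deriv_conj_eta hq n).1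
      (hkn.deriv_conj_eta hq n).2 i
  have hM := muMinus_one_holAsymp hq x t i
  rw [← expSigma_one] at hM
  have hgp := decayingHol_sub_polar Dplus_subset
    (fun n => notMem_DplusC_of_Dminus (hmem n)) hM
    (fun n => aNorm q (conj (eta kn n)) *
      Complex.exp (2 * Complex.I * theta x t (conj (eta kn n))) *
      muMinus q 0 x t (conj (eta kn n)) i)
    (fun n => aNorm q (conj (eta kn n)) *
      Complex.exp (2 * Complex.I * theta x t (conj (eta kn n))) *
      (muMinus' q 0 x t (conj (eta kn n)) i +
        coefDhat q x t (conj (eta kn n)) * muMinus q 0 x t (conj (eta kn n)) i))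
  have hne : ∀ {k}, k ∉ Dminus → k ∉ Set.range fun n => conj (eta kn n) := by
    rintro k hk ⟨n, rfl⟩
    exact hk (hmem n)
  obtain ⟨h1, h2, h3⟩ := cauchy_of_jump (J := fun ζ => mPlusJ q x t ζ i 1) hgp hgm
    fun z hz => by
      rw [hgme z (hne fun h => notMem_Sig_of_Dminus h hz), mPlusJ_eq hq hsing x t hz, mPlus,
        mMinus, cols_one, cols_one, Pi.smul_apply, smul_eq_mul]
      ring
  refine ⟨h1, fun k hk hkη => ?_, fun k hk => ⟨?_, ?_⟩⟩
  · have := (h3 k hk).1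
    rw [hgme k hkη] at this
    simp only [polar_eq] at this
    simp only [cauchyCol, coefChat]
    linear_combination this
  · have := (h2 k hk).1
    simp only [polar_eq] at this
    simp only [cauchyCol, coefChat]
    linear_combination this
  · have hkη : ∀ n, k ≠ conj (eta kn n) := fun n e =>
      hne (fun h => notMem_DplusC_of_Dminus h (Dplus_subset hk)) ⟨n, e.symm⟩
    have hsum := HasDerivAt.fun_sum (u := Finset.univ) fun n _ =>
      hasDerivAt_polar (aNorm q (conj (eta kn n)) *
        Complex.exp (2 * Complex.I * theta x t (conj (eta kn n))) *
        muMinus q 0 x t (conj (eta kn n)) i)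
        (aNorm q (conj (eta kn n)) * Complex.exp (2 * Complex.I * theta x t (conj (eta kn n))) *
      (muMinus' q 0 x t (conj (eta kn n)) i +
        coefDhat q x t (conj (eta kn n)) * muMinus q 0 x t (conj (eta kn n)) i))
        (hkη n)
    have hμ := hasDerivAt_pi.1 (HolAsymp.differentiableAt_vec (muMinus_one_holAsymp hq x t)
      isOpen_Dplus hk).hasDerivAt i
    have := ((hμ.sub_const (expSigma (vMinus q x t : ℂ) i 1)).fun_sub hsum).unique (h2 k hk).2
    simp only [polar_deriv_eq, Finset.sum_neg_distrib] at this
    rw [show muMinus' q 1 x t k i = deriv (fun z => muMinus q 1 x t z) k i from rfl]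
    simp only [cauchyCol, coefChat]
    linear_combination this

/-! ### The Riemann–Hilbert problem -/

theorem rhpM_plus (q : ℝ → ℝ → ℂ) (x t : ℝ) {k : ℂ} (hk : k ∈ Dplus) :
    rhpM q x t k = mPlus q x t k := if_pos hk

theorem rhpM_minus (q : ℝ → ℝ → ℂ) (x t : ℝ) {k : ℂ} (hk : k ∈ Dminus) :
    rhpM q x t k = mMinus q x t k := if_neg (not_lt.2 (Dminus_subset hk))

theorem mPlus_zero (q : ℝ → ℝ → ℂ) (x t : ℝ) (k : ℂ) (i : Fin 2) :
    mPlus q x t k i 0 = (s11 q k)⁻¹ * muPlus q 0 x t k i := by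
  rw [mPlus, cols_zero, Pi.smul_apply, smul_eq_mul]

theorem mPlus_one (q : ℝ → ℝ → ℂ) (x t : ℝ) (k : ℂ) (i : Fin 2) :
    mPlus q x t k i 1 = muMinus q 1 x t k i := by
  rw [mPlus, cols_one]

theorem mMinus_zero (q : ℝ → ℝ → ℂ) (x t : ℝ) (k : ℂ) (i : Fin 2) :
    mMinus q x t k i 0 = muMinus q 0 x t k i := by
  rw [mMinus, cols_zero]

theorem mMinus_one (q : ℝ → ℝ → ℂ) (x t : ℝ) (k : ℂ) (i : Fin 2) :
    mMinus q x t k i 1 = (s22 q k)⁻¹ * muPlus q 1 x t k i := by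
  rw [mMinus, cols_one, Pi.smul_apply, smul_eq_mul]

theorem isRHPSolution (hq : IsSolutionZBC q) (hsing : NoSpectralSingularity q)
    (hkn : HasDoubleZeros q kn) (x t : ℝ) :
    IsRHPSolution (discreteSpectrum kn) (rhpJ q x t) (expSigma (vMinus q x t : ℂ))
      (rhpM q x t) (mPlus q x t) (mMinus q x t) := by
  have hmem : ∀ n, conj (eta kn n) ∈ Dminus := fun n => conj_mem_Dminus (hkn.eta_mem n)
  have hp0 := mPlus_zero_props hq hsing hkn x t
  have hm1 := mMinus_one_props hq hsing hkn x t
  have hp1 := muMinus_one_holAsymp hq x t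
  have hm0 := muMinus_zero_holAsymp hq x t
  have evp : ∀ k ∈ Dplus, ∀ i j, (fun z => mPlus q x t z i j) =ᶠ[𝓝 k] fun z => rhpM q x t z i j :=
    fun k hk i j => by
      filter_upwards [isOpen_Dplus.mem_nhds hk] with z hz
      rw [rhpM_plus q x t hz]
  have evm : ∀ k ∈ Dminus, ∀ i j,
      (fun z => mMinus q x t z i j) =ᶠ[𝓝 k] fun z => rhpM q x t z i j := fun k hk i j => by
    filter_upwards [isOpen_Dminus.mem_nhds hk] with z hz
    rw [rhpM_minus q x t hz]
  refine ⟨?_, ?_, ?_, ?_, fun k hk => mMinus_eq hq hsing x t hk, fun i j => ?_⟩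
  · rintro k ⟨hk | hk, hkK⟩ i j
    · refine AnalyticAt.congr ?_ (evp k hk i j)
      rw [mem_discreteSpectrum_iff, not_or] at hkK
      fin_cases j
      · simp only [Fin.zero_eta, mPlus_zero]
        exact (hp0 i).2.1.analyticAt ((isOpen_Dplus.inter
          (Set.finite_range (eta kn)).isClosed.isOpen_compl).mem_nhds ⟨hk, hkK.1⟩)
      · simp only [Fin.mk_one, mPlus_one]
        exact (hp1 i).analyticAt isOpen_Dplus hk
    · refine AnalyticAt.congr ?_ (evm k hk i j)
      rw [mem_discreteSpectrum_iff, not_or] at hkK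
      fin_cases j
      · simp only [Fin.zero_eta, mMinus_zero]
        exact (hm0 i).analyticAt isOpen_Dminus hk
      · simp only [Fin.mk_one, mMinus_one]
        refine (hm1 i).2.1.analyticAt ((isOpen_Dminus.inter
          (Set.finite_range fun n => conj (eta kn n)).isClosed.isOpen_compl).mem_nhds ⟨hk, ?_⟩)
        rintro ⟨n, hn⟩
        exact hkK.2 ⟨n, by simp only [← hn, Complex.conj_conj]⟩
  · intro k hk
    rcases (mem_discreteSpectrum_iff kn k).1 hk with ⟨n, rfl⟩ | ⟨n, hn⟩
    · have hη := hkn.eta_mem n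
      have key := fun i => neg_two_le_meromorphicOrderAt_div
        ((muPlus_zero_holAsymp hq x t i).analyticAt isOpen_Dplus hη)
        ((s11_holAsymp hq x t).analyticAt isOpen_Dplus hη)
        ((hkn.s11_eq_zero hq hη).2 ⟨n, rfl⟩) (hkn.deriv_eta hq n).1 (hkn.deriv_eta hq n).2
      refine ⟨fun i j => ?_, ?_⟩
      · rw [← meromorphicOrderAt_congr ((evp _ hη i j).filter_mono nhdsWithin_le_nhds)]
        refine And.imp_left (fun h : MeromorphicAt (fun z => mPlus q x t z i j) _ =>
          h.congr ((evp _ hη i j).filter_mono nhdsWithin_le_nhds)) ?_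
        fin_cases j
        · simp only [Fin.zero_eta, mPlus_zero]
          exact ⟨((s11_holAsymp hq x t).analyticAt isOpen_Dplus hη).meromorphicAt.fun_inv.fun_mul
            ((muPlus_zero_holAsymp hq x t i).analyticAt isOpen_Dplus hη).meromorphicAt,
            (key i).1⟩
        · simp only [Fin.mk_one, mPlus_one]
          have := (hp1 i).analyticAt isOpen_Dplus hη
          exact ⟨this.meromorphicAt, le_trans (by decide) this.meromorphicOrderAt_nonneg⟩
      -- A Jost column vanishes nowhere, by uniqueness for the linear equation, so some entry of the
      -- numerator is nonzero and the pole order is exactly two.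
      · have hne : muPlus q 0 x t (eta kn n) ≠ 0 := smul_ne_zero (Complex.exp_ne_zero _)
          ((isJostColumn_phiPlus_zero hq t (Dplus_subset hη)).ne_zero hq x)
        obtain ⟨i, hi⟩ := Function.ne_iff.1 hne
        refine ⟨i, 0, ?_⟩
        rw [← meromorphicOrderAt_congr ((evp _ hη i 0).filter_mono nhdsWithin_le_nhds)]
        simp only [mPlus_zero]
        exact (key i).2 hi
    · obtain rfl : conj (eta kn n) = k := by rw [hn, Complex.conj_conj]
      have hη := hmem n
      have key := fun i => neg_two_le_meromorphicOrderAt_div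
        ((muPlus_one_holAsymp hq x t i).analyticAt isOpen_Dminus hη)
        ((s22_holAsymp hq x t).analyticAt isOpen_Dminus hη)
        ((hkn.s22_eq_zero hq hη).2 ⟨n, rfl⟩) (hkn.deriv_conj_eta hq n).1
        (hkn.deriv_conj_eta hq n).2
      refine ⟨fun i j => ?_, ?_⟩
      · rw [← meromorphicOrderAt_congr ((evm _ hη i j).filter_mono nhdsWithin_le_nhds)]
        refine And.imp_left (fun h : MeromorphicAt (fun z => mMinus q x t z i j) _ =>
          h.congr ((evm _ hη i j).filter_mono nhdsWithin_le_nhds)) ?_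
        fin_cases j
        · simp only [Fin.zero_eta, mMinus_zero]
          have := (hm0 i).analyticAt isOpen_Dminus hη
          exact ⟨this.meromorphicAt, le_trans (by decide) this.meromorphicOrderAt_nonneg⟩
        · simp only [Fin.mk_one, mMinus_one]
          exact ⟨((s22_holAsymp hq x t).analyticAt isOpen_Dminus hη).meromorphicAt.fun_inv.fun_mul
            ((muPlus_one_holAsymp hq x t i).analyticAt isOpen_Dminus hη).meromorphicAt,
            (key i).1⟩
      · have hne : muPlus q 1 x t (conj (eta kn n)) ≠ 0 := smul_ne_zero (Complex.exp_ne_zero _)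
          ((isJostColumn_phiPlus_one hq t (Dminus_subset hη)).ne_zero hq x)
        obtain ⟨i, hi⟩ := Function.ne_iff.1 hne
        refine ⟨i, 1, ?_⟩
        rw [← meromorphicOrderAt_congr ((evm _ hη i 1).filter_mono nhdsWithin_le_nhds)]
        simp only [mMinus_one]
        exact (key i).2 hi
  · intro k hk
    have hkC := mem_DplusC_of_Sig hk
    refine Tendsto.congr' (f₁ := mPlus q x t) ?_ ?_
    · filter_upwards [self_mem_nhdsWithin] with z hz using (rhpM_plus q x t hz).symm
    · refine tendsto_pi_nhds.2 fun i => tendsto_pi_nhds.2 fun j => ?_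
      refine Tendsto.mono_left ?_ (nhdsWithin_mono k Dplus_subset)
      fin_cases j
      · simp only [Fin.zero_eta, mPlus_zero]
        exact (((s11_holAsymp hq x t).cont k hkC).inv₀ (hsing k hk).1).mul
          ((muPlus_zero_holAsymp hq x t i).cont k hkC)
      · simp only [Fin.mk_one, mPlus_one]
        exact (hp1 i).cont k hkC
  · intro k hk
    have hkC := mem_DminusC_of_Sig hk
    refine Tendsto.congr' (f₁ := mMinus q x t) ?_ ?_
    · filter_upwards [self_mem_nhdsWithin] with z hz using (rhpM_minus q x t hz).symm
    · refine tendsto_pi_nhds.2 fun i => tendsto_pi_nhds.2 fun j => ?_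
      refine Tendsto.mono_left ?_ (nhdsWithin_mono k Dminus_subset)
      fin_cases j
      · simp only [Fin.zero_eta, mMinus_zero]
        exact (hm0 i).cont k hkC
      · simp only [Fin.mk_one, mMinus_one]
        exact (((s22_holAsymp hq x t).cont k hkC).inv₀ (hsing k hk).2).mul
          ((muPlus_one_holAsymp hq x t i).cont k hkC)
  · rw [← sup_principal, inf_sup_left]
    refine Asymptotics.IsBigO.sup ?_ ?_
    · have h : (fun k => mPlus q x t k i j - expSigma (vMinus q x t : ℂ) i j)
          =O[atInf DplusC] fun k => k⁻¹ := by
        fin_cases j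
        · simp only [Fin.zero_eta, mPlus_zero]
          exact (hp0 i).2.2
        · simp only [Fin.mk_one, mPlus_one, expSigma_one]
          exact (hp1 i).asymp
      refine (h.mono (inf_le_inf_left _ (principal_mono.2 Dplus_subset))).congr' ?_ EventuallyEq.rfl
      filter_upwards [mem_inf_of_right (mem_principal_self Dplus)] with z hz
      rw [rhpM_plus q x t hz]
    · have h : (fun k => mMinus q x t k i j - expSigma (vMinus q x t : ℂ) i j)
          =O[atInf DminusC] fun k => k⁻¹ := by
        fin_cases j
        · simp only [Fin.zero_eta, mMinus_zero, expSigma_zero]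
          exact (hm0 i).asymp
        · simp only [Fin.mk_one, mMinus_one]
          exact (hm1 i).2.2
      refine (h.mono (inf_le_inf_left _ (principal_mono.2 Dminus_subset))).congr' ?_
        EventuallyEq.rfl
      filter_upwards [mem_inf_of_right (mem_principal_self Dminus)] with z hz
      rw [rhpM_minus q x t hz]

theorem mulVec_single_zero (A : Matrix (Fin 2) (Fin 2) ℂ) (i : Fin 2) :
    (A *ᵥ ![1, 0]) i = A i 0 := by
  simp [Matrix.mulVec, dotProduct]

theorem mulVec_single_one (A : Matrix (Fin 2) (Fin 2) ℂ) (i : Fin 2) :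
    (A *ᵥ ![0, 1]) i = A i 1 := by
  simp [Matrix.mulVec, dotProduct]

end DNLS

end

/-! ### The matrix statement, assembled from its two columns entry by entry. -/

theorem mainTheorem6 (q : ℝ → ℝ → ℂ) (hq : DNLS.IsSolutionZBC q)
    (hsing : DNLS.NoSpectralSingularity q)
    (N : ℕ) (kn : Fin N → ℂ) (hkn : DNLS.HasDoubleZeros q kn) (x t : ℝ) :
    -- `M` is a solution of the Riemann–Hilbert problem
    DNLS.IsRHPSolution (DNLS.discreteSpectrum kn) (DNLS.rhpJ q x t)
      (DNLS.expSigma (DNLS.vMinus q x t : ℂ))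
      (DNLS.rhpM q x t) (DNLS.mPlus q x t) (DNLS.mMinus q x t) ∧
    -- the Cauchy integrals converge and the derivatives exist
    (∀ k : ℂ, k ∉ DNLS.Sig → ∀ m : ℕ, m = 1 ∨ m = 2 → ∀ i j : Fin 2,
      DNLS.SigIntegrable fun ζ => DNLS.mPlusJ q x t ζ i j / (ζ - k) ^ m) ∧
    (∀ n, DifferentiableAt ℂ (fun z => DNLS.muMinus q 0 x t z) (conj (DNLS.eta kn n)) ∧
      DifferentiableAt ℂ (fun z => DNLS.muMinus q 1 x t z) (DNLS.eta kn n)) ∧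
    -- the formula for `M`
    (∀ k : ℂ, k ∉ DNLS.Sig → k ∉ DNLS.discreteSpectrum kn →
      DNLS.rhpM q x t k =
        DNLS.expSigma (DNLS.vMinus q x t : ℂ)
        + DNLS.cols (DNLS.cauchyCol q x t 1 k 0) (DNLS.cauchyCol q x t 1 k 1)
        + ∑ n, DNLS.cols
            (DNLS.coefC q x t (DNLS.eta kn n) k •
              (DNLS.muMinus' q 1 x t (DNLS.eta kn n)
                + (DNLS.coefD q x t (DNLS.eta kn n) + 1 / (k - DNLS.eta kn n)) •
                  DNLS.muMinus q 1 x t (DNLS.eta kn n)))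
            (DNLS.coefChat q x t (conj (DNLS.eta kn n)) k •
              (DNLS.muMinus' q 0 x t (conj (DNLS.eta kn n))
                + (DNLS.coefDhat q x t (conj (DNLS.eta kn n))
                    + 1 / (k - conj (DNLS.eta kn n))) •
                  DNLS.muMinus q 0 x t (conj (DNLS.eta kn n))))) ∧
    -- the closed linear system
    (∀ n,
      DNLS.muMinus q 0 x t (conj (DNLS.eta kn n)) =
        DNLS.expSigma (DNLS.vMinus q x t : ℂ) *ᵥ ![1, 0]
        + ∑ l, DNLS.coefC q x t (DNLS.eta kn l) (conj (DNLS.eta kn n)) •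
            (DNLS.muMinus' q 1 x t (DNLS.eta kn l)
              + (DNLS.coefD q x t (DNLS.eta kn l)
                  + 1 / (conj (DNLS.eta kn n) - DNLS.eta kn l)) •
                DNLS.muMinus q 1 x t (DNLS.eta kn l))
        + DNLS.cauchyCol q x t 1 (conj (DNLS.eta kn n)) 0) ∧
    (∀ n,
      DNLS.muMinus' q 0 x t (conj (DNLS.eta kn n)) =
        - ∑ l, (DNLS.coefC q x t (DNLS.eta kn l) (conj (DNLS.eta kn n))
              / (conj (DNLS.eta kn n) - DNLS.eta kn l)) •
            (DNLS.muMinus' q 1 x t (DNLS.eta kn l)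
              + (DNLS.coefD q x t (DNLS.eta kn l)
                  + 2 / (conj (DNLS.eta kn n) - DNLS.eta kn l)) •
                DNLS.muMinus q 1 x t (DNLS.eta kn l))
        + DNLS.cauchyCol q x t 2 (conj (DNLS.eta kn n)) 0) ∧
    (∀ n,
      DNLS.muMinus q 1 x t (DNLS.eta kn n) =
        DNLS.expSigma (DNLS.vMinus q x t : ℂ) *ᵥ ![0, 1]
        + ∑ j, DNLS.coefChat q x t (conj (DNLS.eta kn j)) (DNLS.eta kn n) •
            (DNLS.muMinus' q 0 x t (conj (DNLS.eta kn j))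
              + (DNLS.coefDhat q x t (conj (DNLS.eta kn j))
                  + 1 / (DNLS.eta kn n - conj (DNLS.eta kn j))) •
                DNLS.muMinus q 0 x t (conj (DNLS.eta kn j)))
        + DNLS.cauchyCol q x t 1 (DNLS.eta kn n) 1) ∧
    (∀ n,
      DNLS.muMinus' q 1 x t (DNLS.eta kn n) =
        - ∑ j, (DNLS.coefChat q x t (conj (DNLS.eta kn j)) (DNLS.eta kn n)
              / (DNLS.eta kn n - conj (DNLS.eta kn j))) •
            (DNLS.muMinus' q 0 x t (conj (DNLS.eta kn j))
              + (DNLS.coefDhat q x t (conj (DNLS.eta kn j))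
                  + 2 / (DNLS.eta kn n - conj (DNLS.eta kn j))) •
                DNLS.muMinus q 0 x t (conj (DNLS.eta kn j)))
        + DNLS.cauchyCol q x t 2 (DNLS.eta kn n) 1) := by
  have hmem : ∀ n, conj (DNLS.eta kn n) ∈ DNLS.Dminus := fun n =>
    DNLS.conj_mem_Dminus (hkn.eta_mem n)
  have h1 := DNLS.first_column hq hsing hkn x t
  have h2 := DNLS.second_column hq hsing hkn x t
  refine ⟨DNLS.isRHPSolution hq hsing hkn x t, fun k hk m hm i j => ?_, fun n => ⟨?_, ?_⟩,
    fun k hk hkK => ?_, fun n => ?_, fun n => ?_, fun n => ?_, fun n => ?_⟩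
  · fin_cases j
    · exact (h1 i).1 k hk m hm
    · exact (h2 i).1 k hk m hm
  · exact DNLS.HolAsymp.differentiableAt_vec (DNLS.muMinus_zero_holAsymp hq x t)
      DNLS.isOpen_Dminus (hmem n)
  · exact DNLS.HolAsymp.differentiableAt_vec (DNLS.muMinus_one_holAsymp hq x t)
      DNLS.isOpen_Dplus (hkn.eta_mem n)
  · rw [DNLS.mem_discreteSpectrum_iff, not_or] at hkK
    ext i j
    rw [Matrix.add_apply, Matrix.add_apply, Matrix.sum_apply]
    rcases DNLS.pos_or_neg_of_notMem_Sig hk with hk | hk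
    · rw [DNLS.rhpM_plus q x t hk]
      fin_cases j
      · simp only [Fin.zero_eta, DNLS.cols_zero, DNLS.mPlus_zero]
        exact (h1 i).2.1 k hk hkK.1
      · simp only [Fin.mk_one, DNLS.cols_one, DNLS.mPlus_one]
        exact ((h2 i).2.2 k hk).1
    · rw [DNLS.rhpM_minus q x t hk]
      fin_cases j
      · simp only [Fin.zero_eta, DNLS.cols_zero, DNLS.mMinus_zero]
        exact ((h1 i).2.2 k hk).1
      · simp only [Fin.mk_one, DNLS.cols_one, DNLS.mMinus_one]
        refine (h2 i).2.1 k hk ?_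
        rintro ⟨n, hn⟩
        exact hkK.2 ⟨n, by simp only [← hn, Complex.conj_conj]⟩
  · ext i
    simp only [Pi.add_apply, Finset.sum_apply, Pi.smul_apply, smul_eq_mul,
      DNLS.mulVec_single_zero]
    rw [((h1 i).2.2 _ (hmem n)).1]
    ring
  · ext i
    simp only [Pi.add_apply, Pi.neg_apply, Finset.sum_apply, Pi.smul_apply, smul_eq_mul]
    rw [((h1 i).2.2 _ (hmem n)).2]
    ring
  · ext i
    simp only [Pi.add_apply, Finset.sum_apply, Pi.smul_apply, smul_eq_mul,
      DNLS.mulVec_single_one]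
    rw [((h2 i).2.2 _ (hkn.eta_mem n)).1]
    ring
  · ext i
    simp only [Pi.add_apply, Pi.neg_apply, Finset.sum_apply, Pi.smul_apply, smul_eq_mul]
    rw [((h2 i).2.2 _ (hkn.eta_mem n)).2]
    ring
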